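/- Let $n\ge 1$, let $(M,\omega)$ be a symplectic manifold of dimension $2n$ and $H\in C^\infty(M)$. For $f\in C^\infty(M)$ let $X_f$ be the vector field with $\omega(X_f,\cdot)=df$, let $\{f,g\}=\omega(X_f,X_g)$, and let $\Omega=\omega^n/n!$. Functions are called functionally independent if their differentials are linearly independent at every point of $M$. Let $(f_1,\dots,f_{2n-2})$ be a Poisson $C^\infty$-structure for $(M,H)$: with $f_0:=H$, the functions $f_0,\dots,f_{2n-2}$ are functionally independent and, for $0\le i<j\le 2n-2$, $\{f_j,f_i\}=F_{ji}(f_0,\dots,f_j)$ for some smooth function $F_{ji}$ defined on an open set containing all values of $(f_0,\dots,f_j)$. Let $f_{2n-1}\in C^\infty(M)$ be such that $f_0,\dots,f_{2n-1}$ are functionally independent. Put $\mathbf F=(\{f_a,f_b\})_{0\le a,b\le 2n-1}$ and, for $1\le i\le 2n-1$, $$\omega_i=\sum_{\substack{k=0\\ k\ne i}}^{2n-1}(-1)^k\operatorname{sgn}(i-k)\,\operatorname{Pf}(\mathbf F_{\widehat{i,k}})\,df_k,$$ where $\mathbf F_{\widehat{i,k}}$ is $\mathbf F$ with the rows and columns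 of index $i$ and $k$ removed, and $\operatorname{Pf}(A)=\frac1{2^m m!}\sum_{\sigma\in S_{2m}}\operatorname{sgn}(\sigma)\prod_{l=1}^m a_{\sigma(2l-1),\sigma(2l)}$ for a $2m\times 2m$ matrix $A$ (so $\operatorname{Pf}=1$ for $m=0$). Then the Hamiltonian system can be locally integrated by successively solving the Pfaffian equations $\omega_{2n-1}\equiv0,\dots,\omega_1\equiv0$. Precisely: 1. $\omega_i(Z)=\Omega(X_{f_0},\dots,\widehat{X_{f_i}},\dots,X_{f_{2n-1}},Z)$ for every tangent vector $Z$ and $1\le i\le 2n-1$. 2. The $\omega_i$ are smooth, linearly independent at every point, and their common kernel at $x$ is $\langle X_H(x)\rangle$. 3. For each $i$ there are smooth 1-forms $\beta_j$ on $M$ with $d\omega_i=\sum_{j=i}^{2n-1}\beta_j\wedge\omega_j$. 4. For $U\subseteq M$ open, functions $I_{k+1},\dots,I_{2n-1}$ and constants $c_j$, call a smooth function $g$ on $U$ a solution of the $k$-th equation on $\Sigma=\{x\in U: I_j(x)=c_j,\ j>k\}$ if, at every $x\in\Sigma$, on the space $\bigcap_{j>k}\ker dI_j(x)$ (the tangent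 space of $\Sigma$) $dg$ is nonzero and $\omega_k\wedge dg=0$. If $U$ is open and, for each $j>k$, $I_j$ is a solution of the $j$-th equation on $\{x\in U: I_l(x)=c_l,\ l>j\}$, then every $p\in\Sigma$ has an open neighbourhood $V\subseteq U$ with a smooth function on $V$ that is a solution of the $k$-th equation on $\Sigma\cap V$. 5. Every point of $M$ has an open neighbourhood $U$ with functions $I_1,\dots,I_{2n-1}$ on $U$ such that, for all constants $c$ and all $k$, $I_k$ is a solution of the $k$-th equation on $\{x\in U:I_j(x)=c_j,\ j>k\}$. 6. If $U$ is open and, for given constants $c$, each $I_k$ ($1\le k\le 2n-1$) is a solution of the $k$-th equation on $\{x\in U:I_j(x)=c_j,\ j>k\}$, then $N=\{x\in U: I_k(x)=c_k,\ 1\le k\le 2n-1\}$ is an integral manifold of $\langle X_H\rangle$: for $p\in N$, $\bigcap_k\ker dI_k(p)=\langle X_H(p)\rangle$, and there are an open neighbourhood $V\subseteq U$ of $p$, $\varepsilon>0$ and an integral curve $\gamma:(-\varepsilon,\varepsilon)\to M$ of $X_H$ with $\gamma(0)=p$ and $N\cap V=\gamma((-\varepsilon,\varepsilon))$. -/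

import Mathlib

open Set
open scoped Manifold ContDiff Topology Nat

noncomputable section

/-! ### Linear algebra: Pfaffian, wedge product, powers of a 2-form -/

/-- The Pfaffian of a `2m × 2m` matrix,
`(1 / (2^m m!)) ∑_σ sgn σ ∏_k a_{σ(2k-1), σ(2k)}` (rows and columns are indexed from `0` here). -/
def pfaffian {m : ℕ} (A : Matrix (Fin (2 * m)) (Fin (2 * m)) ℝ) : ℝ :=
  (1 / (2 ^ m * (m ! : ℝ))) *
    ∑ σ : Equiv.Perm (Fin (2 * m)), ((Equiv.Perm.sign σ : ℤ) : ℝ) *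
      ∏ k : Fin m, A (σ ⟨2 * k, by omega⟩) (σ ⟨2 * k + 1, by omega⟩)

/-- The wedge product of alternating forms (a signed sum over shuffles). -/
def wedge {V : Type*} [AddCommGroup V] [Module ℝ V] {k l : ℕ}
    (a : V [⋀^Fin k]→ₗ[ℝ] ℝ) (b : V [⋀^Fin l]→ₗ[ℝ] ℝ) : V [⋀^Fin (k + l)]→ₗ[ℝ] ℝ :=
  ((LinearMap.mul' ℝ ℝ).compAlternatingMap (a.domCoprod b)).domDomCongr finSumFinEquiv

/-- The `n`-th exterior power `a ∧ ⋯ ∧ a` of a 2-form `a`. -/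
def wedgePow {V : Type*} [AddCommGroup V] [Module ℝ V] (a : V [⋀^Fin 2]→ₗ[ℝ] ℝ) :
    (n : ℕ) → V [⋀^Fin (2 * n)]→ₗ[ℝ] ℝ
  | 0 => (AlternatingMap.constOfIsEmpty ℝ V (Fin 0) (1 : ℝ) : V [⋀^Fin 0]→ₗ[ℝ] ℝ)
  | n + 1 => wedge (wedgePow a n) a

/-! ### Differential forms on a manifold -/

section Forms

variable {d : ℕ} {M : Type*} [TopologicalSpace M] [ChartedSpace (EuclideanSpace ℝ (Fin d)) M]

variable (d M) in
/-- (Not necessarily smooth) differential `k`-forms on a `d`-dimensional manifold. -/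
abbrev DForm (k : ℕ) : Type _ := (x : M) → TangentSpace (𝓡 d) x [⋀^Fin k]→L[ℝ] ℝ

variable (d M) in
/-- (Not necessarily smooth) 1-forms, as fields of covectors. -/
abbrev OneForm : Type _ := (x : M) → TangentSpace (𝓡 d) x →L[ℝ] ℝ

/-- A field of covectors as a differential form of degree 1. -/
def OneForm.toDForm (α : OneForm d M) : DForm d M 1 :=
  fun x => ContinuousAlternatingMap.ofSubsingleton ℝ (TangentSpace (𝓡 d) x) ℝ (0 : Fin 1) (α x)

/-- The expression of a form in the preferred chart at `x₀`, i.e. its pullback under the inverse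
of that chart. -/
def DForm.chartRep {k : ℕ} (α : DForm d M k) (x₀ : M) (y : EuclideanSpace ℝ (Fin d)) :
    EuclideanSpace ℝ (Fin d) [⋀^Fin k]→L[ℝ] ℝ :=
  (α ((extChartAt (𝓡 d) x₀).symm y)).compContinuousLinearMap
    (mfderiv 𝓘(ℝ, EuclideanSpace ℝ (Fin d)) (𝓡 d) (extChartAt (𝓡 d) x₀).symm y)

/-- A form is smooth if its expressions in charts are. -/
def DForm.IsSmooth {k : ℕ} (α : DForm d M k) : Prop :=
  ∀ x₀ : M, ContDiffOn ℝ ∞ (α.chartRep x₀) (extChartAt (𝓡 d) x₀).target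

/-- The exterior derivative of a form: at `x`, it is computed in the preferred chart at `x`. -/
def DForm.extD {k : ℕ} (α : DForm d M k) : DForm d M (k + 1) := fun x =>
  (extDeriv (α.chartRep x) (extChartAt (𝓡 d) x x)).compContinuousLinearMap
    (mfderiv (𝓡 d) 𝓘(ℝ, EuclideanSpace ℝ (Fin d)) (extChartAt (𝓡 d) x) x)

/-- Functional independence: the differentials are linearly independent at every point. -/
def FunctionallyIndependent {N : ℕ} (f : Fin N → C^∞⟮𝓡 d, M; 𝓘(ℝ), ℝ⟯) : Prop :=
  ∀ x : M, LinearIndependent ℝ (fun k : Fin N => mvfderiv (𝓡 d) (f k) x)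

end Forms

/-! ### Symplectic manifolds and Hamiltonian vector fields -/

/-- A symplectic form on a `2n`-dimensional manifold. -/
structure SymplecticForm (n : ℕ) (M : Type*) [TopologicalSpace M]
    [ChartedSpace (EuclideanSpace ℝ (Fin (2 * n))) M] where
  toForm : DForm (2 * n) M 2
  smooth : toForm.IsSmooth
  closed : ∀ x : M, toForm.extD x = 0
  nondegenerate : ∀ (x : M) (v : TangentSpace (𝓡 (2 * n)) x),
    (∀ w : TangentSpace (𝓡 (2 * n)) x, toForm x ![v, w] = 0) → v = 0

namespace SymplecticForm

variable {n : ℕ} {M : Type*} [TopologicalSpace M]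
  [ChartedSpace (EuclideanSpace ℝ (Fin (2 * n))) M]

/-- The contraction map `v ↦ v ⌟ ω = ω(v, ·)` at a point. -/
def flat (S : SymplecticForm n M) (x : M) :
    TangentSpace (𝓡 (2 * n)) x →ₗ[ℝ] Module.Dual ℝ (TangentSpace (𝓡 (2 * n)) x) :=
  have h₀ (a v w : TangentSpace (𝓡 (2 * n)) x) : Function.update ![a, w] 0 v = ![v, w] := by
    funext i; fin_cases i <;> rfl
  have h₁ (a v w : TangentSpace (𝓡 (2 * n)) x) : Function.update ![v, a] 1 w = ![v, w] := by
    funext i; fin_cases i <;> rfl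
  LinearMap.mk₂ ℝ (fun v w => S.toForm x ![v, w])
    (fun u v w => by simpa only [h₀] using (S.toForm x).map_update_add ![u, w] 0 u v)
    (fun c v w => by simpa only [h₀] using (S.toForm x).map_update_smul ![v, w] 0 c v)
    (fun u v w => by simpa only [h₁] using (S.toForm x).map_update_add ![u, v] 1 v w)
    (fun c v w => by simpa only [h₁] using (S.toForm x).map_update_smul ![v, w] 1 c w)

theorem flat_apply (S : SymplecticForm n M) (x : M) (v w : TangentSpace (𝓡 (2 * n)) x) :
    S.flat x v w = S.toForm x ![v, w] := rfl

theorem flat_bijective (S : SymplecticForm n M) (x : M) : Function.Bijective (S.flat x) := by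
  have : FiniteDimensional ℝ (TangentSpace (𝓡 (2 * n)) x) :=
    inferInstanceAs (FiniteDimensional ℝ (EuclideanSpace ℝ (Fin (2 * n))))
  have hinj : Function.Injective (S.flat x) := by
    rw [injective_iff_map_eq_zero]
    intro v hv
    refine S.nondegenerate x v fun w => ?_
    rw [← flat_apply, hv, LinearMap.zero_apply]
  exact ⟨hinj, (LinearMap.injective_iff_surjective_of_finrank_eq_finrank
    Subspace.dual_finrank_eq.symm).1 hinj⟩

/-- The Hamiltonian vector field of `f`, defined by `X_f ⌟ ω = df`. -/
def hamVF (S : SymplecticForm n M) (f : M → ℝ) (x : M) : TangentSpace (𝓡 (2 * n)) x :=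
  (LinearEquiv.ofBijective (S.flat x) (S.flat_bijective x)).symm
    (mvfderiv (𝓡 (2 * n)) f x).toLinearMap

theorem hamVF_spec (S : SymplecticForm n M) (f : M → ℝ) (x : M)
    (w : TangentSpace (𝓡 (2 * n)) x) :
    S.toForm x ![S.hamVF f x, w] = mvfderiv (𝓡 (2 * n)) f x w :=
  LinearMap.congr_fun ((LinearEquiv.ofBijective (S.flat x) (S.flat_bijective x)).apply_symm_apply
    (mvfderiv (𝓡 (2 * n)) f x).toLinearMap) w

/-- The Poisson bracket `{f, g} = ω(X_f, X_g)`. -/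
def bracket (S : SymplecticForm n M) (f g : M → ℝ) (x : M) : ℝ :=
  S.toForm x ![S.hamVF f x, S.hamVF g x]

/-- The Liouville volume form `Ω = ω^n / n!`. -/
def liouville (S : SymplecticForm n M) (x : M) :
    TangentSpace (𝓡 (2 * n)) x [⋀^Fin (2 * n)]→ₗ[ℝ] ℝ :=
  (1 / (n ! : ℝ)) • wedgePow (S.toForm x).toAlternatingMap n

end SymplecticForm

/-! ### Poisson `C^∞`-structures and their Pfaffian forms, in dimension `2n` with `n = m + 1` -/

section Poisson

variable {m : ℕ} {M : Type*} [TopologicalSpace M]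
  [ChartedSpace (EuclideanSpace ℝ (Fin (2 * (m + 1)))) M]

/-- `(f_1, …, f_{2n-2})` is a Poisson `C^∞`-structure for `(M, H)`: with `f_0 = H`, the functions
`f_0, …, f_{2n-2}` are functionally independent and, for `i < j`, the bracket `{f_j, f_i}` is a
smooth function `F_{ji}` (on an open set `V` containing all values) of `f_0, …, f_j`. -/
def IsPoissonCInfStructure (S : SymplecticForm (m + 1) M)
    (H : C^∞⟮𝓡 (2 * (m + 1)), M; 𝓘(ℝ), ℝ⟯)
    (𝓕 : Fin (2 * m) → C^∞⟮𝓡 (2 * (m + 1)), M; 𝓘(ℝ), ℝ⟯) : Prop :=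
  let f : Fin (2 * m + 1) → C^∞⟮𝓡 (2 * (m + 1)), M; 𝓘(ℝ), ℝ⟯ := Fin.cons H 𝓕
  FunctionallyIndependent f ∧
  ∀ i j : Fin (2 * m + 1), i < j →
    ∃ (V : Set (Fin (j + 1) → ℝ)) (F : (Fin (j + 1) → ℝ) → ℝ),
      IsOpen V ∧ ContDiffOn ℝ ∞ F V ∧
      ∀ x : M, (fun k : Fin (j + 1) => f (Fin.castLE j.isLt k) x) ∈ V ∧
        S.bracket (f j) (f i) x = F (fun k : Fin (j + 1) => f (Fin.castLE j.isLt k) x)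

/-- The family `f_0 = H, f_1, …, f_{2n-2}, f_{2n-1} = g`. -/
def fullFamily (H : C^∞⟮𝓡 (2 * (m + 1)), M; 𝓘(ℝ), ℝ⟯)
    (𝓕 : Fin (2 * m) → C^∞⟮𝓡 (2 * (m + 1)), M; 𝓘(ℝ), ℝ⟯)
    (g : C^∞⟮𝓡 (2 * (m + 1)), M; 𝓘(ℝ), ℝ⟯) :
    Fin (2 * m + 1 + 1) → C^∞⟮𝓡 (2 * (m + 1)), M; 𝓘(ℝ), ℝ⟯ :=
  Fin.snoc (α := fun _ => C^∞⟮𝓡 (2 * (m + 1)), M; 𝓘(ℝ), ℝ⟯) (Fin.cons H 𝓕) g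

/-- The matrix `({f_a, f_b})_{a,b}` at a point. -/
def bracketMatrix (S : SymplecticForm (m + 1) M)
    (f : Fin (2 * m + 1 + 1) → C^∞⟮𝓡 (2 * (m + 1)), M; 𝓘(ℝ), ℝ⟯) (x : M) :
    Matrix (Fin (2 * m + 1 + 1)) (Fin (2 * m + 1 + 1)) ℝ :=
  Matrix.of fun a b => S.bracket (f a) (f b) x

/-- `ω_i = ∑_{k ≠ i} (-1)^k sgn(i - k) Pf(F with rows and columns i, k removed) df_k`.
The indices `k ≠ i` are listed as `k = i.succAbove l`, and `i.succAbove ∘ l.succAbove` lists the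
indices other than `i` and `k` in increasing order. -/
def pfaffianForm (S : SymplecticForm (m + 1) M)
    (f : Fin (2 * m + 1 + 1) → C^∞⟮𝓡 (2 * (m + 1)), M; 𝓘(ℝ), ℝ⟯) (i : Fin (2 * m + 1 + 1)) :
    OneForm (2 * (m + 1)) M := fun x =>
  ∑ l : Fin (2 * m + 1),
    ((-1 : ℝ) ^ (i.succAbove l : ℕ) * (Int.sign ((i : ℤ) - (i.succAbove l : ℤ)) : ℝ) *
      pfaffian ((bracketMatrix S f x).submatrix
        (fun a => i.succAbove (l.succAbove a)) (fun a => i.succAbove (l.succAbove a)))) •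
      mvfderiv (𝓡 (2 * (m + 1))) (f (i.succAbove l)) x

end Poisson

/-! ### Successive integration of Pfaffian equations -/

section Integration

variable {d N : ℕ} {M : Type*} [TopologicalSpace M] [ChartedSpace (EuclideanSpace ℝ (Fin d)) M]

/-- The part in `U` of the common level set `I_j = c_j`, `j > k`. -/
def levelSetAbove (I : Fin N → M → ℝ) (c : Fin N → ℝ) (U : Set M) (k : Fin N) : Set M :=
  {x ∈ U | ∀ j, k < j → I j x = c j}

/-- The vectors at `x` tangent to the common level set of the `I_j`, `j > k`. -/
def levelTangentAbove (d : ℕ) {M : Type*} [TopologicalSpace M]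
    [ChartedSpace (EuclideanSpace ℝ (Fin d)) M] (I : Fin N → M → ℝ) (k : Fin N) (x : M) :
    Set (TangentSpace (𝓡 d) x) :=
  {v | ∀ j, k < j → mvfderiv (𝓡 d) (I j) x v = 0}

/-- `g` is a solution on `U` of the Pfaffian equation `θ_k ≡ 0` restricted to the level set
`Σ = {I_j = c_j, j > k}`: `g` is smooth, and on `Σ` the restriction of `dg` has no zero and
satisfies `θ_k|_Σ ∧ dg|_Σ = 0`. -/
def SolvesPfaffian (θ : Fin N → OneForm d M) (I : Fin N → M → ℝ) (c : Fin N → ℝ) (U : Set M)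
    (k : Fin N) (g : M → ℝ) : Prop :=
  ContMDiffOn (𝓡 d) 𝓘(ℝ) ∞ g U ∧
  ∀ x ∈ levelSetAbove I c U k,
    (∃ v ∈ levelTangentAbove d I k x, mvfderiv (𝓡 d) g x v ≠ 0) ∧
    ∀ v ∈ levelTangentAbove d I k x, ∀ w ∈ levelTangentAbove d I k x,
      θ k x v * mvfderiv (𝓡 d) g x w - θ k x w * mvfderiv (𝓡 d) g x v = 0

end Integration

end

/-! The value of `ω^n / n!` on `2n` vectors is the Pfaffian of the matrix of values of `ω`.
Expanding this Pfaffian along its last column shows that `ω_i` is the Liouville form contracted with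
all `X_{f_a}`, `a ≠ i`. Hence `ω_i(X_{f_j}) = 0` for `j ≠ i` (a repeated argument) and `ω_i(X_{f_i})
≠ 0` (a volume form on a frame): forms and Hamiltonian fields are dual frames up to non-vanishing
factors. Independence and all common kernels follow; the kernel of `ω_k, …, ω_{2n-1}` is the span of
`X_{f_0}, …, X_{f_{k-1}}` (`forall_pfaffianForm_eq_zero_iff`).

Closedness of `ω` gives the Jacobi identity, hence `[X_g, X_h] = -X_{{g,h}}`. For a Poisson
structure `{f_j, f_i}` is a function of `f_0, …, f_j`, so its Hamiltonian field is a combination of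
`X_{f_0}, …, X_{f_j}`. Thus all the spans above are involutive
(`IsPoissonCInfStructure.isInvolutiveFamily`). Evaluating `dω_i` on the frame then yields the
structure equations (`exists_extD_pfaffianForm_eq`).

The Frobenius theorem (`exists_adapted_coordinates`) gives near each point, for each `r`, a function
annihilated by `X_{f_a}`, `a < r`, but not by `X_{f_r}` (`exists_first_integral`). Such a function
solves the `r`-th Pfaffian equation on every level set of solutions of the later ones. The Frobenius
theorem itself comes from the inverse function theorem in a Banach space of curves: the curves `u' =
X(u)(π t)` depend smoothly on `t`, and involutivity keeps their variations inside the distribution.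

An arbitrary solution `I_k` is controlled only on the level set of the later ones. Descending
induction (`forall_eq_zero_iff_of_proportional`) nevertheless shows that the tangent space of that
level set is the common kernel of the later forms, whichever solutions were chosen. In the end this
kernel is the line of `X_H`. A second descending induction keeps the integral curve of `X_H` in the
common level set, and one more function, a linear functional increasing along the curve, shows that
the level set contains nothing else nearby. -/

noncomputable section

open scoped BoundedContinuousFunction

/-! ### Superposition operators on spaces of continuous maps -/

namespace BoundedContinuousFunction

section Superposition

variable {K : Type*} [TopologicalSpace K] [CompactSpace K]

/-- Pointwise application of a continuous family of continuous linear maps. -/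
def applyCLM {E F : Type*} [NormedAddCommGroup E] [NormedSpace ℝ E]
    [NormedAddCommGroup F] [NormedSpace ℝ F] :
    (K →ᵇ (E →L[ℝ] F)) →L[ℝ] (K →ᵇ E) →L[ℝ] (K →ᵇ F) :=
  LinearMap.mkContinuous₂
    (LinearMap.mk₂ ℝ (fun (A : K →ᵇ (E →L[ℝ] F)) (u : K →ᵇ E) =>
        mkOfCompact ⟨fun s => A s (u s), by fun_prop⟩)
      (fun A B u => by ext s; simp) (fun c A u => by ext s; simp)
      (fun A u v => by ext s; simp) (fun c A u => by ext s; simp)) 1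
    (fun A u => by
      rw [one_mul]
      refine (norm_le (by positivity)).2 fun s => ?_
      exact ((A s).le_opNorm _).trans (by gcongr <;> exact norm_coe_le_norm _ s))

@[simp]
theorem applyCLM_apply {E F : Type*} [NormedAddCommGroup E] [NormedSpace ℝ E]
    [NormedAddCommGroup F] [NormedSpace ℝ F] (A : K →ᵇ (E →L[ℝ] F)) (u : K →ᵇ E) (s : K) :
    applyCLM A u s = A s (u s) := rfl

theorem norm_applyCLM_le {E F : Type*} [NormedAddCommGroup E] [NormedSpace ℝ E]
    [NormedAddCommGroup F] [NormedSpace ℝ F] (A : K →ᵇ (E →L[ℝ] F)) :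
    ‖applyCLM A‖ ≤ ‖A‖ := by
  refine ContinuousLinearMap.opNorm_le_bound _ (norm_nonneg A) fun u => ?_
  refine (norm_le (by positivity)).2 fun s => ?_
  exact ((A s).le_opNorm _).trans (by gcongr <;> exact norm_coe_le_norm _ s)

/-- Composition with a fixed continuous map. -/
def superposition {E F : Type*} [PseudoMetricSpace E] [PseudoMetricSpace F] (f : C(E, F))
    (u : K →ᵇ E) : K →ᵇ F :=
  mkOfCompact (f.comp u.toContinuousMap)

@[simp]
theorem superposition_apply {E F : Type*} [PseudoMetricSpace E] [PseudoMetricSpace F] (f : C(E, F))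
    (u : K →ᵇ E) (s : K) : superposition f u s = f (u s) := rfl

/-- Compactness of `K` enters here: the sup metric induces the compact-open topology, in which
postcomposition is continuous. -/
theorem continuous_superposition {E F : Type*} [PseudoMetricSpace E] [PseudoMetricSpace F]
    (f : C(E, F)) : Continuous (superposition f : (K →ᵇ E) → (K →ᵇ F)) :=
  (ContinuousMap.isometryEquivBoundedOfCompact K F).continuous.comp
    ((ContinuousMap.continuous_postcomp f).comp
      (ContinuousMap.isometryEquivBoundedOfCompact K E).symm.continuous)

/-- Continuity of `superposition f'` makes `f'` vary by at most `ε` between `u s` and `u s + t • k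
s`, uniformly in `s`, once `‖k‖ < δ`. The mean value inequality on each segment then bounds the
remainder in the sup norm. -/
theorem hasFDerivAt_superposition {E F : Type*} [NormedAddCommGroup E] [NormedSpace ℝ E]
    [NormedAddCommGroup F] [NormedSpace ℝ F] (f : C(E, F)) (f' : C(E, E →L[ℝ] F))
    (hf : ∀ x, HasFDerivAt f (f' x) x) (u : K →ᵇ E) :
    HasFDerivAt (superposition f) (applyCLM (superposition f' u)) u := by
  rw [hasFDerivAt_iff_isLittleO_nhds_zero, Asymptotics.isLittleO_iff]
  intro ε hε
  obtain ⟨δ, hδ, h⟩ := Metric.continuousAt_iff.1 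
    (continuous_superposition (K := K) f').continuousAt ε hε
  filter_upwards [Metric.ball_mem_nhds (0 : K →ᵇ E) hδ] with k hk
  rw [mem_ball_zero_iff] at hk
  refine (norm_le (by positivity)).2 fun s => ?_
  have key : ‖f (u s + k s) - f (u s) - f' (u s) (u s + k s - u s)‖ ≤ ε * ‖u s + k s - u s‖ := by
    refine (convex_segment (𝕜 := ℝ) (u s) (u s + k s)).norm_image_sub_le_of_norm_hasFDerivWithin_le'
      (f' := f') (fun x _ => (hf x).hasFDerivWithinAt) ?_
      (left_mem_segment ℝ _ _) (right_mem_segment ℝ _ _)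
    intro x hx
    rw [segment_eq_image'] at hx
    obtain ⟨t, ⟨ht0, ht1⟩, rfl⟩ := hx
    have hd : dist (u + t • k) u < δ := by
      rw [dist_eq_norm, add_sub_cancel_left, norm_smul, Real.norm_of_nonneg ht0]
      exact (mul_le_of_le_one_left (norm_nonneg _) ht1).trans_lt hk
    have h2 : dist ((superposition f' (u + t • k)) s) ((superposition f' u) s) ≤ ε :=
      (dist_coe_le_dist s).trans (h hd).le
    rw [dist_eq_norm] at h2
    refine le_trans (le_of_eq ?_) h2
    simp
  refine le_trans ?_ (key.trans ?_)
  · simp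
  · rw [add_sub_cancel_left]
    gcongr
    exact norm_coe_le_norm _ s

universe u

/-- The derivative is again a superposition operator, for `fderiv ℝ f`, followed by `applyCLM`. The
induction therefore runs over all target spaces at once, which is why `E` and `F` share a universe.
-/
theorem contDiff_superposition {E F : Type u} [NormedAddCommGroup E] [NormedSpace ℝ E]
    [NormedAddCommGroup F] [NormedSpace ℝ F] (f : C(E, F)) (hf : ContDiff ℝ ∞ f) :
    ContDiff ℝ ∞ (superposition f : (K →ᵇ E) → (K →ᵇ F)) := by
  rw [contDiff_infty]
  intro n
  induction n generalizing F with
  | zero => exact contDiff_zero.2 (continuous_superposition f)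
  | succ n ih =>
    obtain ⟨hd, hf'⟩ := contDiff_infty_iff_fderiv.1 hf
    refine contDiff_succ_iff_hasFDerivAt.2
      ⟨fun u => applyCLM (superposition (⟨fderiv ℝ f, hf'.continuous⟩ : C(E, E →L[ℝ] F)) u), ?_, ?_⟩
    · exact applyCLM.contDiff.comp (ih ⟨fderiv ℝ f, hf'.continuous⟩ hf')
    · intro u
      exact hasFDerivAt_superposition f _ (fun x => (hd x).hasFDerivAt) u

/-- Constant maps, as a continuous linear map. -/
def constantCLM {F : Type*} [NormedAddCommGroup F] [NormedSpace ℝ F] : F →L[ℝ] (K →ᵇ F) :=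
  LinearMap.mkContinuous
    { toFun := fun x => const K x
      map_add' := fun _ _ => rfl
      map_smul' := fun _ _ => rfl } 1
    (fun x => by
      rw [one_mul]
      exact (norm_le (norm_nonneg _)).2 fun _ => le_rfl)

end Superposition

@[simp]
theorem constantCLM_apply {K F : Type*} [TopologicalSpace K] [CompactSpace K]
    [NormedAddCommGroup F] [NormedSpace ℝ F] (x : F) (s : K) :
    (constantCLM x : K →ᵇ F) s = x := rfl

/-! ### Integration of continuous maps on the unit interval -/

section Integral

variable {F : Type*} [NormedAddCommGroup F] [NormedSpace ℝ F]

/-- The primitive `s ↦ ∫ r in 0..s, u r` as an operator on continuous maps. -/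
def primitiveCLM : (unitInterval →ᵇ F) →L[ℝ] (unitInterval →ᵇ F) :=
  LinearMap.mkContinuous
    { toFun := fun u => mkOfCompact ⟨fun s => ∫ r in (0 : ℝ)..s, IccExtend zero_le_one u r,
        (intervalIntegral.continuous_primitive
          (fun a b => (u.continuous.Icc_extend' (h := zero_le_one)).intervalIntegrable a b) 0).comp
          continuous_subtype_val⟩
      map_add' := fun u v => by
        ext s
        exact intervalIntegral.integral_add
          ((u.continuous.Icc_extend' (h := zero_le_one)).intervalIntegrable _ _)
          ((v.continuous.Icc_extend' (h := zero_le_one)).intervalIntegrable _ _)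
      map_smul' := fun c u => by
        ext s
        exact intervalIntegral.integral_smul c _ } 1
    (fun u => by
      rw [one_mul]
      refine (norm_le (by positivity)).2 fun s => ?_
      have := intervalIntegral.norm_integral_le_of_norm_le_const (a := 0) (b := (s : ℝ))
        (f := IccExtend zero_le_one u) (C := ‖u‖)
        (fun x _ => norm_coe_le_norm u _)
      refine this.trans ?_
      rw [sub_zero, abs_of_nonneg s.2.1]
      exact mul_le_of_le_one_right (norm_nonneg _) s.2.2)

theorem primitiveCLM_apply (u : unitInterval →ᵇ F) (s : unitInterval) :
    primitiveCLM u s = ∫ r in (0 : ℝ)..s, IccExtend zero_le_one u r := rfl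

theorem norm_primitiveCLM_le : ‖(primitiveCLM : (unitInterval →ᵇ F) →L[ℝ] (unitInterval →ᵇ F))‖ ≤ 1 :=
  LinearMap.mkContinuous_norm_le _ zero_le_one _

/-- The primitive of the derivative of a function is given by its increments. -/
theorem primitiveCLM_eq_of_hasDerivAt [CompleteSpace F] (W : ℝ → F) (v : unitInterval →ᵇ F)
    (h : ∀ s : ℝ, (hs : s ∈ Ioo (0 : ℝ) 1) → HasDerivAt W (v ⟨s, hs.1.le, hs.2.le⟩) s)
    (hW : ContinuousOn W (Icc 0 1)) (s : unitInterval) : primitiveCLM v s = W s - W 0 := by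
  rw [primitiveCLM_apply]
  refine intervalIntegral.integral_eq_sub_of_hasDerivAt_of_le s.2.1
    (hW.mono (Icc_subset_Icc_right s.2.2)) ?_
    ((v.continuous.Icc_extend' (h := zero_le_one)).intervalIntegrable _ _)
  intro x hx
  have hx' : x ∈ Ioo (0 : ℝ) 1 := ⟨hx.1, hx.2.trans_le s.2.2⟩
  rw [IccExtend_of_mem _ _ ⟨hx'.1.le, hx'.2.le⟩]
  exact h x hx'

theorem hasDerivAt_integral_IccExtend [CompleteSpace F] (v : unitInterval →ᵇ F) (s : ℝ) :
    HasDerivAt (fun s : ℝ => ∫ r in (0 : ℝ)..s, IccExtend zero_le_one v r)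
      (IccExtend zero_le_one v s) s :=
  (v.continuous.Icc_extend' (h := zero_le_one)).integral_hasStrictDerivAt 0 s |>.hasDerivAt

end Integral

end BoundedContinuousFunction

end

noncomputable section

/-! ### Smooth extension and smooth local inverses -/

/-- Multiplication by a bump function. Superposition operators act on globally defined maps, whereas
a frame lives on a chart domain only. -/
theorem exists_contDiff_eventuallyEq {E F : Type*} [NormedAddCommGroup E] [NormedSpace ℝ E]
    [HasContDiffBump E] [NormedAddCommGroup F] [NormedSpace ℝ F]
    {f : E → F} {U : Set E} (hU : IsOpen U) (hf : ContDiffOn ℝ ∞ f U) {p : E} (hp : p ∈ U) :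
    ∃ g : E → F, ContDiff ℝ ∞ g ∧ g =ᶠ[𝓝 p] f := by
  obtain ⟨r, hr, hrU⟩ := Metric.isOpen_iff.1 hU p hp
  let χ : ContDiffBump p := ⟨r / 4, r / 2, by positivity, by linarith⟩
  refine ⟨fun x => χ x • f x, ?_, ?_⟩
  · rw [contDiff_iff_contDiffAt]
    intro x
    by_cases hx : x ∈ U
    · exact χ.contDiffAt.smul (hf.contDiffAt (hU.mem_nhds hx))
    · have hx' : x ∉ tsupport χ := by
        rw [χ.tsupport_eq]
        intro h
        exact hx (hrU ((Metric.mem_closedBall.1 h).trans_lt (by change r / 2 < r; linarith)))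
      have : (fun x => χ x • f x) =ᶠ[𝓝 x] fun _ => 0 := by
        filter_upwards [(isClosed_tsupport χ).isOpen_compl.mem_nhds hx'] with y hy
        rw [image_eq_zero_of_notMem_tsupport hy, zero_smul]
      exact contDiffAt_const.congr_of_eventuallyEq this
  · filter_upwards [χ.eventuallyEq_one] with x hx
    rw [hx, Pi.one_apply, one_smul]

/-- The inverse function theorem, with smoothness on the whole target. -/
theorem ContDiffOn.exists_openPartialHomeomorph {E F : Type*} [NormedAddCommGroup E]
    [NormedSpace ℝ E] [CompleteSpace E] [NormedAddCommGroup F] [NormedSpace ℝ F]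
    {f : E → F} {U : Set E} (hU : IsOpen U) (hf : ContDiffOn ℝ ∞ f U) {a : E} (ha : a ∈ U)
    (f' : E ≃L[ℝ] F) (hf' : HasFDerivAt f (f' : E →L[ℝ] F) a) :
    ∃ e : OpenPartialHomeomorph E F, a ∈ e.source ∧ e.source ⊆ U ∧ (∀ x, e x = f x) ∧
      ContDiffOn ℝ ∞ e.symm e.target ∧
      ∀ x ∈ e.source, ∃ g : E ≃L[ℝ] F, HasFDerivAt f (g : E →L[ℝ] F) x ∧
        HasFDerivAt e.symm (g.symm : F →L[ℝ] E) (e x) := by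
  have hfa : ContDiffAt ℝ ∞ f a := hf.contDiffAt (hU.mem_nhds ha)
  let e₀ := hfa.toOpenPartialHomeomorph f hf' (by simp)
  have hd : ContinuousOn (fderiv ℝ f) U := hf.continuousOn_fderiv_of_isOpen hU (by simp)
  -- The source is cut down to points with invertible derivative, so that the inverse is smooth on
  -- the whole target and not only at `f a`.
  have hV : IsOpen (U ∩ fderiv ℝ f ⁻¹' range ((↑) : (E ≃L[ℝ] F) → E →L[ℝ] F)) :=
    hd.isOpen_inter_preimage hU ContinuousLinearEquiv.isOpen
  set V := U ∩ fderiv ℝ f ⁻¹' range ((↑) : (E ≃L[ℝ] F) → E →L[ℝ] F) with hVdef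
  have key : ∀ x ∈ V, ∃ g : E ≃L[ℝ] F, HasFDerivAt f (g : E →L[ℝ] F) x := by
    rintro x ⟨hx, g, hg⟩
    refine ⟨g, hg ▸ ?_⟩
    exact ((hf.contDiffAt (hU.mem_nhds hx)).differentiableAt (by simp)).hasFDerivAt
  refine ⟨e₀.restrOpen V hV, ⟨hfa.mem_toOpenPartialHomeomorph_source hf' (by simp), ha, f',
    hf'.fderiv.symm⟩, fun x hx => hx.2.1, fun x => rfl, ?_, ?_⟩
  · intro y hy
    have hs := (e₀.restrOpen V hV).map_target hy
    obtain ⟨g, hg⟩ := key _ hs.2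
    exact ((e₀.restrOpen V hV).contDiffAt_symm hy hg
      (hf.contDiffAt (hU.mem_nhds hs.2.1))).contDiffWithinAt
  · intro x hx
    obtain ⟨g, hg⟩ := key x hx.2
    refine ⟨g, hg, ?_⟩
    have h := (e₀.restrOpen V hV).map_source hx
    refine (e₀.restrOpen V hV).hasFDerivAt_symm h ?_
    rw [(e₀.restrOpen V hV).left_inv hx]
    exact hg

open BoundedContinuousFunction
open scoped BoundedContinuousFunction

/-! ### The integral equation for curves in a distribution -/

section FlowDefect

universe u

variable {E P : Type u} [NormedAddCommGroup E] [NormedSpace ℝ E]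
  [NormedAddCommGroup P] [NormedSpace ℝ P]

/-- The zeros of the second component are the solutions of `u' = Y(u) (π t)`,
`u(0) = p + A (t - π t)`. -/
def flowDefect (Y : C(E, P →L[ℝ] E)) (A : P →L[ℝ] E) (π : P →L[ℝ] P) (p : E)
    (z : P × (unitInterval →ᵇ E)) : P × (unitInterval →ᵇ E) :=
  (z.1, z.2 - constantCLM (p + A (z.1 - π z.1)) -
    primitiveCLM (applyCLM (superposition Y z.2) (constantCLM (π z.1))))

variable (Y : C(E, P →L[ℝ] E)) (A : P →L[ℝ] E) (π : P →L[ℝ] P) (p : E)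

theorem contDiff_flowDefect (hY : ContDiff ℝ ∞ Y) : ContDiff ℝ ∞ (flowDefect Y A π p) := by
  have h : ContDiff ℝ ∞ fun u : (unitInterval →ᵇ E) => superposition Y u := contDiff_superposition Y hY
  unfold flowDefect
  have h1 : ContDiff ℝ ∞ fun z : P × (unitInterval →ᵇ E) =>
      applyCLM (superposition Y z.2)
        (constantCLM (π z.1) : (unitInterval →ᵇ P)) :=
    (applyCLM.contDiff.comp (h.comp contDiff_snd)).clm_apply (by fun_prop)
  have h2 := (primitiveCLM (F := E)).contDiff (n := ∞) |>.comp h1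
  exact contDiff_fst.prodMk ((contDiff_snd.sub (by fun_prop)).sub h2)

/-- The second component of `D` is the integral form of the linearized differential equation. The
explicit formula serves twice: for invertibility at the constant curve, and to identify the
derivative of a solution in its parameter. -/
theorem hasFDerivAt_flowDefect (Y' : C(E, E →L[ℝ] P →L[ℝ] E))
    (hY : ∀ x, HasFDerivAt Y (Y' x) x) (z : P × (unitInterval →ᵇ E)) :
    ∃ D : P × (unitInterval →ᵇ E) →L[ℝ] P × (unitInterval →ᵇ E),
      HasFDerivAt (flowDefect Y A π p) D z ∧ ∀ τ w,
        D (τ, w) = (τ, w - constantCLM (A (τ - π τ)) -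
          primitiveCLM (applyCLM (applyCLM (superposition Y' z.2) w)
              (constantCLM (π z.1)) +
            applyCLM (superposition Y z.2) (constantCLM (π τ)))) := by
  have h : HasFDerivAt (fun z : P × (unitInterval →ᵇ E) => superposition Y z.2)
      ((applyCLM (superposition Y' z.2)).comp (ContinuousLinearMap.snd ℝ _ _)) z :=
    (hasFDerivAt_superposition Y Y' hY z.2).comp z hasFDerivAt_snd
  have h0 (A : unitInterval →ᵇ (P →L[ℝ] E)) :=
    (applyCLM (K := unitInterval) (E := P) (F := E)).hasFDerivAt (x := A)
  have h1 := HasFDerivAt.comp (f := fun z : P × (unitInterval →ᵇ E) => superposition Y z.2) z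
    (h0 (superposition Y z.2)) h
  have h2 := ((constantCLM (K := unitInterval) (F := P)).comp
    (π.comp (ContinuousLinearMap.fst ℝ P (unitInterval →ᵇ E)))).hasFDerivAt (x := z)
  have h12 := h1.clm_apply h2
  have h3 := ((primitiveCLM (F := E)).hasFDerivAt (x := applyCLM (superposition Y z.2)
    (constantCLM (π z.1)))).comp z h12
  have h4 := ((constantCLM (K := unitInterval) (F := E)).comp (A.comp
    ((ContinuousLinearMap.fst ℝ P (unitInterval →ᵇ E)) -
      π.comp (ContinuousLinearMap.fst ℝ P (unitInterval →ᵇ E))))).hasFDerivAt (x := z) |>.const_add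
      (constantCLM p)
  have h5 := hasFDerivAt_fst.prodMk ((hasFDerivAt_snd.sub h4).sub h3)
  have hfun : flowDefect Y A π p = fun z => (z.1, z.2 - (constantCLM p +
      ((constantCLM (K := unitInterval) (F := E)).comp (A.comp
        ((ContinuousLinearMap.fst ℝ P (unitInterval →ᵇ E)) -
          π.comp (ContinuousLinearMap.fst ℝ P (unitInterval →ᵇ E))))) z) -
      primitiveCLM (applyCLM (superposition Y z.2) (constantCLM (π z.1)))) := by
    funext z
    simp only [flowDefect, map_add]
    rfl
  refine ⟨_, h5.congr_of_eventuallyEq (Filter.EventuallyEq.of_eq hfun), ?_⟩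
  intro τ w
  refine Prod.ext rfl ?_
  change w - constantCLM (A (τ - π τ)) - primitiveCLM (applyCLM (superposition Y z.2) (constantCLM (π τ)) +
    applyCLM (applyCLM (superposition Y' z.2) w) (constantCLM (π z.1))) = _
  rw [add_comm (applyCLM (superposition Y z.2) (constantCLM (π τ)))]

end FlowDefect

end

noncomputable section

open BoundedContinuousFunction
open scoped BoundedContinuousFunction

/-! ### The Frobenius theorem -/

section Frobenius

universe u

/-- A linear Volterra equation, solved by a Neumann series: integration over the unit interval has
norm at most one, so the bound on `Λ` gives an operator of norm at most `1 / 2`. -/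
theorem exists_eq_sub_primitiveCLM {P : Type u} [NormedAddCommGroup P] [NormedSpace ℝ P]
    [CompleteSpace P] (Λ : unitInterval →ᵇ (P →L[ℝ] P)) (hΛ : ‖Λ‖ ≤ 1 / 2)
    (r : unitInterval →ᵇ P) : ∃ c : unitInterval →ᵇ P, c = r - primitiveCLM (applyCLM Λ c) := by
  let T : (unitInterval →ᵇ P) →L[ℝ] (unitInterval →ᵇ P) := primitiveCLM.comp (applyCLM Λ)
  have hT : ‖-T‖ < 1 := by
    rw [norm_neg]
    refine lt_of_le_of_lt ?_ (by norm_num : (1 / 2 : ℝ) < 1)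
    calc ‖T‖ ≤ ‖(primitiveCLM : (unitInterval →ᵇ P) →L[ℝ] (unitInterval →ᵇ P))‖ * ‖applyCLM Λ‖ :=
          ContinuousLinearMap.opNorm_comp_le _ _
      _ ≤ 1 * (1 / 2) := by
          gcongr
          · exact norm_primitiveCLM_le
          · exact (norm_applyCLM_le Λ).trans hΛ
      _ = 1 / 2 := one_mul _
  let V := Units.oneSub (-T) hT
  refine ⟨(↑V⁻¹ : (unitInterval →ᵇ P) →L[ℝ] (unitInterval →ᵇ P)) r, ?_⟩
  have h : ((V : (unitInterval →ᵇ P) →L[ℝ] (unitInterval →ᵇ P)) * ↑V⁻¹) r = r := by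
    rw [Units.mul_inv]; rfl
  have hV : (V : (unitInterval →ᵇ P) →L[ℝ] (unitInterval →ᵇ P)) = 1 - -T := rfl
  rw [hV] at h
  have h2 : (↑V⁻¹ : (unitInterval →ᵇ P) →L[ℝ] (unitInterval →ᵇ P)) r +
      T ((↑V⁻¹ : (unitInterval →ᵇ P) →L[ℝ] (unitInterval →ᵇ P)) r) = r := by
    rw [sub_neg_eq_add] at h
    exact h
  exact eq_sub_of_add_eq h2

variable {E P : Type u} [NormedAddCommGroup E] [NormedSpace ℝ E] [CompleteSpace E]
  [NormedAddCommGroup P] [NormedSpace ℝ P] [CompleteSpace P]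

/-- Along a solution of the integral equation, the linearized equation in a direction of the
distribution is solved by a field tangent to the distribution. -/
theorem exists_tangent_solution (Y : C(E, P →L[ℝ] E)) (Y' : C(E, E →L[ℝ] P →L[ℝ] E))
    (hY : ∀ x, HasFDerivAt Y (Y' x) x) (A : P →L[ℝ] E) (π : P →L[ℝ] P)
    (hπ : ∀ t, π (π t) = π t) (p : E) (t : P) (u : unitInterval →ᵇ E)
    (hu : (flowDefect Y A π p (t, u)).2 = 0) (Λ : unitInterval →ᵇ (P →L[ℝ] P))
    (hΛ : ‖Λ‖ ≤ 1 / 2) (hΛπ : ∀ s c, π (Λ s c) = Λ s c)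
    (hbr : ∀ s c, Y (u s) (Λ s c) =
      Y' (u s) (Y (u s) (π t)) (π c) - Y' (u s) (Y (u s) (π c)) (π t)) (τ : P) :
    ∃ w : unitInterval →ᵇ E, (∃ q, w 1 = Y (u 1) (π q)) ∧
      w - constantCLM (A (π τ - π (π τ))) -
          primitiveCLM (applyCLM (applyCLM (superposition Y' u) w) (constantCLM (π t)) +
            applyCLM (superposition Y u) (constantCLM (π (π τ)))) = 0 := by
  -- The coefficients solve `c' = π τ - Λ c`, `c 0 = 0`. For `w = Y(u)(π c)` the product rule gives
  -- `w' = Y'(u)(Y(u)(π t))(π c) + Y(u)(π τ - Λ c)`, which `hbr` turns into `Y'(u)(w)(π t) + Y(u)(π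
  -- τ)`.
  obtain ⟨c, hc⟩ := exists_eq_sub_primitiveCLM Λ hΛ
    (mkOfCompact ⟨fun s : unitInterval => (s : ℝ) • π τ, by fun_prop⟩)
  let w : unitInterval →ᵇ E := mkOfCompact ⟨fun s => Y (u s) (π (c s)), by fun_prop⟩
  have hw : ∀ s, w s = Y (u s) (π (c s)) := fun s => rfl
  refine ⟨w, ⟨c 1, rfl⟩, ?_⟩
  let vu : unitInterval →ᵇ E := applyCLM (superposition Y u) (constantCLM (π t))
  let vc : unitInterval →ᵇ P := applyCLM Λ c
  -- Both curves are extended to the real line through their integral equations, in order to be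
  -- differentiated.
  let uext : ℝ → E := fun s => p + A (t - π t) + ∫ r in (0 : ℝ)..s, IccExtend zero_le_one vu r
  let cext : ℝ → P := fun s => s • π τ - ∫ r in (0 : ℝ)..s, IccExtend zero_le_one vc r
  have huext : ∀ s : unitInterval, uext s = u s := by
    intro s
    have h := DFunLike.congr_fun hu s
    change u s - (p + A (t - π t)) - primitiveCLM vu s = 0 at h
    rw [sub_sub, sub_eq_zero] at h
    exact h.symm
  have hcext : ∀ s : unitInterval, cext s = c s := by
    intro s
    have h := DFunLike.congr_fun hc s
    exact h.symm
  have hud : ∀ s, HasDerivAt uext (IccExtend zero_le_one vu s) s := fun s =>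
    (hasDerivAt_integral_IccExtend vu s).const_add _
  have hcd : ∀ s, HasDerivAt cext ((1 : ℝ) • π τ - IccExtend zero_le_one vc s) s := fun s =>
    ((hasDerivAt_id s).smul_const (π τ)).sub (hasDerivAt_integral_IccExtend vc s)
  let W : ℝ → E := fun s => Y (uext s) (π (cext s))
  have hWd : ∀ s, HasDerivAt W (Y' (uext s) (IccExtend zero_le_one vu s) (π (cext s)) +
      Y (uext s) (π ((1 : ℝ) • π τ - IccExtend zero_le_one vc s))) s := fun s =>
    ((hY (uext s)).comp_hasDerivAt s (hud s)).clm_apply (π.hasFDerivAt.comp_hasDerivAt s (hcd s))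
  have hWs : ∀ s : unitInterval, W s = w s := by
    intro s
    change Y (uext s) (π (cext s)) = _
    rw [huext, hcext, hw]
  have hW0 : W 0 = 0 := by
    change Y (uext 0) (π (cext 0)) = 0
    have : cext 0 = 0 := by simp [cext]
    rw [this, map_zero, map_zero]
  have key := primitiveCLM_eq_of_hasDerivAt W
    (applyCLM (applyCLM (superposition Y' u) w) (constantCLM (π t)) +
            applyCLM (superposition Y u) (constantCLM (π (π τ)))) (fun s hs => by
      have h := hWd s
      have hs' : s ∈ Icc (0 : ℝ) 1 := ⟨hs.1.le, hs.2.le⟩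
      rw [IccExtend_of_mem _ _ hs', IccExtend_of_mem _ _ hs'] at h
      have h1 := huext ⟨s, hs'⟩
      have h2 := hcext ⟨s, hs'⟩
      simp only at h1 h2
      rw [h1, h2] at h
      convert! h using 1
      change Y' (u ⟨s, hs'⟩) (w ⟨s, hs'⟩) (π t) + Y (u ⟨s, hs'⟩) (π (π τ)) =
        Y' (u ⟨s, hs'⟩) (Y (u ⟨s, hs'⟩) (π t)) (π (c ⟨s, hs'⟩)) +
          Y (u ⟨s, hs'⟩) (π ((1 : ℝ) • π τ - Λ ⟨s, hs'⟩ (c ⟨s, hs'⟩)))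
      rw [hw, one_smul, map_sub, map_sub, hΛπ, hbr]
      abel) (fun s _ => (hWd s).continuousAt.continuousWithinAt)
  ext s
  change w s - A (π τ - π (π τ)) - primitiveCLM _ s = 0
  rw [key, hW0, hWs, hπ, sub_self, map_zero, sub_zero]
  exact sub_self _

end Frobenius
end

noncomputable section

open BoundedContinuousFunction
open scoped BoundedContinuousFunction

section Frobenius

universe u

variable {E P : Type u} [NormedAddCommGroup E] [NormedSpace ℝ E]
  [NormedAddCommGroup P] [NormedSpace ℝ P]

/-- The commutator `c ↦ (X z)⁻¹ [X π c, X π t]` of fields of a distribution, in terms of the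
derivative of the frame and of a left inverse of it. -/
def structureCLM (Y : E → P →L[ℝ] E) (Y' : E → E →L[ℝ] P →L[ℝ] E) (B : E → E →L[ℝ] P)
    (π : P →L[ℝ] P) (t : P) (z : E) : P →L[ℝ] P :=
  (B z).comp ((Y' z (Y z (π t))).comp π -
    ((ContinuousLinearMap.apply ℝ E (π t)).comp (Y' z)).comp ((Y z).comp π))

theorem structureCLM_apply (Y : E → P →L[ℝ] E) (Y' : E → E →L[ℝ] P →L[ℝ] E) (B : E → E →L[ℝ] P)
    (π : P →L[ℝ] P) (t : P) (z : E) (c : P) : structureCLM Y Y' B π t z c =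
      B z (Y' z (Y z (π t)) (π c) - Y' z (Y z (π c)) (π t)) := rfl

theorem continuous_structureCLM {Y : E → P →L[ℝ] E} {Y' : E → E →L[ℝ] P →L[ℝ] E}
    {B : E → E →L[ℝ] P} (hY : Continuous Y) (hY' : Continuous Y') (hB : Continuous B)
    (π : P →L[ℝ] P) : Continuous fun q : P × E => structureCLM Y Y' B π q.1 q.2 := by
  unfold structureCLM
  fun_prop

/-- Solutions of the integral equation depending smoothly on the parameter. -/
theorem exists_smooth_solutions [CompleteSpace E] [CompleteSpace P] (Y : C(E, P →L[ℝ] E)) (hY : ContDiff ℝ ∞ Y) (p : E)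
    (π : P →L[ℝ] P) {N : Set E} (hN : N ∈ 𝓝 p) :
    ∃ (O : Set P) (u : P → unitInterval →ᵇ E), IsOpen O ∧ 0 ∈ O ∧ ContDiffOn ℝ ∞ u O ∧
      u 0 = constantCLM p ∧
      (∀ t ∈ O, (flowDefect Y (Y p) π p (t, u t)).2 = 0 ∧ ∀ s, u t s ∈ N) ∧
      ∀ t ∈ O, ∀ τ w, w - constantCLM (Y p (τ - π τ)) -
          primitiveCLM (applyCLM (applyCLM (superposition
              (⟨fderiv ℝ Y, hY.continuous_fderiv (by simp)⟩ : C(E, E →L[ℝ] P →L[ℝ] E)) (u t)) w)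
              (constantCLM (π t)) +
            applyCLM (superposition Y (u t)) (constantCLM (π τ))) = 0 → fderiv ℝ u t τ = w := by
  set Y' : C(E, E →L[ℝ] P →L[ℝ] E) := ⟨fderiv ℝ Y, hY.continuous_fderiv (by simp)⟩ with hY'def
  have hd : ∀ x, HasFDerivAt Y (Y' x) x := fun x =>
    (hY.differentiable (by simp) x).hasFDerivAt
  have hΘ := contDiff_flowDefect Y (Y p) π p hY
  set Θ := flowDefect Y (Y p) π p with hΘdef
  obtain ⟨D, hD, hDf⟩ := hasFDerivAt_flowDefect Y (Y p) π p Y' hd (0, constantCLM p)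
  let R : P →L[ℝ] (unitInterval →ᵇ E) := -(constantCLM.comp ((Y p).comp
      (ContinuousLinearMap.id ℝ P - π))) - primitiveCLM.comp ((applyCLM (superposition Y
        (constantCLM p))).comp (constantCLM.comp π))
  -- At the constant curve `π 0 = 0` removes the term with `Y'`, so the derivative is triangular
  -- with identity blocks on the diagonal.
  let D' : (P × (unitInterval →ᵇ E)) ≃L[ℝ] P × (unitInterval →ᵇ E) :=
    (ContinuousLinearEquiv.refl ℝ P).skewProd (ContinuousLinearEquiv.refl ℝ (unitInterval →ᵇ E)) R
  have hDD' : (D' : (P × (unitInterval →ᵇ E)) →L[ℝ] P × (unitInterval →ᵇ E)) = D := by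
    refine ContinuousLinearMap.ext fun ⟨τ, w⟩ => ?_
    rw [hDf]
    refine Prod.ext rfl ?_
    change w + (-(constantCLM (Y p (τ - π τ))) - primitiveCLM (applyCLM (superposition Y
        (constantCLM p)) (constantCLM (π τ)))) = _
    rw [map_zero, map_zero, map_zero, zero_add]
    dsimp only
    abel
  have hΘ0 : Θ (0, constantCLM p) = (0, 0) := by
    refine Prod.ext rfl ?_
    change constantCLM p - constantCLM (p + Y p (0 - π 0)) - primitiveCLM (applyCLM (superposition Y
        (constantCLM p)) (constantCLM (π 0))) = 0
    simp
  obtain ⟨e, hes, -, hef, hesm, hed⟩ := hΘ.contDiffOn.exists_openPartialHomeomorph isOpen_univ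
    (mem_univ _) D' (hDD' ▸ hD)
  have he0 : e.symm (0, 0) = (0, constantCLM p) := by
    rw [← hΘ0, ← hef, e.left_inv hes]
  have h0t : ((0, 0) : P × (unitInterval →ᵇ E)) ∈ e.target := by
    rw [← hΘ0, ← hef]; exact e.map_source hes
  let ι : P →L[ℝ] P × (unitInterval →ᵇ E) := ContinuousLinearMap.inl ℝ P (unitInterval →ᵇ E)
  let u : P → unitInterval →ᵇ E := fun t => (e.symm (ι t)).2
  have hO₁ : IsOpen (ι ⁻¹' e.target) := e.open_target.preimage ι.continuous
  have hus : ContDiffOn ℝ ∞ u (ι ⁻¹' e.target) :=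
    contDiff_snd.comp_contDiffOn (hesm.comp ι.contDiff.contDiffOn (fun _ h => h))
  have hu0 : u 0 = constantCLM p := congrArg Prod.snd he0
  obtain ⟨r, hr, hrN⟩ := Metric.mem_nhds_iff.1 hN
  have hO : IsOpen (ι ⁻¹' e.target ∩ u ⁻¹' Metric.ball (constantCLM p) r) :=
    hus.continuousOn.isOpen_inter_preimage hO₁ Metric.isOpen_ball
  have hpair : ∀ t ∈ ι ⁻¹' e.target, e.symm (ι t) = (t, u t) := by
    intro t ht
    refine Prod.ext ?_ rfl
    have h := e.right_inv ht
    rw [hef] at h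
    exact (congrArg Prod.fst h : _)
  refine ⟨_, u, hO, ⟨h0t, ?_⟩, hus.mono inter_subset_left, hu0, ?_, ?_⟩
  · rw [mem_preimage, hu0]; exact Metric.mem_ball_self hr
  · rintro t ⟨ht, htr⟩
    constructor
    · rw [← hpair t ht, ← hef, e.right_inv ht]
      rfl
    · intro s
      refine hrN ?_
      exact (dist_coe_le_dist (f := u t) (g := constantCLM p) s).trans_lt htr
  · rintro t ⟨ht, -⟩ τ w h
    obtain ⟨g, hg, hgs⟩ := hed _ (e.map_target ht)
    rw [e.right_inv ht] at hgs
    rw [hpair t ht] at hg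
    obtain ⟨D₁, hD₁, hD₁f⟩ := hasFDerivAt_flowDefect Y (Y p) π p Y' hd (t, u t)
    have hgD := hg.unique hD₁
    -- If `w` solves the linearized equation, the inverse derivative sends `(τ, 0)` to `(τ, w)`; its
    -- second component is the derivative of `u` in the direction `τ`.
    have h1 : g (τ, w) = (τ, 0) := by
      change (g : (P × (unitInterval →ᵇ E)) →L[ℝ] P × (unitInterval →ᵇ E)) (τ, w) = _
      rw [hgD, hD₁f]
      exact Prod.ext rfl h
    have h2 : g.symm (τ, 0) = (τ, w) := by rw [← h1, g.symm_apply_apply]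
    have h3 : HasFDerivAt u ((ContinuousLinearMap.snd ℝ P (unitInterval →ᵇ E)).comp
        ((g.symm : P × (unitInterval →ᵇ E) →L[ℝ] P × (unitInterval →ᵇ E)).comp ι)) t :=
      (ContinuousLinearMap.snd ℝ P (unitInterval →ᵇ E)).hasFDerivAt.comp t
        (hgs.comp t ι.hasFDerivAt)
    rw [h3.fderiv]
    exact congrArg Prod.snd h2

end Frobenius
end

noncomputable section

open BoundedContinuousFunction
open scoped BoundedContinuousFunction

section Frobenius

universe u

variable {E P : Type u} [NormedAddCommGroup E] [NormedSpace ℝ E]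
  [NormedAddCommGroup P] [NormedSpace ℝ P] [FiniteDimensional ℝ P]

/-- An injective linear map sending `range π` into the image of `range π` under another injective
map reaches all of that image. -/
theorem exists_eq_of_range_le (π : P →L[ℝ] P) (f g : P →L[ℝ] E) (hf : Function.Injective f)
    (hg : Function.Injective g) (h : ∀ t, ∃ q, f (π t) = g (π q)) (s : P) :
    ∃ q, g (π s) = f (π q) := by
  let R : Submodule ℝ P := (π : P →ₗ[ℝ] P).range
  have hle : R.map (f : P →ₗ[ℝ] E) ≤ R.map (g : P →ₗ[ℝ] E) := by
    rintro _ ⟨_, ⟨t, rfl⟩, rfl⟩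
    obtain ⟨q, hq⟩ := h t
    exact ⟨π q, ⟨q, rfl⟩, hq.symm⟩
  have hrank : Module.finrank ℝ (R.map (f : P →ₗ[ℝ] E)) = Module.finrank ℝ (R.map (g : P →ₗ[ℝ] E)) :=
    (Submodule.equivMapOfInjective (f : P →ₗ[ℝ] E) hf R).finrank_eq.symm.trans
      (Submodule.equivMapOfInjective (g : P →ₗ[ℝ] E) hg R).finrank_eq
  have heq := Submodule.eq_of_le_of_finrank_eq hle hrank
  have hmem : g (π s) ∈ R.map (g : P →ₗ[ℝ] E) := ⟨π s, ⟨s, rfl⟩, rfl⟩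
  rw [← heq] at hmem
  obtain ⟨_, ⟨q, rfl⟩, hq⟩ := hmem
  exact ⟨q, hq.symm⟩

/-- **Frobenius theorem**, local form: an involutive distribution `z ↦ X z (range π)` given by part
of a smooth frame `X` is, near each point, contained in the preimage of `range π` under the
differential of some smooth coordinates `T` whose differential at `p` is inverse to the frame. -/
theorem exists_adapted_coordinates [FiniteDimensional ℝ E] [HasContDiffBump E] {X : E → P →L[ℝ] E} {U : Set E}
    (hU : IsOpen U) (hX : ContDiffOn ℝ ∞ X U) {p : E} (hp : p ∈ U) (A : P ≃L[ℝ] E) (hA : X p = A)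
    (π : P →L[ℝ] P) (hπ : ∀ t, π (π t) = π t)
    (hinv : ∀ z ∈ U, ∀ s t, ∃ q, fderiv ℝ X z (X z (π s)) (π t) - fderiv ℝ X z (X z (π t)) (π s) =
      X z (π q)) :
    ∃ (V : Set E) (T : E → P), IsOpen V ∧ p ∈ V ∧ V ⊆ U ∧ ContDiffOn ℝ ∞ T V ∧
      fderiv ℝ T p = A.symm ∧ ∀ z ∈ V, ∀ t, ∃ q, fderiv ℝ T z (X z (π t)) = π q := by
  have : CompleteSpace E := FiniteDimensional.complete ℝ E
  have : CompleteSpace P := FiniteDimensional.complete ℝ P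
  obtain ⟨Y₀, hY, hYX⟩ := exists_contDiff_eventuallyEq hU hX hp
  let Y : C(E, P →L[ℝ] E) := ⟨Y₀, hY.continuous⟩
  have hYp : Y p = X p := hYX.eq_of_nhds
  let Y' : C(E, E →L[ℝ] P →L[ℝ] E) := ⟨fderiv ℝ Y, hY.continuous_fderiv (by simp)⟩
  have hd : ∀ x, HasFDerivAt Y (Y' x) x := fun x =>
    (hY.differentiable (by simp) x).hasFDerivAt
  have hinvb : ∀ᶠ z in 𝓝 p, X z ∈ range ((↑) : (P ≃L[ℝ] E) → P →L[ℝ] E) :=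
    (hX.continuousOn.continuousAt (hU.mem_nhds hp)).eventually_mem
      (ContinuousLinearEquiv.isOpen.mem_nhds ⟨A, hA.symm⟩)
  obtain ⟨U₁, hU₁s, hU₁, hpU₁⟩ := eventually_nhds_iff.1 (hinvb.and (hU.mem_nhds hp))
  have hBs : ContDiffOn ℝ ∞ (fun z => (X z).inverse) U₁ := by
    intro z hz
    obtain ⟨⟨g, hg⟩, hzU⟩ := hU₁s z hz
    have h1 : ContDiffAt ℝ ∞ ContinuousLinearMap.inverse (X z) := hg ▸ contDiffAt_map_inverse g
    exact (h1.comp z (hX.contDiffAt (hU.mem_nhds hzU))).contDiffWithinAt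
  obtain ⟨B, hB, hBX⟩ := exists_contDiff_eventuallyEq hU₁ hBs hpU₁
  have hΛc := continuous_structureCLM hY.continuous Y'.continuous hB.continuous π
  have hΛ0 : structureCLM Y Y' B π 0 p = 0 := by
    ext c
    simp [structureCLM_apply]
  -- The commutator map vanishes at `t = 0`, hence has norm below `1 / 2` for small `t` near `p`, as
  -- the Volterra equation requires.
  have hsmall : ∀ᶠ q : P × E in 𝓝 (0, p), ‖structureCLM Y Y' B π q.1 q.2‖ < 1 / 2 := by
    refine (hΛc.norm.tendsto (0, p)).eventually (gt_mem_nhds ?_)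
    have : ‖structureCLM Y Y' B π (0 : P) p‖ = 0 := by rw [hΛ0, norm_zero]
    exact this.trans_lt (by norm_num)
  rw [nhds_prod_eq, Filter.eventually_prod_iff] at hsmall
  obtain ⟨pa, hpa, pb, hpb, hab⟩ := hsmall
  obtain ⟨O, u, hO, h0O, huO, hu0, hsol, hder⟩ := exists_smooth_solutions Y hY p π
    (N := {z | pb z ∧ (∀ᶠ y in 𝓝 z, Y₀ y = X y) ∧ B z = (X z).inverse ∧ z ∈ U₁})
    (hpb.and (hYX.eventually_nhds.and (hBX.and (hU₁.mem_nhds hpU₁))))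
  obtain ⟨O₁, hO₁s, hO₁, h0O₁⟩ := eventually_nhds_iff.1 hpa
  let ev : (unitInterval →ᵇ E) →L[ℝ] E := evalCLM ℝ (1 : unitInterval)
  -- The time-one point of the field `X (π t)` started at `p + A (t - π t)`: complementary
  -- directions only shift the start. The inverse of `Ψ` is the desired `T`.
  let Ψ : P → E := fun t => u t 1
  have hΨO : ContDiffOn ℝ ∞ Ψ (O ∩ O₁) :=
    ev.contDiff.comp_contDiffOn (huO.mono inter_subset_left)
  have hΨ' : ∀ t ∈ O, ∀ τ, fderiv ℝ Ψ t τ = fderiv ℝ u t τ 1 := by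
    intro t ht τ
    have h := (huO.contDiffAt (hO.mem_nhds ht)).differentiableAt (by simp) |>.hasFDerivAt
    have h2 : HasFDerivAt Ψ (ev.comp (fderiv ℝ u t)) t :=
      ev.hasFDerivAt.comp t h
    rw [h2.fderiv]
    rfl
  have hΨ0' : fderiv ℝ Ψ 0 = A := by
    ext τ
    -- At `t = 0` the linearized solution is explicit, `A (τ - π τ) + s • A (π τ)`, and equals `A τ`
    -- at `s = 1`.
    have h := hder 0 h0O τ (constantCLM (Y p (τ - π τ)) +
      primitiveCLM (applyCLM (superposition Y (u 0)) (constantCLM (π τ)))) (by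
        rw [map_zero, map_zero, map_zero, zero_add, add_sub_cancel_left, sub_self])
    rw [hΨ' 0 h0O, h, hu0]
    change Y p (τ - π τ) + ∫ r in (0 : ℝ)..(1 : unitInterval), Y p (π τ) = A τ
    rw [intervalIntegral.integral_const]
    change Y p (τ - π τ) + ((1 : ℝ) - 0) • Y p (π τ) = A τ
    rw [sub_zero, one_smul, ← map_add, sub_add_cancel, hYp, hA]
    rfl
  have hΨ0 : HasFDerivAt Ψ (A : P →L[ℝ] E) 0 := by
    rw [← hΨ0']
    exact ((hΨO.contDiffAt ((hO.inter hO₁).mem_nhds ⟨h0O, h0O₁⟩)).differentiableAt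
      (by simp)).hasFDerivAt
  have hΨp : Ψ 0 = p := by
    change u 0 1 = p
    rw [hu0, constantCLM_apply]
  obtain ⟨e, hes, heO, hef, hesm, hed⟩ := hΨO.exists_openPartialHomeomorph (hO.inter hO₁)
    ⟨h0O, h0O₁⟩ A hΨ0
  have hpt : p ∈ e.target := by
    rw [← hΨp, ← hef]; exact e.map_source hes
  have hU' : ∀ t ∈ O, Ψ t ∈ U₁ := fun t ht => ((hsol t ht).2 1).2.2.2
  have hsec : ∀ z ∈ e.target, Ψ (e.symm z) = z := fun z hz => by rw [← hef, e.right_inv hz]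
  refine ⟨e.target, e.symm, e.open_target, hpt, fun z hz => ?_, hesm, ?_, ?_⟩
  · have h := hU' _ (heO (e.map_target hz)).1
    rw [hsec z hz] at h
    exact (hU₁s z h).2
  · obtain ⟨g, hg, hgs⟩ := hed 0 hes
    have hgA : g = A := by
      ext t
      exact DFunLike.congr_fun (hg.unique hΨ0) t
    rw [hef, hΨp] at hgs
    rw [hgs.fderiv, hgA]
  · intro z hz s
    have ht := heO (e.map_target hz)
    obtain ⟨g, hg, hgs⟩ := hed _ (e.map_target hz)
    rw [e.right_inv hz] at hgs
    set t := e.symm z with htdef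
    have hz1 : z ∈ U₁ := by rw [← hsec z hz]; exact hU' _ ht.1
    obtain ⟨⟨gX, hgX⟩, -⟩ := hU₁s z hz1
    -- The differential of `Ψ` sends `range π` into the distribution at `z`. Equality of dimensions
    -- reverses the inclusion below, which is the claim for the inverse of `Ψ`.
    have hrange : ∀ τ, ∃ q, (g : P →L[ℝ] E) (π τ) = X z (π q) := by
      intro τ
      let Λ : unitInterval →ᵇ (P →L[ℝ] P) :=
        mkOfCompact ⟨fun r => structureCLM Y Y' B π t (u t r), hΛc.comp (continuous_const.prodMk (u t).continuous)⟩
      have hΛn : ‖Λ‖ ≤ 1 / 2 := (norm_le (by norm_num)).2 fun r =>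
        (hab (hO₁s t ht.2) ((hsol t ht.1).2 r).1).le
      have hbr : ∀ r c, ∃ q, Λ r c = π q ∧ Y (u t r) (Λ r c) =
          Y' (u t r) (Y (u t r) (π t)) (π c) - Y' (u t r) (Y (u t r) (π c)) (π t) := by
        intro r c
        obtain ⟨-, hYe, hBe, hUe⟩ := (hsol t ht.1).2 r
        obtain ⟨⟨k, hk⟩, hUr⟩ := hU₁s _ hUe
        have hYe' : Y (u t r) = X (u t r) := hYe.self_of_nhds
        have hY'e : Y' (u t r) = fderiv ℝ X (u t r) := Filter.EventuallyEq.fderiv_eq hYe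
        obtain ⟨q, hq⟩ := hinv _ hUr t c
        have hΛq : Λ r c = π q := by
          change structureCLM Y Y' B π t (u t r) c = π q
          rw [structureCLM_apply, hYe', hY'e, hq, hBe, ← hk, ContinuousLinearMap.inverse_equiv]
          exact k.symm_apply_apply _
        exact ⟨q, hΛq, by rw [hΛq, hYe', hY'e, hq]⟩
      obtain ⟨w, ⟨q, hwq⟩, hw⟩ := exists_tangent_solution Y Y' hd (Y p) π hπ p t (u t)
        (hsol t ht.1).1 Λ hΛn (fun r c => by
          obtain ⟨q, hq, -⟩ := hbr r c
          rw [hq, hπ]) (fun r c => (hbr r c).choose_spec.2) τ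
      have h := hder t ht.1 (π τ) w hw
      refine ⟨q, ?_⟩
      rw [← hg.fderiv, hΨ' t ht.1, h, hwq]
      obtain ⟨-, hYe, -⟩ := (hsol t ht.1).2 1
      have h1 : u t 1 = z := hsec z hz
      rw [h1] at hYe ⊢
      have hYe' : Y z = X z := hYe.self_of_nhds
      rw [hYe']
    obtain ⟨q, hq⟩ := exists_eq_of_range_le π (g : P →L[ℝ] E) (X z) g.injective
      (hgX ▸ gX.injective) hrange s
    refine ⟨q, ?_⟩
    rw [hgs.fderiv, hq]
    exact g.symm_apply_apply _

end Frobenius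
end

noncomputable section

/-! ### Expansion of Pfaffians -/

section Pfaffian

/-- Extension of a permutation by a fixed last element. -/
def Fin.permExtendLast {N : ℕ} (e : Equiv.Perm (Fin N)) : Equiv.Perm (Fin (N + 1)) :=
  finSuccEquivLast.symm.permCongr (Equiv.optionCongr e)

theorem Fin.permExtendLast_castSucc {N : ℕ} (e : Equiv.Perm (Fin N)) (i : Fin N) :
    Fin.permExtendLast e i.castSucc = (e i).castSucc := by
  simp [Fin.permExtendLast, Equiv.permCongr_apply]

theorem Fin.permExtendLast_last {N : ℕ} (e : Equiv.Perm (Fin N)) :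
    Fin.permExtendLast e (Fin.last N) = Fin.last N := by
  simp [Fin.permExtendLast, Equiv.permCongr_apply]

theorem Fin.sign_permExtendLast {N : ℕ} (e : Equiv.Perm (Fin N)) :
    Equiv.Perm.sign (Fin.permExtendLast e) = Equiv.Perm.sign e := by
  rw [Fin.permExtendLast, Equiv.Perm.sign_permCongr, Equiv.optionCongr_sign]

theorem Fin.permExtendLast_injective {N : ℕ} :
    Function.Injective (Fin.permExtendLast : Equiv.Perm (Fin N) → Equiv.Perm (Fin (N + 1))) := by
  intro e e' h
  ext i
  have := DFunLike.congr_fun h i.castSucc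
  rw [Fin.permExtendLast_castSucc, Fin.permExtendLast_castSucc] at this
  rw [Fin.castSucc_injective _ this]

/-- Permutations of `N + 1` elements are sorted by the image of the last one. -/
theorem Equiv.Perm.sum_eq_sum_permExtendLast {N : ℕ} {R : Type*} [AddCommMonoid R]
    (F : Equiv.Perm (Fin (N + 1)) → R) (κ : Fin (N + 1) → Equiv.Perm (Fin (N + 1)))
    (hκ : ∀ q, κ q (Fin.last N) = q) :
    ∑ σ, F σ = ∑ q, ∑ e : Equiv.Perm (Fin N), F (κ q * Fin.permExtendLast e) := by
  have hb : Function.Bijective fun p : Fin (N + 1) × Equiv.Perm (Fin N) =>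
      κ p.1 * Fin.permExtendLast p.2 := by
    rw [Fintype.bijective_iff_injective_and_card]
    constructor
    · rintro ⟨q, e⟩ ⟨q', e'⟩ h
      have h1 := DFunLike.congr_fun h (Fin.last N)
      simp only [Equiv.Perm.mul_apply, Fin.permExtendLast_last, hκ] at h1
      subst h1
      exact Prod.ext rfl (Fin.permExtendLast_injective (mul_left_cancel h))
    · simp [Fintype.card_perm, Nat.factorial_succ]
  rw [← hb.sum_comp, Fintype.sum_prod_type]

/-- The signed product attached to a permutation in the definition of the Pfaffian. -/
def pfaffianTerm {m : ℕ} (A : Matrix (Fin (2 * m)) (Fin (2 * m)) ℝ) (σ : Equiv.Perm (Fin (2 * m))) :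
    ℝ :=
  ((Equiv.Perm.sign σ : ℤ) : ℝ) * ∏ k : Fin m, A (σ ⟨2 * k, by omega⟩) (σ ⟨2 * k + 1, by omega⟩)

/-- Exchanging the two positions of a pair changes the sign of the permutation and, by
skew-symmetry, that of one factor. -/
theorem pfaffianTerm_mul_swap {m : ℕ} (A : Matrix (Fin (2 * m)) (Fin (2 * m)) ℝ)
    (hA : ∀ i j, A i j = -A j i) (σ : Equiv.Perm (Fin (2 * m))) (k : Fin m) :
    pfaffianTerm A (σ * Equiv.swap ⟨2 * k, by omega⟩ ⟨2 * k + 1, by omega⟩) = pfaffianTerm A σ := by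
  have hne : (⟨2 * k, by omega⟩ : Fin (2 * m)) ≠ ⟨2 * k + 1, by omega⟩ := by
    simp
  unfold pfaffianTerm
  rw [Equiv.Perm.sign_mul, Equiv.Perm.sign_swap hne,
    ← Finset.mul_prod_erase _ _ (Finset.mem_univ k), ← Finset.mul_prod_erase _ _ (Finset.mem_univ k)]
  rw [Equiv.Perm.mul_apply, Equiv.Perm.mul_apply, Equiv.swap_apply_left, Equiv.swap_apply_right,
    hA (σ ⟨2 * k + 1, _⟩)]
  have : ∀ j ∈ Finset.univ.erase k,
      A ((σ * Equiv.swap (⟨2 * k, by omega⟩ : Fin (2 * m)) ⟨2 * k + 1, by omega⟩) ⟨2 * j, by omega⟩)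
        ((σ * Equiv.swap (⟨2 * k, by omega⟩ : Fin (2 * m)) ⟨2 * k + 1, by omega⟩)
          ⟨2 * j + 1, by omega⟩) =
      A (σ ⟨2 * j, by omega⟩) (σ ⟨2 * j + 1, by omega⟩) := by
    intro j hj
    have hjk : (j : ℕ) ≠ k := fun h => Finset.ne_of_mem_erase hj (Fin.ext h)
    rw [Equiv.Perm.mul_apply, Equiv.Perm.mul_apply, Equiv.swap_apply_of_ne_of_ne,
      Equiv.swap_apply_of_ne_of_ne] <;> · rw [Ne, Fin.mk.injEq]; omega
  rw [Finset.prod_congr rfl this]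
  push_cast
  ring

/-- Exchanging two pairs is an even permutation and merely reorders the factors. -/
theorem pfaffianTerm_mul_swap_mul_swap {m : ℕ} (A : Matrix (Fin (2 * m)) (Fin (2 * m)) ℝ)
    (σ : Equiv.Perm (Fin (2 * m))) (k k' : Fin m) :
    pfaffianTerm A (σ * (Equiv.swap ⟨2 * k, by omega⟩ ⟨2 * k', by omega⟩ *
      Equiv.swap ⟨2 * k + 1, by omega⟩ ⟨2 * k' + 1, by omega⟩)) = pfaffianTerm A σ := by
  by_cases hk : k = k'
  · subst hk
    simp [Equiv.swap_self, ← Equiv.Perm.one_def]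
  have hk' : (k : ℕ) ≠ k' := fun h => hk (Fin.ext h)
  have h0 : (⟨2 * k, by omega⟩ : Fin (2 * m)) ≠ ⟨2 * k', by omega⟩ := by
    rw [Ne, Fin.mk.injEq]; omega
  have h1 : (⟨2 * k + 1, by omega⟩ : Fin (2 * m)) ≠ ⟨2 * k' + 1, by omega⟩ := by
    rw [Ne, Fin.mk.injEq]; omega
  unfold pfaffianTerm
  rw [Equiv.Perm.sign_mul, Equiv.Perm.sign_mul, Equiv.Perm.sign_swap h0, Equiv.Perm.sign_swap h1]
  congr 1
  · simp
  rw [← Equiv.prod_comp (Equiv.swap k k')]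
  refine Finset.prod_congr rfl fun j _ => ?_
  congr 1
  all_goals
    simp only [Equiv.Perm.mul_apply]
    congr 1
    simp only [Equiv.swap_apply_def, Fin.mk.injEq]
    split_ifs <;> grind

/-- A permutation of the positions that respects the pairs and takes the last position to `q`. -/
theorem exists_perm_pfaffianTerm {m : ℕ} (A : Matrix (Fin (2 * m + 1 + 1)) (Fin (2 * m + 1 + 1)) ℝ)
    (hA : ∀ i j, A i j = -A j i) (q : Fin (2 * m + 1 + 1)) :
    ∃ ρ : Equiv.Perm (Fin (2 * m + 1 + 1)), ρ (Fin.last _) = q ∧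
      ∀ σ, pfaffianTerm (m := m + 1) A (σ * ρ) = pfaffianTerm (m := m + 1) A σ := by
  have hlast : Fin.last (2 * m + 1) = ⟨2 * ((Fin.last m : Fin (m + 1)) : ℕ) + 1, by simp⟩ := rfl
  rcases Nat.even_or_odd' q with ⟨k, hk | hk⟩
  -- For `q = 2k` the exchange of pairs takes the last position to `2k + 1`, and the swap inside the
  -- pair takes it on to `2k`.
  · refine ⟨Equiv.swap ⟨2 * k, by omega⟩ ⟨2 * k + 1, by omega⟩ *
      (Equiv.swap ⟨2 * k, by omega⟩ ⟨2 * (Fin.last m : Fin (m + 1)), by simp⟩ *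
      Equiv.swap ⟨2 * k + 1, by omega⟩ ⟨2 * (Fin.last m : Fin (m + 1)) + 1, by simp⟩), ?_, ?_⟩
    · simp only [Equiv.Perm.mul_apply]
      have h0 : Equiv.swap (⟨2 * k, by omega⟩ : Fin (2 * m + 1 + 1))
          ⟨2 * (Fin.last m : Fin (m + 1)), by simp⟩ ⟨2 * k + 1, by omega⟩ = ⟨2 * k + 1, by omega⟩ := by
        refine Equiv.swap_apply_of_ne_of_ne ?_ ?_ <;> · rw [Ne, Fin.mk.injEq]; omega
      rw [hlast, Equiv.swap_apply_right, h0, Equiv.swap_apply_right]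
      exact Fin.ext hk.symm
    · intro σ
      rw [← mul_assoc]
      exact (pfaffianTerm_mul_swap_mul_swap (m := m + 1) A _ ⟨k, by omega⟩ (Fin.last m)).trans
        (pfaffianTerm_mul_swap (m := m + 1) A hA σ ⟨k, by omega⟩)
  · refine ⟨Equiv.swap ⟨2 * k, by omega⟩ ⟨2 * (Fin.last m : Fin (m + 1)), by simp⟩ *
      Equiv.swap ⟨2 * k + 1, by omega⟩ ⟨2 * (Fin.last m : Fin (m + 1)) + 1, by simp⟩, ?_, ?_⟩
    · simp only [Equiv.Perm.mul_apply]
      rw [hlast, Equiv.swap_apply_right, Equiv.swap_apply_of_ne_of_ne]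
      · exact Fin.ext hk.symm
      · rw [Ne, Fin.mk.injEq]; omega
      · rw [Ne, Fin.mk.injEq]; omega
    · intro σ
      exact pfaffianTerm_mul_swap_mul_swap (m := m + 1) A σ ⟨k, by omega⟩ (Fin.last m)

/-- Expansion of the Pfaffian along the last column. -/
theorem pfaffian_succ {m : ℕ} (A : Matrix (Fin (2 * m + 1 + 1)) (Fin (2 * m + 1 + 1)) ℝ)
    (hA : ∀ i j, A i j = -A j i) :
    pfaffian (m := m + 1) A = ∑ l : Fin (2 * m + 1), (-1) ^ (l : ℕ) *
      A l.castSucc (Fin.last _) * pfaffian (A.submatrix (fun a => (l.succAbove a).castSucc)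
        (fun a => (l.succAbove a).castSucc)) := by
  choose ρ hρ hρT using exists_perm_pfaffianTerm A hA
  have h1 : ∑ σ, pfaffianTerm (m := m + 1) A σ =
      (2 * m + 2 : ℝ) * ∑ e : Equiv.Perm (Fin (2 * m + 1)),
        pfaffianTerm (m := m + 1) A (Fin.permExtendLast e) := by
    have hρT' : ∀ q σ, pfaffianTerm (m := m + 1) A (σ * (ρ q)⁻¹) =
        pfaffianTerm (m := m + 1) A σ := by
      intro q σ
      rw [← hρT q (σ * (ρ q)⁻¹), inv_mul_cancel_right]
    have hinv : ∀ e : Equiv.Perm (Fin (2 * m + 1)), (Fin.permExtendLast e)⁻¹ =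
        Fin.permExtendLast e⁻¹ := by
      intro e
      refine inv_eq_of_mul_eq_one_right (Equiv.ext fun i => ?_)
      induction i using Fin.lastCases with
      | last => simp [Fin.permExtendLast_last]
      | cast i => simp [Fin.permExtendLast_castSucc]
    -- Inverses are needed because the terms are invariant under `ρ q` on the right, while the
    -- sorting puts `ρ q` on the left. Each of the `2m + 2` classes then contributes the same sum.
    rw [← Equiv.sum_comp (Equiv.inv (Equiv.Perm (Fin (2 * (m + 1)))))]
    refine (Equiv.Perm.sum_eq_sum_permExtendLast (N := 2 * m + 1) _ ρ hρ).trans ?_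
    have h2 : ∀ q, ∑ e : Equiv.Perm (Fin (2 * m + 1)), pfaffianTerm (m := m + 1) A
        (Equiv.inv (Equiv.Perm (Fin (2 * (m + 1)))) (ρ q * Fin.permExtendLast e)) =
        ∑ e : Equiv.Perm (Fin (2 * m + 1)), pfaffianTerm (m := m + 1) A
          (Fin.permExtendLast e) := by
      intro q
      rw [← Equiv.sum_comp (Equiv.inv (Equiv.Perm (Fin (2 * m + 1))))
        (fun e => pfaffianTerm (m := m + 1) A (Fin.permExtendLast e))]
      refine Finset.sum_congr rfl fun e _ => ?_
      rw [Equiv.inv_apply, Equiv.inv_apply, mul_inv_rev, hρT', hinv]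
    rw [Finset.sum_congr rfl fun q _ => h2 q, Finset.sum_const, Finset.card_univ, Fintype.card_fin,
      nsmul_eq_mul]
    push_cast
    ring
  have h3 : ∑ e : Equiv.Perm (Fin (2 * m + 1)), pfaffianTerm (m := m + 1) A
      (Fin.permExtendLast e) = ∑ l : Fin (2 * m + 1), (-1) ^ (l : ℕ) * A l.castSucc (Fin.last _) *
        ∑ e : Equiv.Perm (Fin (2 * m)), pfaffianTerm (A.submatrix (fun a => (l.succAbove a).castSucc)
        (fun a => (l.succAbove a).castSucc)) e := by
    -- The permutations are now sorted by the image `l` of the last but one position. The cycle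
    -- taking that position to `l` has sign `(-1)^(2m - l) = (-1)^l` and lists the other indices in
    -- order, as `succAbove` does.
    rw [Equiv.Perm.sum_eq_sum_permExtendLast _ (fun l => Fin.cycleIcc l (Fin.last _))
      (fun l => Fin.cycleIcc_of_last (Fin.le_last l))]
    refine Finset.sum_congr rfl fun l _ => ?_
    rw [Finset.mul_sum]
    refine Finset.sum_congr rfl fun e _ => ?_
    have hcyc : ∀ a : Fin (2 * m), Fin.cycleIcc l (Fin.last _) a.castSucc = l.succAbove a := by
      intro a
      have := congrFun (Fin.cycleIcc_comp_succAbove l (Fin.last _) (Fin.le_last l)) a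
      rwa [Function.comp_apply, Fin.succAbove_last] at this
    have hsgn : ((Equiv.Perm.sign (Fin.permExtendLast (Fin.cycleIcc l (Fin.last (2 * m)) *
        Fin.permExtendLast e)) : ℤ) : ℝ) = (-1) ^ (l : ℕ) * ((Equiv.Perm.sign e : ℤ) : ℝ) := by
      rw [Fin.sign_permExtendLast, Equiv.Perm.sign_mul, Fin.sign_permExtendLast,
        Fin.sign_cycleIcc_of_le (Fin.le_last l)]
      push_cast
      congr 1
      rw [neg_one_pow_eq_pow_mod_two, neg_one_pow_eq_pow_mod_two (n := (l : ℕ))]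
      congr 1
      omega
    unfold pfaffianTerm
    rw [hsgn]
    have hprod := Fin.prod_univ_castSucc (fun k : Fin (m + 1) =>
      A ((Fin.permExtendLast (Fin.cycleIcc l (Fin.last (2 * m)) * Fin.permExtendLast e))
          ⟨2 * k, by omega⟩)
        ((Fin.permExtendLast (Fin.cycleIcc l (Fin.last (2 * m)) * Fin.permExtendLast e))
          ⟨2 * k + 1, by omega⟩))
    have hlast : A ((Fin.permExtendLast (Fin.cycleIcc l (Fin.last (2 * m)) * Fin.permExtendLast e))
          ⟨2 * (Fin.last m : Fin (m + 1)), by simp⟩)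
        ((Fin.permExtendLast (Fin.cycleIcc l (Fin.last (2 * m)) * Fin.permExtendLast e))
          ⟨2 * (Fin.last m : Fin (m + 1)) + 1, by simp⟩) = A l.castSucc (Fin.last _) := by
      have e1 : (⟨2 * (Fin.last m : Fin (m + 1)), by simp⟩ : Fin (2 * m + 1 + 1)) =
        (Fin.last (2 * m)).castSucc := rfl
      have e2 : (⟨2 * (Fin.last m : Fin (m + 1)) + 1, by simp⟩ : Fin (2 * m + 1 + 1)) =
        Fin.last (2 * m + 1) := rfl
      rw [e1, e2, Fin.permExtendLast_last, Fin.permExtendLast_castSucc, Equiv.Perm.mul_apply,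
        Fin.permExtendLast_last, Fin.cycleIcc_of_last (Fin.le_last l)]
    have hrest : ∀ (j : Fin (2 * m)), Fin.permExtendLast (Fin.cycleIcc l (Fin.last (2 * m)) *
        Fin.permExtendLast e) ⟨j, by omega⟩ = (l.succAbove (e j)).castSucc := by
      intro j
      have e1 : (⟨j, by omega⟩ : Fin (2 * m + 1 + 1)) = j.castSucc.castSucc := rfl
      rw [e1, Fin.permExtendLast_castSucc, Equiv.Perm.mul_apply, Fin.permExtendLast_castSucc, hcyc]
    refine (congrArg _ hprod).trans ?_
    rw [hlast]
    have hrest' : ∀ k : Fin m, A ((Fin.permExtendLast (Fin.cycleIcc l (Fin.last (2 * m)) *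
          Fin.permExtendLast e)) ⟨2 * (k.castSucc : Fin (m + 1)), by simp; omega⟩)
        ((Fin.permExtendLast (Fin.cycleIcc l (Fin.last (2 * m)) * Fin.permExtendLast e))
          ⟨2 * (k.castSucc : Fin (m + 1)) + 1, by simp⟩) =
        (A.submatrix (fun a => (l.succAbove a).castSucc) (fun a => (l.succAbove a).castSucc))
          (e ⟨2 * k, by omega⟩) (e ⟨2 * k + 1, by omega⟩) := by
      intro k
      rw [Matrix.submatrix_apply, ← hrest ⟨2 * k, by omega⟩, ← hrest ⟨2 * k + 1, by omega⟩]
      rfl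
    rw [Finset.prod_congr rfl fun k _ => hrest' k]
    ring
  change 1 / (2 ^ (m + 1) * ((m + 1)! : ℝ)) * ∑ σ, pfaffianTerm (m := m + 1) A σ = _
  rw [h1, h3, Finset.mul_sum, Finset.mul_sum]
  refine Finset.sum_congr rfl fun l _ => ?_
  change _ = (-1) ^ (l : ℕ) * A l.castSucc (Fin.last _) * (1 / (2 ^ m * (m ! : ℝ)) *
    ∑ σ, pfaffianTerm _ σ)
  have hm : (m ! : ℝ) ≠ 0 := by positivity
  rw [Nat.factorial_succ, pow_succ]
  push_cast
  field_simp

end Pfaffian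

/-! ### Powers of a 2-form are Pfaffians -/

section WedgePow

variable {V : Type*} [AddCommGroup V] [Module ℝ V]

theorem alternatingMap_two_apply_swap (a : V [⋀^Fin 2]→ₗ[ℝ] ℝ) (v w : V) :
    a ![v, w] = -a ![w, v] := by
  have h := a.map_swap ![w, v] (i := 0) (j := 1) (by simp)
  rw [← h]
  congr 1
  ext i
  fin_cases i <;> rfl

/-- The shuffles of the wedge product merge with the permutations inside the two factors into all
permutations of `k + l` positions, each occurring once. -/
theorem wedge_smul_alternatization {k l : ℕ} (c d : ℝ)
    (P : MultilinearMap ℝ (fun _ : Fin k => V) ℝ) (Q : MultilinearMap ℝ (fun _ : Fin l => V) ℝ)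
    (v : Fin (k + l) → V) :
    wedge (c • MultilinearMap.alternatization P) (d • MultilinearMap.alternatization Q) v =
      c * d * ∑ σ : Equiv.Perm (Fin (k + l)), ((Equiv.Perm.sign σ : ℤ) : ℝ) *
        (P (fun i => v (σ (Fin.castAdd l i))) * Q (fun i => v (σ (Fin.natAdd k i)))) := by
  have h : (c • MultilinearMap.alternatization P).domCoprod (d • MultilinearMap.alternatization Q) =
      (c * d) • MultilinearMap.alternatization (MultilinearMap.domCoprod P Q) := by
    rw [MultilinearMap.domCoprod_alternization, ← AlternatingMap.domCoprod'_apply,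
      ← AlternatingMap.domCoprod'_apply, TensorProduct.smul_tmul_smul, map_smul]
  rw [wedge, h]
  simp only [AlternatingMap.domDomCongr_apply, LinearMap.compAlternatingMap_apply,
    AlternatingMap.smul_apply, map_smul, MultilinearMap.alternatization_apply, map_sum, smul_eq_mul]
  congr 1
  rw [← Equiv.sum_comp (finSumFinEquiv (m := k) (n := l)).symm.permCongr]
  refine Finset.sum_congr rfl fun σ _ => ?_
  rw [Equiv.Perm.sign_permCongr]
  rw [Units.smul_def, map_zsmul, zsmul_eq_mul]
  simp [Equiv.permCongr_apply, Function.comp_def]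

/-- Each factor `a` is half its own alternatization, which is the origin of the `2 ^ n` in the
Pfaffian. -/
theorem exists_wedgePow_eq_alternatization (a : V [⋀^Fin 2]→ₗ[ℝ] ℝ) (n : ℕ) :
    ∃ P : MultilinearMap ℝ (fun _ : Fin (2 * n) => V) ℝ,
      wedgePow a n = (1 / 2 ^ n : ℝ) • MultilinearMap.alternatization P ∧
      ∀ v, P v = ∏ k : Fin n, a ![v ⟨2 * k, by omega⟩, v ⟨2 * k + 1, by omega⟩] := by
  induction n with
  | zero =>
    refine ⟨MultilinearMap.constOfIsEmpty ℝ (fun _ : Fin 0 => V) 1, ?_, fun v => by simp⟩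
    ext v
    simp [wedgePow, MultilinearMap.alternatization_apply]
  | succ n ih =>
    obtain ⟨P, hP, hPv⟩ := ih
    have ha : a = (1 / 2 : ℝ) • MultilinearMap.alternatization (a : MultilinearMap ℝ (fun _ => V) ℝ) := by
      rw [AlternatingMap.coe_alternatization, Fintype.card_fin]
      ext v
      simp
    refine ⟨((LinearMap.mul' ℝ ℝ).compMultilinearMap (P.domCoprod
      (a : MultilinearMap ℝ (fun _ => V) ℝ))).domDomCongr finSumFinEquiv, ?_, ?_⟩
    · ext v
      have h := wedge_smul_alternatization (1 / 2 ^ n) (1 / 2) P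
        (a : MultilinearMap ℝ (fun _ => V) ℝ) v
      rw [← hP, ← ha] at h
      refine Eq.trans (b := wedge (wedgePow a n) a v) rfl (h.trans ?_)
      rw [AlternatingMap.smul_apply, MultilinearMap.alternatization_apply, smul_eq_mul, pow_succ]
      congr 1
      · field_simp
      · refine Finset.sum_congr rfl fun σ _ => ?_
        simp [Units.smul_def]
        rfl
    · intro v
      refine Eq.trans ?_ (Fin.prod_univ_castSucc _).symm
      refine Eq.trans (b := P (fun i => v (finSumFinEquiv (Sum.inl i))) *
        a (fun i => v (finSumFinEquiv (Sum.inr i)))) (by simp; rfl) ?_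
      rw [hPv]
      congr 1
      congr 1
      ext i
      fin_cases i <;> rfl

/-- `a ^ n / n!` evaluated on vectors is the Pfaffian of the values of `a`. -/
theorem wedgePow_apply_eq_pfaffian (a : V [⋀^Fin 2]→ₗ[ℝ] ℝ) (n : ℕ) (v : Fin (2 * n) → V) :
    ((1 / (n ! : ℝ)) • wedgePow a n) v = pfaffian (Matrix.of fun i j => a ![v i, v j]) := by
  obtain ⟨P, hP, hPv⟩ := exists_wedgePow_eq_alternatization a n
  rw [hP, AlternatingMap.smul_apply, AlternatingMap.smul_apply, MultilinearMap.alternatization_apply,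
    pfaffian, smul_eq_mul, smul_eq_mul, ← mul_assoc]
  congr 1
  · field_simp
  · refine Finset.sum_congr rfl fun σ _ => ?_
    simp [Units.smul_def, hPv]

/-- With `v` the Hamiltonian fields other than `X_{f_i}`, the right-hand side is, up to the
bookkeeping of signs, the sum defining `ω_i(Z)`. -/
theorem pfaffian_apply_snoc {m : ℕ} (a : V [⋀^Fin 2]→ₗ[ℝ] ℝ) (v : Fin (2 * m + 1) → V) (Z : V) :
    ((1 / ((m + 1)! : ℝ)) • wedgePow a (m + 1)) (Fin.snoc (α := fun _ => V) v Z) =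
      ∑ l : Fin (2 * m + 1), (-1) ^ (l : ℕ) * a ![v l, Z] *
        pfaffian (Matrix.of fun i j => a ![v (l.succAbove i), v (l.succAbove j)]) := by
  rw [wedgePow_apply_eq_pfaffian]
  refine (pfaffian_succ (Matrix.of fun i j => a ![(Fin.snoc (α := fun _ => V) v Z :
    Fin (2 * m + 1 + 1) → V) i, (Fin.snoc (α := fun _ => V) v Z : Fin (2 * m + 1 + 1) → V) j])
    (fun i j => alternatingMap_two_apply_swap a _ _)).trans ?_
  refine Finset.sum_congr rfl fun l _ => ?_
  simp only [Matrix.of_apply, Fin.snoc_castSucc, Fin.snoc_last]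
  congr 2
  ext i j
  simp [Fin.snoc_castSucc]

end WedgePow

/-! ### Top powers of nondegenerate 2-forms -/

section Nondegenerate

variable {V : Type*} [AddCommGroup V] [Module ℝ V]

/-- Vectors are added two at a time. For `w` outside the span of `v`, expansion along the last
column writes the new Pfaffian as `a(u, z)`, where `u` is a combination of `v` and `w` whose
coefficient at `w` is the old Pfaffian. Hence `u ≠ 0`, and nondegeneracy supplies `z`. -/
theorem exists_pfaffian_ne_zero [FiniteDimensional ℝ V] (a : V [⋀^Fin 2]→ₗ[ℝ] ℝ)
    (ha : ∀ v, (∀ w, a ![v, w] = 0) → v = 0) (n : ℕ) (hn : 2 * n ≤ Module.finrank ℝ V) :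
    ∃ v : Fin (2 * n) → V, pfaffian (Matrix.of fun i j => a ![v i, v j]) ≠ 0 := by
  have hadd : ∀ u v z, a ![u + v, z] = a ![u, z] + a ![v, z] := fun u v z => by
    have h (b : V) : Function.update ![(0 : V), z] 0 b = ![b, z] := by
      funext i; fin_cases i <;> rfl
    simpa only [h] using a.map_update_add ![0, z] 0 u v
  have hsmul : ∀ (c : ℝ) v z, a ![c • v, z] = c * a ![v, z] := fun c v z => by
    have h (b : V) : Function.update ![(0 : V), z] 0 b = ![b, z] := by
      funext i; fin_cases i <;> rfl
    simpa only [h, smul_eq_mul] using a.map_update_smul ![0, z] 0 c v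
  induction n with
  | zero => exact ⟨fun _ => 0, by simp [pfaffian]⟩
  | succ n ih =>
    obtain ⟨v, hv⟩ := ih (by omega)
    have hspan : Submodule.span ℝ (range v) ≠ ⊤ := by
      intro h
      have h1 := finrank_range_le_card (R := ℝ) v
      rw [Set.finrank, h, finrank_top, Fintype.card_fin] at h1
      omega
    obtain ⟨w, hw⟩ : ∃ w, w ∉ Submodule.span ℝ (range v) := by
      by_contra! h
      exact hspan (eq_top_iff.2 fun x _ => h x)
    let v' : Fin (2 * n + 1) → V := Fin.snoc (α := fun _ => V) v w
    let u : V := ∑ l : Fin (2 * n + 1), ((-1) ^ (l : ℕ) *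
        pfaffian (Matrix.of fun i j => a ![v' (l.succAbove i), v' (l.succAbove j)])) • v' l
    have hu : u ≠ 0 := by
      intro h0
      have h1 : u = (∑ l : Fin (2 * n), ((-1) ^ (l : ℕ) * pfaffian (Matrix.of fun i j =>
          a ![v' (l.castSucc.succAbove i), v' (l.castSucc.succAbove j)])) • v l) +
          pfaffian (Matrix.of fun i j => a ![v i, v j]) • w := by
        simp only [u]
        rw [Fin.sum_univ_castSucc]
        simp [v', Fin.snoc_castSucc, Fin.snoc_last, Fin.succAbove_last]
      rw [h0] at h1
      have h2 : pfaffian (Matrix.of fun i j => a ![v i, v j]) • w ∈ Submodule.span ℝ (range v) := by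
        rw [← neg_eq_of_add_eq_zero_right h1.symm]
        exact Submodule.neg_mem _ (Submodule.sum_mem _ fun l _ =>
          Submodule.smul_mem _ _ (Submodule.subset_span ⟨l, rfl⟩))
      exact hw ((Submodule.smul_mem_iff _ hv).1 h2)
    obtain ⟨z, hz⟩ : ∃ z, a ![u, z] ≠ 0 := by
      by_contra! h
      exact hu (ha u h)
    refine ⟨Fin.snoc (α := fun _ => V) v' z, ?_⟩
    rw [← wedgePow_apply_eq_pfaffian]
    refine ne_of_eq_of_ne (pfaffian_apply_snoc a v' z) (ne_of_eq_of_ne ?_ hz)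
    have hsum : ∀ (s : Finset (Fin (2 * n + 1))) (g : Fin (2 * n + 1) → V),
        a ![∑ l ∈ s, g l, z] = ∑ l ∈ s, a ![g l, z] := by
      intro s g
      induction s using Finset.induction_on with
      | empty =>
        have := hsmul 0 0 z
        rw [zero_smul, zero_mul] at this
        simpa using this
      | insert i s hi ih => rw [Finset.sum_insert hi, hadd, ih, Finset.sum_insert hi]
    rw [hsum]
    refine Finset.sum_congr rfl fun l _ => ?_
    rw [hsmul]
    ring

end Nondegenerate

/-! ### Poisson brackets and the frame of Hamiltonian vector fields -/

section Bracket

variable {n : ℕ} {M : Type*} [TopologicalSpace M]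
  [ChartedSpace (EuclideanSpace ℝ (Fin (2 * n))) M] (S : SymplecticForm n M)

theorem SymplecticForm.toForm_swap (x : M) (v w : TangentSpace (𝓡 (2 * n)) x) :
    S.toForm x ![v, w] = -S.toForm x ![w, v] :=
  alternatingMap_two_apply_swap (S.toForm x).toAlternatingMap v w

theorem SymplecticForm.bracket_eq (g h : M → ℝ) (x : M) :
    S.bracket g h x = mvfderiv (𝓡 (2 * n)) g x (S.hamVF h x) :=
  S.hamVF_spec g x _

theorem SymplecticForm.bracket_swap (g h : M → ℝ) (x : M) : S.bracket g h x = -S.bracket h g x :=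
  S.toForm_swap x _ _

theorem SymplecticForm.bracket_bracket_swap (f g h : M → ℝ) (x : M) :
    S.bracket (S.bracket f g) h x = -S.bracket (S.bracket g f) h x := by
  have h1 : S.bracket f g = -S.bracket g f := by
    funext z
    exact S.bracket_swap f g z
  rw [h1, S.bracket_eq, S.bracket_eq, mvfderiv_neg]
  rfl

end Bracket

section Frame

variable {m : ℕ} {M : Type*} [TopologicalSpace M]
  [ChartedSpace (EuclideanSpace ℝ (Fin (2 * (m + 1)))) M] (S : SymplecticForm (m + 1) M)

/-- A form of top degree that is nonzero somewhere does not vanish on any basis. -/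
theorem SymplecticForm.liouville_ne_zero (x : M)
    (v : Fin (2 * (m + 1)) → TangentSpace (𝓡 (2 * (m + 1))) x) (hv : LinearIndependent ℝ v) :
    S.liouville x v ≠ 0 := by
  have : FiniteDimensional ℝ (TangentSpace (𝓡 (2 * (m + 1))) x) :=
    inferInstanceAs (FiniteDimensional ℝ (EuclideanSpace ℝ (Fin (2 * (m + 1)))))
  have hr : Module.finrank ℝ (TangentSpace (𝓡 (2 * (m + 1))) x) = 2 * (m + 1) :=
    finrank_euclideanSpace_fin
  obtain ⟨w, hw⟩ := exists_pfaffian_ne_zero (S.toForm x).toAlternatingMap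
    (S.nondegenerate x) (m + 1) hr.ge
  have hΩ : S.liouville x ≠ 0 := by
    intro h
    refine hw ?_
    rw [← wedgePow_apply_eq_pfaffian]
    exact DFunLike.congr_fun h w
  let b := basisOfLinearIndependentOfCardEqFinrank hv (by rw [hr, Fintype.card_fin])
  have hb : ⇑b = v := coe_basisOfLinearIndependentOfCardEqFinrank hv _
  rw [← hb]
  exact (AlternatingMap.map_basis_ne_zero_iff b _).2 hΩ

variable (f : Fin (2 * m + 1 + 1) → C^∞⟮𝓡 (2 * (m + 1)), M; 𝓘(ℝ), ℝ⟯)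

/-- The forms `ω_i` are contractions of the Liouville volume form. -/
theorem pfaffianForm_apply (i : Fin (2 * m + 1 + 1)) (x : M) (Z : TangentSpace (𝓡 (2 * (m + 1))) x) :
    pfaffianForm S f i x Z = S.liouville x
      (Fin.snoc (α := fun _ => TangentSpace (𝓡 (2 * (m + 1))) x)
        (fun a : Fin (2 * m + 1) => S.hamVF (f (i.succAbove a)) x) Z) := by
  refine Eq.trans ?_ (pfaffian_apply_snoc (S.toForm x).toAlternatingMap
    (fun a : Fin (2 * m + 1) => S.hamVF (f (i.succAbove a)) x) Z).symm
  rw [pfaffianForm, sum_apply]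
  refine Finset.sum_congr rfl fun l _ => ?_
  -- Put `k = i.succAbove l`. If `k < i`, then `k = l` and `sgn (i - k) = 1`; if `k > i`, then `k =
  -- l + 1` and the two sign changes cancel.
  have hsgn : (-1 : ℝ) ^ (i.succAbove l : ℕ) *
      (Int.sign ((i : ℤ) - (i.succAbove l : ℤ)) : ℝ) = (-1) ^ (l : ℕ) := by
    rcases lt_or_ge l.castSucc i with h | h
    · rw [Fin.succAbove_of_castSucc_lt _ _ h, Fin.val_castSucc, Int.sign_eq_one_of_pos]
      · simp
      · have : (l : ℕ) < i := h
        omega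
    · rw [Fin.succAbove_of_le_castSucc _ _ h, Fin.val_succ, Int.sign_eq_neg_one_of_neg]
      · simp [pow_succ]
      · have : (i : ℕ) ≤ l := h
        push_cast
        omega
  rw [smul_apply, hsgn, smul_eq_mul, ← S.hamVF_spec]
  simp only [mul_assoc]
  congr 1
  exact mul_comm _ _

/-- `X_{f_j}` occurs twice among the arguments of the volume form. -/
theorem pfaffianForm_hamVF_of_ne {i j : Fin (2 * m + 1 + 1)} (h : j ≠ i) (x : M) :
    pfaffianForm S f i x (S.hamVF (f j) x) = 0 := by
  obtain ⟨l, rfl⟩ := Fin.exists_succAbove_eq h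
  rw [pfaffianForm_apply]
  refine AlternatingMap.map_eq_zero_of_eq _ _ (i := l.castSucc) (j := Fin.last _) ?_
    (Fin.castSucc_lt_last l).ne
  rw [Fin.snoc_castSucc, Fin.snoc_last]

variable {f}

theorem linearIndependent_hamVF (hf : FunctionallyIndependent f) (x : M) :
    LinearIndependent ℝ fun a => S.hamVF (f a) x := by
  have h1 : (S.flat x) ∘ (fun a => S.hamVF (f a) x) =
      fun a => (ContinuousLinearMap.coeLM ℝ) (mvfderiv (𝓡 (2 * (m + 1))) (f a) x) := by
    funext a
    ext w
    exact S.hamVF_spec _ _ _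
  refine LinearIndependent.of_comp (S.flat x) ?_
  rw [h1]
  exact (hf x).map' (ContinuousLinearMap.coeLM ℝ) (LinearMap.ker_eq_bot.2
    ContinuousLinearMap.coe_injective)

/-- Inserting the missing field yields a reordering of the frame, on which the volume form does not
vanish. -/
theorem pfaffianForm_hamVF_self_ne_zero (hf : FunctionallyIndependent f) (i : Fin (2 * m + 1 + 1))
    (x : M) : pfaffianForm S f i x (S.hamVF (f i) x) ≠ 0 := by
  rw [pfaffianForm_apply]
  refine S.liouville_ne_zero x _ ?_
  have h : (Fin.snoc (α := fun _ => TangentSpace (𝓡 (2 * (m + 1))) x)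
        (fun a : Fin (2 * m + 1) => S.hamVF (f (i.succAbove a)) x) (S.hamVF (f i) x)) =
      (fun a => S.hamVF (f a) x) ∘ (Fin.snoc (α := fun _ => Fin (2 * m + 1 + 1)) i.succAbove i) := by
    funext a
    induction a using Fin.lastCases with
    | last => simp
    | cast a => simp
  rw [h]
  refine (linearIndependent_hamVF S hf x).comp _ ?_
  intro a b hab
  induction a using Fin.lastCases with
  | last =>
    induction b using Fin.lastCases with
    | last => rfl
    | cast b => simp at hab
  | cast a =>
    induction b using Fin.lastCases with
    | last => simp at hab
    | cast b => simpa using hab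

/-- Coordinates of tangent vectors in the frame of Hamiltonian vector fields. -/
theorem eq_sum_hamVF (hf : FunctionallyIndependent f) (x : M)
    (v : TangentSpace (𝓡 (2 * (m + 1))) x) :
    v = ∑ a, (pfaffianForm S f a x v / pfaffianForm S f a x (S.hamVF (f a) x)) •
      S.hamVF (f a) x := by
  have : FiniteDimensional ℝ (TangentSpace (𝓡 (2 * (m + 1))) x) :=
    inferInstanceAs (FiniteDimensional ℝ (EuclideanSpace ℝ (Fin (2 * (m + 1)))))
  have hr : Module.finrank ℝ (TangentSpace (𝓡 (2 * (m + 1))) x) = 2 * (m + 1) :=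
    finrank_euclideanSpace_fin
  let b := basisOfLinearIndependentOfCardEqFinrank (linearIndependent_hamVF S hf x)
    (by rw [hr, Fintype.card_fin]; rfl)
  have hb : ∀ a, b a = S.hamVF (f a) x := fun a => by simp [b]
  have hv := (b.sum_repr v).symm
  simp only [hb] at hv
  have key : ∀ a, pfaffianForm S f a x v = b.repr v a * pfaffianForm S f a x (S.hamVF (f a) x) := by
    intro a
    conv_lhs => rw [hv]
    rw [map_sum, Finset.sum_eq_single a]
    · rw [map_smul, smul_eq_mul]
    · intro c _ hc
      rw [map_smul, pfaffianForm_hamVF_of_ne S f hc, smul_zero]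
    · simp
  conv_lhs => rw [hv]
  refine Finset.sum_congr rfl fun a _ => ?_
  rw [key, mul_div_cancel_right₀ _ (pfaffianForm_hamVF_self_ne_zero S hf a x)]

theorem linearIndependent_pfaffianForm (hf : FunctionallyIndependent f) (x : M) :
    LinearIndependent ℝ fun a => pfaffianForm S f a x := by
  rw [Fintype.linearIndependent_iff]
  intro c hc a
  have h := DFunLike.congr_fun hc (S.hamVF (f a) x)
  rw [sum_apply, Finset.sum_eq_single a] at h
  · exact (mul_eq_zero.1 h).resolve_right (pfaffianForm_hamVF_self_ne_zero S hf a x)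
  · intro b _ hb
    rw [smul_apply, pfaffianForm_hamVF_of_ne S f hb.symm, smul_zero]
  · simp

/-- Up to non-vanishing factors the forms are the coordinate functions of the frame
(`eq_sum_hamVF`). These kernels are the distributions to be integrated. -/
theorem forall_pfaffianForm_eq_zero_iff (hf : FunctionallyIndependent f) (x : M)
    (v : TangentSpace (𝓡 (2 * (m + 1))) x) (k : Fin (2 * m + 1 + 1)) :
    (∀ i, k ≤ i → pfaffianForm S f i x v = 0) ↔
      v ∈ Submodule.span ℝ ((fun a => S.hamVF (f a) x) '' Iio k) := by
  constructor
  · intro h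
    rw [eq_sum_hamVF S hf x v]
    refine Submodule.sum_mem _ fun a _ => ?_
    by_cases ha : k ≤ a
    · rw [h a ha, zero_div, zero_smul]
      exact Submodule.zero_mem _
    · exact Submodule.smul_mem _ _ (Submodule.subset_span ⟨a, not_le.1 ha, rfl⟩)
  · intro h i hi
    induction h using Submodule.span_induction with
    | mem v hv =>
      obtain ⟨a, ha, rfl⟩ := hv
      exact pfaffianForm_hamVF_of_ne S f (ne_of_lt (lt_of_lt_of_le ha hi)) x
    | zero => exact map_zero _
    | add u v _ _ hu hv => rw [map_add, hu, hv, add_zero]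
    | smul c v _ hv => rw [map_smul, hv, smul_zero]

end Frame

/-! ### Functions, vector fields and forms in charts -/

section Chart

variable {d : ℕ} {M : Type*} [TopologicalSpace M] [ChartedSpace (EuclideanSpace ℝ (Fin d)) M]

/-- The derivative of the inverse of the preferred chart at `x₀`. -/
def chartFrame (x₀ : M) (y : EuclideanSpace ℝ (Fin d)) :
    EuclideanSpace ℝ (Fin d) →L[ℝ] TangentSpace (𝓡 d) ((extChartAt (𝓡 d) x₀).symm y) :=
  mfderiv 𝓘(ℝ, EuclideanSpace ℝ (Fin d)) (𝓡 d) (extChartAt (𝓡 d) x₀).symm y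

/-- The expression of a vector field in the preferred chart at `x₀`. -/
def chartVF (v : (x : M) → TangentSpace (𝓡 d) x) (x₀ : M) (y : EuclideanSpace ℝ (Fin d)) :
    EuclideanSpace ℝ (Fin d) :=
  (chartFrame x₀ y).inverse (v ((extChartAt (𝓡 d) x₀).symm y))

theorem DForm.chartRep_apply {k : ℕ} (α : DForm d M k) (x₀ : M) (y : EuclideanSpace ℝ (Fin d))
    (v : Fin k → EuclideanSpace ℝ (Fin d)) :
    α.chartRep x₀ y v = α ((extChartAt (𝓡 d) x₀).symm y) (fun i => chartFrame x₀ y (v i)) := rfl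

theorem ContMDiffOn.of_comp_extChartAt_symm [IsManifold (𝓡 d) ∞ M] {h : M → ℝ} {x₀ : M}
    (hh : ContDiffOn ℝ ∞ (h ∘ (extChartAt (𝓡 d) x₀).symm) (extChartAt (𝓡 d) x₀).target) :
    ContMDiffOn (𝓡 d) 𝓘(ℝ) ∞ h (extChartAt (𝓡 d) x₀).source := by
  have h1 : ContMDiffOn (𝓡 d) 𝓘(ℝ) ∞
      ((h ∘ (extChartAt (𝓡 d) x₀).symm) ∘ extChartAt (𝓡 d) x₀) (extChartAt (𝓡 d) x₀).source := by
    refine hh.contMDiffOn.comp ?_ (fun x hx => (extChartAt (𝓡 d) x₀).map_source hx)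
    rw [extChartAt_source]
    exact contMDiffOn_extChartAt
  refine h1.congr fun x hx => ?_
  simp only [Function.comp_apply, (extChartAt (𝓡 d) x₀).left_inv hx]

theorem contMDiff_of_forall_comp_extChartAt_symm [IsManifold (𝓡 d) ∞ M] {h : M → ℝ}
    (hh : ∀ x₀ : M, ContDiffOn ℝ ∞ (h ∘ (extChartAt (𝓡 d) x₀).symm) (extChartAt (𝓡 d) x₀).target) :
    ContMDiff (𝓡 d) 𝓘(ℝ) ∞ h := fun x =>
  (ContMDiffOn.of_comp_extChartAt_symm (hh x)).contMDiffAt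
    ((isOpen_extChartAt_source x).mem_nhds (mem_extChartAt_source x))

variable [IsManifold (𝓡 d) ∞ M] {x₀ : M} {y : EuclideanSpace ℝ (Fin d)}

theorem ContMDiff.comp_extChartAt_symm {h : M → ℝ} (hh : ContMDiff (𝓡 d) 𝓘(ℝ) ∞ h) (x₀ : M) :
    ContDiffOn ℝ ∞ (h ∘ (extChartAt (𝓡 d) x₀).symm) (extChartAt (𝓡 d) x₀).target :=
  (hh.comp_contMDiffOn (contMDiffOn_extChartAt_symm x₀)).contDiffOn

theorem mdifferentiableAt_extChartAt_symm (hy : y ∈ (extChartAt (𝓡 d) x₀).target) :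
    MDifferentiableAt 𝓘(ℝ, EuclideanSpace ℝ (Fin d)) (𝓡 d) (extChartAt (𝓡 d) x₀).symm y := by
  have : IsManifold (𝓡 d) 1 M := IsManifold.of_le (n := ∞) (by norm_num)
  have h := mdifferentiableWithinAt_extChartAt_symm (I := 𝓡 d) hy
  rwa [ModelWithCorners.range_eq_univ, mdifferentiableWithinAt_univ] at h

theorem isInvertible_chartFrame (hy : y ∈ (extChartAt (𝓡 d) x₀).target) :
    (chartFrame x₀ y).IsInvertible := by
  have : IsManifold (𝓡 d) 1 M := IsManifold.of_le (n := ∞) (by norm_num)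
  have h := isInvertible_mfderivWithin_extChartAt_symm (I := 𝓡 d) hy
  rwa [ModelWithCorners.range_eq_univ, mfderivWithin_univ] at h

theorem chartFrame_chartVF (v : (x : M) → TangentSpace (𝓡 d) x)
    (hy : y ∈ (extChartAt (𝓡 d) x₀).target) :
    chartFrame x₀ y (chartVF v x₀ y) = v ((extChartAt (𝓡 d) x₀).symm y) :=
  (isInvertible_chartFrame hy).self_apply_inverse _

theorem fderiv_comp_extChartAt_symm {h : M → ℝ} (hy : y ∈ (extChartAt (𝓡 d) x₀).target)
    (hh : MDifferentiableAt (𝓡 d) 𝓘(ℝ) h ((extChartAt (𝓡 d) x₀).symm y))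
    (w : EuclideanSpace ℝ (Fin d)) :
    fderiv ℝ (h ∘ (extChartAt (𝓡 d) x₀).symm) y w =
      mvfderiv (𝓡 d) h ((extChartAt (𝓡 d) x₀).symm y) (chartFrame x₀ y w) := by
  have h1 := mvfderiv_comp_apply (I := 𝓘(ℝ, EuclideanSpace ℝ (Fin d))) y hh
    (mdifferentiableAt_extChartAt_symm hy) w
  refine Eq.trans ?_ h1
  rw [mvfderiv, mfderiv_eq_fderiv]
  rfl

theorem fderiv_comp_extChartAt_symm_chartVF {h : M → ℝ} (hy : y ∈ (extChartAt (𝓡 d) x₀).target)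
    (hh : MDifferentiableAt (𝓡 d) 𝓘(ℝ) h ((extChartAt (𝓡 d) x₀).symm y))
    (v : (x : M) → TangentSpace (𝓡 d) x) :
    fderiv ℝ (h ∘ (extChartAt (𝓡 d) x₀).symm) y (chartVF v x₀ y) =
      mvfderiv (𝓡 d) h ((extChartAt (𝓡 d) x₀).symm y) (v ((extChartAt (𝓡 d) x₀).symm y)) := by
  rw [fderiv_comp_extChartAt_symm hy hh, chartFrame_chartVF v hy]

theorem mfderiv_extChartAt_eq_chartVF (v : (x : M) → TangentSpace (𝓡 d) x) (x : M) :
    mfderiv (𝓡 d) 𝓘(ℝ, EuclideanSpace ℝ (Fin d)) (extChartAt (𝓡 d) x) x (v x) =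
      chartVF v x (extChartAt (𝓡 d) x x) := by
  have : IsManifold (𝓡 d) 1 M := IsManifold.of_le (n := ∞) (by norm_num)
  have hy := mem_extChartAt_target (I := 𝓡 d) x
  have h := mfderiv_extChartAt_comp_mfderivWithin_extChartAt_symm (I := 𝓡 d) hy
  rw [ModelWithCorners.range_eq_univ, mfderivWithin_univ] at h
  have h2 := DFunLike.congr_fun h (chartVF v x (extChartAt (𝓡 d) x x))
  have h3 : chartFrame x (extChartAt (𝓡 d) x x) (chartVF v x (extChartAt (𝓡 d) x x)) =
    v ((extChartAt (𝓡 d) x).symm (extChartAt (𝓡 d) x x)) := chartFrame_chartVF v hy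
  refine Eq.trans ?_ h2
  change _ = (mfderiv (𝓡 d) 𝓘(ℝ, EuclideanSpace ℝ (Fin d)) (extChartAt (𝓡 d) x)
    ((extChartAt (𝓡 d) x).symm (extChartAt (𝓡 d) x x)))
    (chartFrame x (extChartAt (𝓡 d) x x) (chartVF v x (extChartAt (𝓡 d) x x)))
  rw [h3, extChartAt_to_inv]

/-- The exterior derivative at `x` on vector fields, computed in the preferred chart at `x`. -/
theorem DForm.extD_apply {k : ℕ} (α : DForm d M k) (x : M)
    (v : Fin (k + 1) → (x : M) → TangentSpace (𝓡 d) x) :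
    α.extD x (fun i => v i x) = extDeriv (α.chartRep x) (extChartAt (𝓡 d) x x)
      (fun i => chartVF (v i) x (extChartAt (𝓡 d) x x)) := by
  change extDeriv (α.chartRep x) (extChartAt (𝓡 d) x x)
    (fun i => mfderiv (𝓡 d) 𝓘(ℝ, EuclideanSpace ℝ (Fin d)) (extChartAt (𝓡 d) x) x (v i x)) = _
  congr 1
  funext i
  exact mfderiv_extChartAt_eq_chartVF (v i) x

end Chart

/-! ### Exterior derivatives evaluated on vector fields -/

section ExteriorDerivative

variable {E : Type*} [NormedAddCommGroup E] [NormedSpace ℝ E] {u v w : E → E} {y : E}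

/-- The invariant formula: on Hamiltonian fields both the derivatives along fields and the Lie
brackets can be expressed by Poisson brackets. -/
theorem extDeriv_one_form_apply {α : E → E [⋀^Fin 1]→L[ℝ] ℝ} (hα : DifferentiableAt ℝ α y)
    (hu : DifferentiableAt ℝ u y) (hv : DifferentiableAt ℝ v y) :
    extDeriv α y ![u y, v y] = fderiv ℝ (fun z => α z ![v z]) y (u y) -
      fderiv ℝ (fun z => α z ![u z]) y (v y) - α y ![VectorField.lieBracket ℝ u v y] := by
  have e (z : E) : (fun i : Fin 2 => (![u, v] : Fin 2 → E → E) i z) = ![u z, v z] := by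
    funext i; fin_cases i <;> rfl
  have e₀ (z : E) : (0 : Fin 2).removeNth ![u z, v z] = ![v z] := by
    funext i; fin_cases i; rfl
  have e₁ (z : E) : (1 : Fin 2).removeNth ![u z, v z] = ![u z] := by
    funext i; fin_cases i; rfl
  have h := extDeriv_apply_vectorField (V := ![u, v]) hα (by
    intro i; fin_cases i
    exacts [hu, hv])
  simp only [e] at h
  rw [h, Fin.sum_univ_two, Fin.sum_univ_one, show Finset.Ici (0 : Fin 1) = {0} from by decide,
    Finset.sum_singleton]
  simp only [e₀, e₁]
  simp [e₀, sub_eq_add_neg]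

theorem extDeriv_two_form_apply {α : E → E [⋀^Fin 2]→L[ℝ] ℝ} (hα : DifferentiableAt ℝ α y)
    (hu : DifferentiableAt ℝ u y) (hv : DifferentiableAt ℝ v y) (hw : DifferentiableAt ℝ w y) :
    extDeriv α y ![u y, v y, w y] = fderiv ℝ (fun z => α z ![v z, w z]) y (u y) -
      fderiv ℝ (fun z => α z ![u z, w z]) y (v y) + fderiv ℝ (fun z => α z ![u z, v z]) y (w y) -
      α y ![VectorField.lieBracket ℝ u v y, w y] + α y ![VectorField.lieBracket ℝ u w y, v y] -
      α y ![VectorField.lieBracket ℝ v w y, u y] := by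
  have e (z : E) : (fun i : Fin 3 => (![u, v, w] : Fin 3 → E → E) i z) = ![u z, v z, w z] := by
    funext i; fin_cases i <;> rfl
  have e₀ (z : E) : (0 : Fin 3).removeNth ![u z, v z, w z] = ![v z, w z] := by
    funext i; fin_cases i <;> rfl
  have e₁ (z : E) : (1 : Fin 3).removeNth ![u z, v z, w z] = ![u z, w z] := by
    funext i; fin_cases i <;> rfl
  have e₂ (z : E) : (2 : Fin 3).removeNth ![u z, v z, w z] = ![u z, v z] := by
    funext i; fin_cases i <;> rfl
  have f₀ (a b : E) : (0 : Fin 2).removeNth ![a, b] = ![b] := by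
    funext i; fin_cases i; rfl
  have f₁ (a b : E) : (1 : Fin 2).removeNth ![a, b] = ![a] := by
    funext i; fin_cases i; rfl
  have h := extDeriv_apply_vectorField (V := ![u, v, w]) hα (by
    intro i; fin_cases i
    exacts [hu, hv, hw])
  simp only [e] at h
  rw [h, Fin.sum_univ_three, Fin.sum_univ_two, show Finset.Ici (0 : Fin 2) = {0, 1} from by decide,
    show Finset.Ici (1 : Fin 2) = {1} from by decide, Finset.sum_singleton,
    Finset.sum_pair (by decide)]
  simp only [Fin.castSucc_zero, Fin.castSucc_one, e₀, e₁, e₂, f₀, f₁]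
  simp
  ring

end ExteriorDerivative

/-! ### Smooth 1-forms -/

section SmoothForms

variable {d : ℕ} {M : Type*} [TopologicalSpace M] [ChartedSpace (EuclideanSpace ℝ (Fin d)) M]

theorem OneForm.chartRep_toDForm (α : OneForm d M) (x₀ : M) (y : EuclideanSpace ℝ (Fin d)) :
    α.toDForm.chartRep x₀ y = ContinuousAlternatingMap.ofSubsingletonLIE (𝕜 := ℝ)
      (E := EuclideanSpace ℝ (Fin d)) (F := ℝ) (0 : Fin 1)
      ((α ((extChartAt (𝓡 d) x₀).symm y)).comp (chartFrame x₀ y)) := rfl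

theorem OneForm.toDForm_apply (α : OneForm d M) (x : M) (v : Fin 1 → TangentSpace (𝓡 d) x) :
    α.toDForm x v = α x (v 0) := rfl

variable [IsManifold (𝓡 d) ∞ M]

theorem OneForm.isSmooth_mvfderiv {h : M → ℝ} (hh : ContMDiff (𝓡 d) 𝓘(ℝ) ∞ h) :
    (OneForm.toDForm (fun x => mvfderiv (𝓡 d) h x)).IsSmooth := by
  intro x₀
  have h1 : ContDiffOn ℝ ∞ (fderiv ℝ (h ∘ (extChartAt (𝓡 d) x₀).symm))
      (extChartAt (𝓡 d) x₀).target :=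
    (hh.comp_extChartAt_symm x₀).fderiv_of_isOpen (isOpen_extChartAt_target x₀) (by simp)
  refine ((ContinuousAlternatingMap.ofSubsingletonLIE (𝕜 := ℝ)
      (E := EuclideanSpace ℝ (Fin d)) (F := ℝ) (0 : Fin 1)).contDiff.comp_contDiffOn h1).congr fun y hy => ?_
  rw [OneForm.chartRep_toDForm, Function.comp_apply]
  congr 1
  ext w
  exact (fderiv_comp_extChartAt_symm hy (hh.mdifferentiable (by simp) _) w).symm

theorem OneForm.isSmooth_sum_smul {ι : Type*} (s : Finset ι) {h : ι → M → ℝ}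
    {α : ι → OneForm d M} (hh : ∀ i, ContMDiff (𝓡 d) 𝓘(ℝ) ∞ (h i))
    (hα : ∀ i, (α i).toDForm.IsSmooth) :
    (OneForm.toDForm (fun x => ∑ i ∈ s, h i x • α i x)).IsSmooth := by
  intro x₀
  refine (ContDiffOn.sum (s := s) fun i _ =>
    ((hh i).comp_extChartAt_symm x₀).smul (hα i x₀)).congr fun y _ => ?_
  ext v
  rw [ContinuousAlternatingMap.sum_apply, DForm.chartRep_apply, OneForm.toDForm_apply, sum_apply]
  rfl

end SmoothForms

/-! ### Hamiltonian vector fields in charts and the Jacobi identity -/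

section ChartHamiltonian

variable {n : ℕ} {M : Type*} [TopologicalSpace M]
  [ChartedSpace (EuclideanSpace ℝ (Fin (2 * n))) M] [IsManifold (𝓡 (2 * n)) ∞ M]
  (S : SymplecticForm n M) {x₀ : M} {y : EuclideanSpace ℝ (Fin (2 * n))}

namespace SymplecticForm

/-- The contraction map of the symplectic form in a chart. -/
def chartFlat (x₀ : M) (y : EuclideanSpace ℝ (Fin (2 * n))) :
    EuclideanSpace ℝ (Fin (2 * n)) →L[ℝ] EuclideanSpace ℝ (Fin (2 * n)) →L[ℝ] ℝ :=
  (ContinuousAlternatingMap.ofSubsingletonLIE (𝕜 := ℝ)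
      (E := EuclideanSpace ℝ (Fin (2 * n))) (F := ℝ) (0 : Fin 1)).symm.toContinuousLinearEquiv.toContinuousLinearMap
    ∘L (S.toForm.chartRep x₀ y).curryLeft

omit [IsManifold (𝓡 (2 * n)) ∞ M] in
theorem chartFlat_apply (v w : EuclideanSpace ℝ (Fin (2 * n))) :
    S.chartFlat x₀ y v w = S.toForm.chartRep x₀ y ![v, w] := by
  change S.toForm.chartRep x₀ y (Matrix.vecCons v fun _ => w) = _
  congr 1
  funext i
  fin_cases i <;> rfl

omit [IsManifold (𝓡 (2 * n)) ∞ M] in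
theorem chartRep_toForm_apply (v w : EuclideanSpace ℝ (Fin (2 * n))) :
    S.toForm.chartRep x₀ y ![v, w] = S.toForm ((extChartAt (𝓡 (2 * n)) x₀).symm y)
      ![chartFrame x₀ y v, chartFrame x₀ y w] := by
  rw [DForm.chartRep_apply]
  congr 1
  funext i
  fin_cases i <;> rfl

omit [IsManifold (𝓡 (2 * n)) ∞ M] in
theorem contDiffOn_chartFlat (x₀ : M) :
    ContDiffOn ℝ ∞ (S.chartFlat x₀) (extChartAt (𝓡 (2 * n)) x₀).target := by
  refine contDiffOn_clm_apply.2 fun v => contDiffOn_clm_apply.2 fun w => ?_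
  simp only [chartFlat_apply]
  exact (S.smooth x₀).continuousLinearMap_comp (ContinuousAlternatingMap.apply ℝ
    (EuclideanSpace ℝ (Fin (2 * n))) ℝ ![v, w])

theorem isInvertible_chartFlat (hy : y ∈ (extChartAt (𝓡 (2 * n)) x₀).target) :
    (S.chartFlat x₀ y).IsInvertible := by
  have hinj : Function.Injective (S.chartFlat x₀ y) := by
    rw [injective_iff_map_eq_zero]
    intro v hv
    obtain ⟨e, he⟩ := isInvertible_chartFrame hy
    have h0 : chartFrame x₀ y v = 0 := by
      refine S.nondegenerate _ _ fun w => ?_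
      have h1 := chartRep_toForm_apply S (x₀ := x₀) (y := y) v (e.symm w)
      rw [← chartFlat_apply, hv, ← he] at h1
      erw [e.apply_symm_apply] at h1
      rw [← he]
      exact h1.symm
    rw [← he] at h0
    exact e.map_eq_zero_iff.1 h0
  have hdim : Module.finrank ℝ (EuclideanSpace ℝ (Fin (2 * n))) =
      Module.finrank ℝ (EuclideanSpace ℝ (Fin (2 * n)) →L[ℝ] ℝ) := by
    rw [← LinearMap.toContinuousLinearMap.finrank_eq]
    exact Subspace.dual_finrank_eq.symm
  refine ⟨(LinearMap.linearEquivOfInjective (S.chartFlat x₀ y).toLinearMap hinj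
    hdim).toContinuousLinearEquiv, ?_⟩
  ext v w
  rfl

theorem chartFlat_chartVF_hamVF {f : M → ℝ} (hy : y ∈ (extChartAt (𝓡 (2 * n)) x₀).target)
    (hf : MDifferentiableAt (𝓡 (2 * n)) 𝓘(ℝ) f ((extChartAt (𝓡 (2 * n)) x₀).symm y)) :
    S.chartFlat x₀ y (chartVF (S.hamVF f) x₀ y) =
      fderiv ℝ (f ∘ (extChartAt (𝓡 (2 * n)) x₀).symm) y := by
  ext w
  rw [chartFlat_apply, chartRep_toForm_apply, chartFrame_chartVF _ hy, S.hamVF_spec,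
    fderiv_comp_extChartAt_symm hy hf]

/-- In a chart `X_f` is the inverse of the contraction map applied to `df`, and inversion is smooth
at invertible maps. -/
theorem contDiffOn_chartVF_hamVF {f : M → ℝ} (hf : ContMDiff (𝓡 (2 * n)) 𝓘(ℝ) ∞ f) (x₀ : M) :
    ContDiffOn ℝ ∞ (chartVF (S.hamVF f) x₀) (extChartAt (𝓡 (2 * n)) x₀).target := by
  have h1 : ContDiffOn ℝ ∞ (fderiv ℝ (f ∘ (extChartAt (𝓡 (2 * n)) x₀).symm))
      (extChartAt (𝓡 (2 * n)) x₀).target :=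
    (hf.comp_extChartAt_symm x₀).fderiv_of_isOpen (isOpen_extChartAt_target x₀) (by simp)
  have h2 : ContDiffOn ℝ ∞ (fun y => (S.chartFlat x₀ y).inverse)
      (extChartAt (𝓡 (2 * n)) x₀).target := fun y hy =>
    (S.isInvertible_chartFlat hy).contDiffAt_map_inverse.comp_contDiffWithinAt y
      (S.contDiffOn_chartFlat x₀ y hy)
  refine (h2.clm_apply h1).congr fun y hy => ?_
  rw [← S.chartFlat_chartVF_hamVF hy (hf.mdifferentiable (by simp) _),
    (S.isInvertible_chartFlat hy).inverse_apply_self]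

theorem bracket_comp_extChartAt_symm {f g : M → ℝ}
    (hf : ContMDiff (𝓡 (2 * n)) 𝓘(ℝ) ∞ f) (hy : y ∈ (extChartAt (𝓡 (2 * n)) x₀).target) :
    (S.bracket f g ∘ (extChartAt (𝓡 (2 * n)) x₀).symm) y =
      fderiv ℝ (f ∘ (extChartAt (𝓡 (2 * n)) x₀).symm) y (chartVF (S.hamVF g) x₀ y) := by
  rw [Function.comp_apply, bracket, S.hamVF_spec,
    fderiv_comp_extChartAt_symm_chartVF hy (hf.mdifferentiable (by simp) _)]

theorem contMDiff_bracket {f g : M → ℝ} (hf : ContMDiff (𝓡 (2 * n)) 𝓘(ℝ) ∞ f)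
    (hg : ContMDiff (𝓡 (2 * n)) 𝓘(ℝ) ∞ g) : ContMDiff (𝓡 (2 * n)) 𝓘(ℝ) ∞ (S.bracket f g) := by
  refine contMDiff_of_forall_comp_extChartAt_symm fun x₀ => ?_
  have h1 : ContDiffOn ℝ ∞ (fderiv ℝ (f ∘ (extChartAt (𝓡 (2 * n)) x₀).symm))
      (extChartAt (𝓡 (2 * n)) x₀).target :=
    (hf.comp_extChartAt_symm x₀).fderiv_of_isOpen (isOpen_extChartAt_target x₀) (by simp)
  exact (h1.clm_apply (S.contDiffOn_chartVF_hamVF hg x₀)).congr fun y hy =>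
    S.bracket_comp_extChartAt_symm hf hy

/-- The differential of a function on the Lie bracket of two Hamiltonian vector fields. -/
theorem fderiv_lieBracket_chartVF {f g h : M → ℝ} (hf : ContMDiff (𝓡 (2 * n)) 𝓘(ℝ) ∞ f)
    (hg : ContMDiff (𝓡 (2 * n)) 𝓘(ℝ) ∞ g) (hh : ContMDiff (𝓡 (2 * n)) 𝓘(ℝ) ∞ h)
    (hy : y ∈ (extChartAt (𝓡 (2 * n)) x₀).target) :
    fderiv ℝ (h ∘ (extChartAt (𝓡 (2 * n)) x₀).symm) y
      (VectorField.lieBracket ℝ (chartVF (S.hamVF f) x₀) (chartVF (S.hamVF g) x₀) y) =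
    S.bracket (S.bracket h g) f ((extChartAt (𝓡 (2 * n)) x₀).symm y) -
      S.bracket (S.bracket h f) g ((extChartAt (𝓡 (2 * n)) x₀).symm y) := by
  have hT := (isOpen_extChartAt_target (I := 𝓡 (2 * n)) x₀).mem_nhds hy
  have hh' := (hh.comp_extChartAt_symm x₀).contDiffAt hT
  have hd : DifferentiableAt ℝ (fderiv ℝ (h ∘ (extChartAt (𝓡 (2 * n)) x₀).symm)) y :=
    (hh'.fderiv_right (m := ∞) (by simp)).differentiableAt (by simp)
  -- `{{h, b}, a}` is the derivative of `dh(X_b)` along `X_a`; its second-order part is symmetric in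
  -- `a` and `b` and drops out of the difference.
  have key : ∀ {a b : M → ℝ}, ContMDiff (𝓡 (2 * n)) 𝓘(ℝ) ∞ a → ContMDiff (𝓡 (2 * n)) 𝓘(ℝ) ∞ b →
      S.bracket (S.bracket h b) a ((extChartAt (𝓡 (2 * n)) x₀).symm y) =
        fderiv ℝ (h ∘ (extChartAt (𝓡 (2 * n)) x₀).symm) y
          (fderiv ℝ (chartVF (S.hamVF b) x₀) y (chartVF (S.hamVF a) x₀ y)) +
        fderiv ℝ (fderiv ℝ (h ∘ (extChartAt (𝓡 (2 * n)) x₀).symm)) y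
          (chartVF (S.hamVF a) x₀ y) (chartVF (S.hamVF b) x₀ y) := by
    intro a b ha hb
    have hb' : DifferentiableAt ℝ (chartVF (S.hamVF b) x₀) y :=
      ((S.contDiffOn_chartVF_hamVF hb x₀).contDiffAt hT).differentiableAt (by simp)
    have h1 := S.bracket_comp_extChartAt_symm (g := a) (S.contMDiff_bracket hh hb) hy
    have h2 : (S.bracket h b ∘ (extChartAt (𝓡 (2 * n)) x₀).symm) =ᶠ[𝓝 y]
        fun z => fderiv ℝ (h ∘ (extChartAt (𝓡 (2 * n)) x₀).symm) z (chartVF (S.hamVF b) x₀ z) :=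
      Filter.eventuallyEq_of_mem hT fun z hz => S.bracket_comp_extChartAt_symm hh hz
    rw [Function.comp_apply] at h1
    rw [h1, h2.fderiv_eq, fderiv_clm_apply hd hb']
    simp
  rw [key hf hg, key hg hf, VectorField.lieBracket, map_sub,
    (hh'.isSymmSndFDerivAt (by simpa using WithTop.coe_le_coe.2 (le_top : (2 : ℕ∞) ≤ ⊤))).eq (chartVF (S.hamVF f) x₀ y)]
  ring

theorem chartRep_toForm_lieBracket {f g h : M → ℝ} (hf : ContMDiff (𝓡 (2 * n)) 𝓘(ℝ) ∞ f)
    (hg : ContMDiff (𝓡 (2 * n)) 𝓘(ℝ) ∞ g) (hh : ContMDiff (𝓡 (2 * n)) 𝓘(ℝ) ∞ h)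
    (hy : y ∈ (extChartAt (𝓡 (2 * n)) x₀).target) :
    S.toForm.chartRep x₀ y ![VectorField.lieBracket ℝ (chartVF (S.hamVF f) x₀)
      (chartVF (S.hamVF g) x₀) y, chartVF (S.hamVF h) x₀ y] =
    S.bracket (S.bracket h f) g ((extChartAt (𝓡 (2 * n)) x₀).symm y) -
    S.bracket (S.bracket h g) f ((extChartAt (𝓡 (2 * n)) x₀).symm y) := by
  rw [← neg_sub, ← S.fderiv_lieBracket_chartVF hf hg hh hy,
    ← S.chartFlat_chartVF_hamVF hy (hh.mdifferentiable (by simp) _), chartFlat_apply]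
  exact alternatingMap_two_apply_swap (S.toForm.chartRep x₀ y).toAlternatingMap _ _

/-- This is `dω(X_f, X_g, X_h) = 0`: the derivative terms of the invariant formula add up to the
cyclic sum, and the Lie bracket terms to minus twice that sum. -/
theorem bracket_add_bracket_add_bracket {f g h : M → ℝ} (hf : ContMDiff (𝓡 (2 * n)) 𝓘(ℝ) ∞ f)
    (hg : ContMDiff (𝓡 (2 * n)) 𝓘(ℝ) ∞ g) (hh : ContMDiff (𝓡 (2 * n)) 𝓘(ℝ) ∞ h) (x : M) :
    S.bracket (S.bracket g h) f x + S.bracket (S.bracket h f) g x +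
      S.bracket (S.bracket f g) h x = 0 := by
  have hy := mem_extChartAt_target (I := 𝓡 (2 * n)) x
  have hT := (isOpen_extChartAt_target (I := 𝓡 (2 * n)) x).mem_nhds hy
  have hω : DifferentiableAt ℝ (S.toForm.chartRep x) (extChartAt (𝓡 (2 * n)) x x) :=
    ((S.smooth x).contDiffAt hT).differentiableAt (by simp)
  have hV {a : M → ℝ} (ha : ContMDiff (𝓡 (2 * n)) 𝓘(ℝ) ∞ a) :
      DifferentiableAt ℝ (chartVF (S.hamVF a) x) (extChartAt (𝓡 (2 * n)) x x) :=
    ((S.contDiffOn_chartVF_hamVF ha x).contDiffAt hT).differentiableAt (by simp)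
  have hd {a b c : M → ℝ} (ha : ContMDiff (𝓡 (2 * n)) 𝓘(ℝ) ∞ a)
      (hb : ContMDiff (𝓡 (2 * n)) 𝓘(ℝ) ∞ b) :
      fderiv ℝ (fun z => S.toForm.chartRep x z ![chartVF (S.hamVF a) x z, chartVF (S.hamVF b) x z])
        (extChartAt (𝓡 (2 * n)) x x) (chartVF (S.hamVF c) x (extChartAt (𝓡 (2 * n)) x x)) =
      S.bracket (S.bracket a b) c x := by
    have h1 : (fun z => S.toForm.chartRep x z
        ![chartVF (S.hamVF a) x z, chartVF (S.hamVF b) x z]) =ᶠ[𝓝 (extChartAt (𝓡 (2 * n)) x x)]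
        S.bracket a b ∘ (extChartAt (𝓡 (2 * n)) x).symm :=
      Filter.eventuallyEq_of_mem hT fun z hz => by
        rw [chartRep_toForm_apply, chartFrame_chartVF _ hz, chartFrame_chartVF _ hz]
        rfl
    rw [h1.fderiv_eq, ← S.bracket_comp_extChartAt_symm (S.contMDiff_bracket ha hb) hy,
      Function.comp_apply, extChartAt_to_inv]
  have h0 := S.toForm.extD_apply x ![S.hamVF f, S.hamVF g, S.hamVF h]
  have e : (fun i => chartVF ((![S.hamVF f, S.hamVF g, S.hamVF h] : Fin 3 →
      (x : M) → TangentSpace (𝓡 (2 * n)) x) i) x (extChartAt (𝓡 (2 * n)) x x)) =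
      ![chartVF (S.hamVF f) x (extChartAt (𝓡 (2 * n)) x x),
        chartVF (S.hamVF g) x (extChartAt (𝓡 (2 * n)) x x),
        chartVF (S.hamVF h) x (extChartAt (𝓡 (2 * n)) x x)] := by
    funext i; fin_cases i <;> rfl
  rw [S.closed x, e, extDeriv_two_form_apply hω (hV hf) (hV hg) (hV hh), hd hg hh, hd hf hh,
    hd hf hg, S.chartRep_toForm_lieBracket hf hg hh hy, S.chartRep_toForm_lieBracket hf hh hg hy,
    S.chartRep_toForm_lieBracket hg hh hf hy, extChartAt_to_inv] at h0
  rw [S.bracket_bracket_swap h f g] at h0 ⊢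
  rw [S.bracket_bracket_swap h g f, S.bracket_bracket_swap g f h] at h0
  have h1 : (0 : TangentSpace (𝓡 (2 * n)) x [⋀^Fin 3]→L[ℝ] ℝ) (fun i => (![S.hamVF f, S.hamVF g,
      S.hamVF h] : Fin 3 → (x : M) → TangentSpace (𝓡 (2 * n)) x) i x) = 0 := rfl
  rw [h1] at h0
  linarith

end SymplecticForm

end ChartHamiltonian

/-! ### The chain rule for a function of several functions -/

section ChainRule

variable {d : ℕ} {M : Type*} [TopologicalSpace M] [ChartedSpace (EuclideanSpace ℝ (Fin d)) M]
  [IsManifold (𝓡 d) ∞ M]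

theorem mvfderiv_comp_pi {ι : Type*} [Fintype ι] [DecidableEq ι] {G : ι → M → ℝ}
    (hG : ∀ k, ContMDiff (𝓡 d) 𝓘(ℝ) ∞ (G k)) {F : (ι → ℝ) → ℝ} {x : M}
    (hF : DifferentiableAt ℝ F (fun k => G k x)) (hFG : ContMDiff (𝓡 d) 𝓘(ℝ) ∞
      (fun x => F (fun k => G k x))) (v : TangentSpace (𝓡 d) x) :
    mvfderiv (𝓡 d) (fun x => F (fun k => G k x)) x v =
      ∑ k, fderiv ℝ F (fun k => G k x) (Pi.single k 1) * mvfderiv (𝓡 d) (G k) x v := by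
  have hy := mem_extChartAt_target (I := 𝓡 d) x
  have hT := (isOpen_extChartAt_target (I := 𝓡 d) x).mem_nhds hy
  obtain ⟨w, hw⟩ : ∃ w, chartFrame x (extChartAt (𝓡 d) x x) w =
      (show TangentSpace (𝓡 d) ((extChartAt (𝓡 d) x).symm (extChartAt (𝓡 d) x x)) from v) :=
    ⟨_, (isInvertible_chartFrame hy).self_apply_inverse _⟩
  have key {h : M → ℝ} (hh : ContMDiff (𝓡 d) 𝓘(ℝ) ∞ h) : mvfderiv (𝓡 d) h x v =
      fderiv ℝ (h ∘ (extChartAt (𝓡 d) x).symm) (extChartAt (𝓡 d) x x) w := by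
    rw [fderiv_comp_extChartAt_symm hy (hh.mdifferentiable (by simp) _), hw]
    have e : ∀ z, z = x → ∀ u : EuclideanSpace ℝ (Fin d),
        mvfderiv (𝓡 d) h x u = mvfderiv (𝓡 d) h z u := by
      rintro _ rfl _
      rfl
    exact e _ (extChartAt_to_inv x) v
  have hd : HasFDerivAt (fun z k => G k ((extChartAt (𝓡 d) x).symm z))
      (ContinuousLinearMap.pi fun k => fderiv ℝ (G k ∘ (extChartAt (𝓡 d) x).symm)
        (extChartAt (𝓡 d) x x)) (extChartAt (𝓡 d) x x) :=
    hasFDerivAt_pi.2 fun k =>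
      ((((hG k).comp_extChartAt_symm x).contDiffAt hT).differentiableAt (by simp)).hasFDerivAt
  have hF' : HasFDerivAt F (fderiv ℝ F (fun k => G k x))
      (fun k => G k ((extChartAt (𝓡 d) x).symm (extChartAt (𝓡 d) x x))) := by
    simpa only [extChartAt_to_inv] using hF.hasFDerivAt
  have h1 := (hF'.comp (extChartAt (𝓡 d) x x) hd).fderiv
  rw [key hFG]
  refine (DFunLike.congr_fun h1 w).trans ?_
  rw [ContinuousLinearMap.comp_apply]
  set L := fderiv ℝ F (fun k => G k x)
  have h2 (u : ι → ℝ) : L u = ∑ k, L (Pi.single k 1) * u k := by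
    conv_lhs => rw [pi_eq_sum_univ' u]
    rw [map_sum]
    refine Finset.sum_congr rfl fun k _ => ?_
    rw [map_smul, smul_eq_mul, mul_comm]
  rw [h2]
  refine Finset.sum_congr rfl fun k _ => ?_
  rw [key (hG k)]
  rfl

end ChainRule

/-! ### Involutivity from the Poisson structure -/

section Involutive

theorem SymplecticForm.hamVF_eq_sum {n : ℕ} {M : Type*} [TopologicalSpace M]
    [ChartedSpace (EuclideanSpace ℝ (Fin (2 * n))) M] (S : SymplecticForm n M)
    {ι : Type*} (s : Finset ι) {G : ι → M → ℝ} {h : M → ℝ} {c : ι → ℝ} {x : M}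
    (hh : ∀ v, mvfderiv (𝓡 (2 * n)) h x v = ∑ k ∈ s, c k * mvfderiv (𝓡 (2 * n)) (G k) x v) :
    S.hamVF h x = ∑ k ∈ s, c k • S.hamVF (G k) x := by
  refine (S.flat_bijective x).1 ?_
  ext w
  rw [map_sum, LinearMap.sum_apply, S.flat_apply, S.hamVF_spec, hh]
  refine Finset.sum_congr rfl fun k _ => ?_
  rw [map_smul, LinearMap.smul_apply, S.flat_apply, S.hamVF_spec, smul_eq_mul]

variable {m : ℕ} {M : Type*} [TopologicalSpace M]
  [ChartedSpace (EuclideanSpace ℝ (Fin (2 * (m + 1)))) M] (S : SymplecticForm (m + 1) M)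

/-- The spans of the Hamiltonian vector fields of `f_0, …, f_{r-1}` are involutive. -/
def IsInvolutiveFamily (f : Fin (2 * m + 1 + 1) → C^∞⟮𝓡 (2 * (m + 1)), M; 𝓘(ℝ), ℝ⟯) : Prop :=
  ∀ (r a b : Fin (2 * m + 1 + 1)), a < r → b < r → ∀ x, S.hamVF (S.bracket (f a) (f b)) x ∈
    Submodule.span ℝ ((fun l => S.hamVF (f l) x) '' Iio r)

variable {S} [IsManifold (𝓡 (2 * (m + 1))) ∞ M]

/-- By the chain rule the Hamiltonian field of `F(f_0, …, f_j)` is a combination of `X_{f_0}, …,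
X_{f_j}`, with the partial derivatives of `F` as coefficients. -/
theorem IsPoissonCInfStructure.isInvolutiveFamily {H : C^∞⟮𝓡 (2 * (m + 1)), M; 𝓘(ℝ), ℝ⟯}
    {𝓕 : Fin (2 * m) → C^∞⟮𝓡 (2 * (m + 1)), M; 𝓘(ℝ), ℝ⟯}
    (h𝓕 : IsPoissonCInfStructure S H 𝓕) (g : C^∞⟮𝓡 (2 * (m + 1)), M; 𝓘(ℝ), ℝ⟯) :
    IsInvolutiveFamily S (fullFamily H 𝓕 g) := by
  have hcast (j : Fin (2 * m + 1)) : fullFamily H 𝓕 g j.castSucc =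
      (Fin.cons H 𝓕 : Fin (2 * m + 1) → C^∞⟮𝓡 (2 * (m + 1)), M; 𝓘(ℝ), ℝ⟯) j :=
    Fin.snoc_castSucc ..
  have key (r : Fin (2 * m + 1 + 1)) (i j : Fin (2 * m + 1)) (hij : i < j) (hj : j.castSucc < r)
      (x : M) : S.hamVF (S.bracket (fullFamily H 𝓕 g j.castSucc) (fullFamily H 𝓕 g i.castSucc)) x ∈
        Submodule.span ℝ ((fun l => S.hamVF (fullFamily H 𝓕 g l) x) '' Iio r) := by
    obtain ⟨V, F, hV, hF, hVF⟩ := h𝓕.2 i j hij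
    have h1 : (S.bracket (fullFamily H 𝓕 g j.castSucc) (fullFamily H 𝓕 g i.castSucc) : M → ℝ) =
        fun x => F (fun k : Fin (j + 1) => fullFamily H 𝓕 g (Fin.castLE j.isLt k).castSucc x) := by
      funext x
      simp only [hcast]
      exact (hVF x).2
    have h2 := S.contMDiff_bracket (fullFamily H 𝓕 g j.castSucc).contMDiff
      (fullFamily H 𝓕 g i.castSucc).contMDiff
    rw [h1] at h2 ⊢
    have hx := (hVF x).1
    simp only [← hcast] at hx
    rw [S.hamVF_eq_sum Finset.univ (mvfderiv_comp_pi
      (fun k : Fin (j + 1) => (fullFamily H 𝓕 g (Fin.castLE j.isLt k).castSucc).contMDiff)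
      ((hF.contDiffAt (hV.mem_nhds hx)).differentiableAt (by simp)) h2)]
    refine Submodule.sum_mem _ fun k _ => Submodule.smul_mem _ _ (Submodule.subset_span
      ⟨(Fin.castLE j.isLt k).castSucc, lt_of_le_of_lt ?_ hj, rfl⟩)
    have := k.isLt
    rw [Fin.le_def]
    simp only [Fin.val_castSucc, Fin.val_castLE]
    omega
  intro r a b ha hb x
  -- Being below `r`, neither index is the last one: brackets with `f_{2n-1}`, about which nothing
  -- is assumed, do not occur.
  obtain ⟨i, rfl⟩ := Fin.exists_castSucc_eq.2 (ne_of_lt (lt_of_lt_of_le ha (Fin.le_last r)))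
  obtain ⟨j, rfl⟩ := Fin.exists_castSucc_eq.2 (ne_of_lt (lt_of_lt_of_le hb (Fin.le_last r)))
  rcases lt_trichotomy i j with h | h | h
  · have h1 : (S.bracket (fullFamily H 𝓕 g i.castSucc) (fullFamily H 𝓕 g j.castSucc) : M → ℝ) =
        -S.bracket (fullFamily H 𝓕 g j.castSucc) (fullFamily H 𝓕 g i.castSucc) := by
      funext z
      exact S.bracket_swap _ _ z
    rw [S.hamVF_eq_sum {()} (G := fun _ => S.bracket (fullFamily H 𝓕 g j.castSucc)
      (fullFamily H 𝓕 g i.castSucc)) (c := fun _ => -1) (by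
        intro v
        rw [h1, mvfderiv_neg]
        simp), Finset.sum_singleton]
    exact Submodule.smul_mem _ _ (key r i j h hb x)
  · subst h
    rw [S.hamVF_eq_sum (∅ : Finset Unit) (G := fun _ => H) (c := fun _ => 0) (by
        intro v
        have h1 : (S.bracket (fullFamily H 𝓕 g i.castSucc) (fullFamily H 𝓕 g i.castSucc) : M → ℝ) =
            0 := by
          funext z
          exact self_eq_neg.1 (S.bracket_swap _ _ z)
        rw [h1, mvfderiv_zero]
        simp), Finset.sum_empty]
    exact Submodule.zero_mem _
  · exact key r j i h ha x

end Involutive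

/-! ### Wedge products of two 1-forms -/

section WedgeOne

theorem wedge_one_one_apply {V : Type*} [AddCommGroup V] [Module ℝ V] (a b : V [⋀^Fin 1]→ₗ[ℝ] ℝ)
    (v : Fin 2 → V) :
    wedge a b v = a ![v 0] * b ![v 1] - a ![v 1] * b ![v 0] := by
  have h1 (a : V [⋀^Fin 1]→ₗ[ℝ] ℝ) :
      (1 : ℝ) • MultilinearMap.alternatization (a : MultilinearMap ℝ (fun _ => V) ℝ) = a := by
    rw [AlternatingMap.coe_alternatization]
    simp
  have h2 (i j : Fin 2) : (fun k : Fin 1 => v (Equiv.swap i j (Fin.castAdd 1 k))) =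
      ![v (Equiv.swap i j 0)] := by
    funext k; fin_cases k; rfl
  have h3 (i j : Fin 2) : (fun k : Fin 1 => v (Equiv.swap i j (Fin.natAdd 1 k))) =
      ![v (Equiv.swap i j 1)] := by
    funext k; fin_cases k; rfl
  have h := wedge_smul_alternatization 1 1 (a : MultilinearMap ℝ (fun _ : Fin 1 => V) ℝ)
    (b : MultilinearMap ℝ (fun _ : Fin 1 => V) ℝ) v
  rw [h1 a, h1 b] at h
  refine h.trans ?_
  have huniv : (Finset.univ : Finset (Equiv.Perm (Fin (1 + 1)))) =
      {Equiv.swap 0 0, Equiv.swap 0 1} := by decide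
  rw [huniv, Finset.sum_pair (by decide), h2, h3, h2, h3]
  simp [sub_eq_add_neg]

end WedgeOne

/-! ### Smoothness of the Pfaffian forms; Lie brackets of Hamiltonian fields -/

section Smooth

variable {m : ℕ} {M : Type*} [TopologicalSpace M]
  [ChartedSpace (EuclideanSpace ℝ (Fin (2 * (m + 1)))) M] [IsManifold (𝓡 (2 * (m + 1))) ∞ M]
  (S : SymplecticForm (m + 1) M) {f : Fin (2 * m + 1 + 1) → C^∞⟮𝓡 (2 * (m + 1)), M; 𝓘(ℝ), ℝ⟯}

theorem contMDiff_pfaffian {d k : ℕ} {M : Type*} [TopologicalSpace M]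
    [ChartedSpace (EuclideanSpace ℝ (Fin d)) M] {A : M → Matrix (Fin (2 * k)) (Fin (2 * k)) ℝ}
    (hA : ∀ i j, ContMDiff (𝓡 d) 𝓘(ℝ) ∞ fun x => A x i j) :
    ContMDiff (𝓡 d) 𝓘(ℝ) ∞ fun x => pfaffian (A x) := by
  unfold pfaffian
  exact contMDiff_const.mul (contMDiff_finsetSum fun σ _ =>
    contMDiff_const.mul (contMDiff_finsetProd fun l _ => hA _ _))

theorem exists_pfaffianForm_eq (f : Fin (2 * m + 1 + 1) → C^∞⟮𝓡 (2 * (m + 1)), M; 𝓘(ℝ), ℝ⟯)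
    (i : Fin (2 * m + 1 + 1)) :
    ∃ P : Fin (2 * m + 1) → M → ℝ, (∀ l, ContMDiff (𝓡 (2 * (m + 1))) 𝓘(ℝ) ∞ (P l)) ∧
      pfaffianForm S f i = fun x => ∑ l, P l x •
        mvfderiv (𝓡 (2 * (m + 1))) (f (i.succAbove l)) x := by
  refine ⟨_, fun l => ?_, rfl⟩
  exact contMDiff_const.mul (contMDiff_pfaffian fun a b =>
    S.contMDiff_bracket (f _).contMDiff (f _).contMDiff)

theorem isSmooth_pfaffianForm (i : Fin (2 * m + 1 + 1)) : (pfaffianForm S f i).toDForm.IsSmooth := by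
  obtain ⟨P, hP, h⟩ := exists_pfaffianForm_eq S f i
  rw [h]
  exact OneForm.isSmooth_sum_smul _ hP fun l => OneForm.isSmooth_mvfderiv (f _).contMDiff

theorem contMDiff_pfaffianForm_hamVF (i : Fin (2 * m + 1 + 1)) {h : M → ℝ}
    (hh : ContMDiff (𝓡 (2 * (m + 1))) 𝓘(ℝ) ∞ h) :
    ContMDiff (𝓡 (2 * (m + 1))) 𝓘(ℝ) ∞ fun x => pfaffianForm S f i x (S.hamVF h x) := by
  obtain ⟨P, hP, hi⟩ := exists_pfaffianForm_eq S f i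
  have h1 : (fun x => pfaffianForm S f i x (S.hamVF h x)) =
      fun x => ∑ l, P l x * S.bracket (f (i.succAbove l)) h x := by
    funext x
    rw [hi]
    simp only [sum_apply, smul_apply, smul_eq_mul, S.bracket_eq]
  rw [h1]
  exact contMDiff_finsetSum fun l _ => (hP l).mul (S.contMDiff_bracket (f _).contMDiff hh)

variable {S}

omit [IsManifold (𝓡 (2 * (m + 1))) ∞ M] in
theorem eq_zero_of_forall_mvfderiv (S : SymplecticForm (m + 1) M) (hf : FunctionallyIndependent f) {x : M}
    {v : TangentSpace (𝓡 (2 * (m + 1))) x}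
    (hv : ∀ a, mvfderiv (𝓡 (2 * (m + 1))) (f a) x v = 0) : v = 0 := by
  refine S.nondegenerate x v fun w => ?_
  rw [← S.flat_apply, eq_sum_hamVF S hf x w, map_sum]
  refine Finset.sum_eq_zero fun a _ => ?_
  rw [map_smul, S.flat_apply, S.toForm_swap, S.hamVF_spec, hv, neg_zero, smul_zero]

-- Tested against the `df_a`, which separate vectors, both sides agree by the Jacobi identity. This
-- links `IsInvolutiveFamily` to involutivity in the usual sense.
variable (S) in
theorem lieBracket_chartVF_hamVF (hf : FunctionallyIndependent f) {g h : M → ℝ}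
    (hg : ContMDiff (𝓡 (2 * (m + 1))) 𝓘(ℝ) ∞ g) (hh : ContMDiff (𝓡 (2 * (m + 1))) 𝓘(ℝ) ∞ h)
    {x₀ : M} {y : EuclideanSpace ℝ (Fin (2 * (m + 1)))}
    (hy : y ∈ (extChartAt (𝓡 (2 * (m + 1))) x₀).target) :
    VectorField.lieBracket ℝ (chartVF (S.hamVF g) x₀) (chartVF (S.hamVF h) x₀) y =
      -chartVF (S.hamVF (S.bracket g h)) x₀ y := by
  obtain ⟨e, he⟩ := isInvertible_chartFrame hy
  rw [← sub_eq_zero]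
  refine e.map_eq_zero_iff.1 (eq_zero_of_forall_mvfderiv S hf fun a => ?_)
  have hd : MDifferentiableAt (𝓡 (2 * (m + 1))) 𝓘(ℝ) (f a)
      ((extChartAt (𝓡 (2 * (m + 1))) x₀).symm y) := (f a).contMDiff.mdifferentiable (by simp) _
  have he' (w) : e w = chartFrame x₀ y w := by rw [← he]; rfl
  rw [he', ← fderiv_comp_extChartAt_symm hy hd, map_sub, map_neg,
    S.fderiv_lieBracket_chartVF hg hh (f a).contMDiff hy,
    fderiv_comp_extChartAt_symm_chartVF hy hd, ← S.bracket_eq,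
    S.bracket_swap (f a) (S.bracket g h)]
  have := S.bracket_add_bracket_add_bracket hg hh (f a).contMDiff
    ((extChartAt (𝓡 (2 * (m + 1))) x₀).symm y)
  rw [S.bracket_bracket_swap h (f a)] at this
  linarith

/-- The exterior derivative of a 1-form on two Hamiltonian vector fields. -/
theorem extD_toDForm_hamVF (hf : FunctionallyIndependent f) {α : OneForm (2 * (m + 1)) M}
    (hα : α.toDForm.IsSmooth) {g h : M → ℝ}
    (hg : ContMDiff (𝓡 (2 * (m + 1))) 𝓘(ℝ) ∞ g) (hh : ContMDiff (𝓡 (2 * (m + 1))) 𝓘(ℝ) ∞ h)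
    (hαg : ContMDiff (𝓡 (2 * (m + 1))) 𝓘(ℝ) ∞ fun x => α x (S.hamVF g x))
    (hαh : ContMDiff (𝓡 (2 * (m + 1))) 𝓘(ℝ) ∞ fun x => α x (S.hamVF h x)) (x : M) :
    α.toDForm.extD x ![S.hamVF g x, S.hamVF h x] =
      mvfderiv (𝓡 (2 * (m + 1))) (fun x => α x (S.hamVF h x)) x (S.hamVF g x) -
      mvfderiv (𝓡 (2 * (m + 1))) (fun x => α x (S.hamVF g x)) x (S.hamVF h x) +
      α x (S.hamVF (S.bracket g h) x) := by
  have hy := mem_extChartAt_target (I := 𝓡 (2 * (m + 1))) x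
  have hT := (isOpen_extChartAt_target (I := 𝓡 (2 * (m + 1))) x).mem_nhds hy
  have hV {a : M → ℝ} (ha : ContMDiff (𝓡 (2 * (m + 1))) 𝓘(ℝ) ∞ a) :
      DifferentiableAt ℝ (chartVF (S.hamVF a) x) (extChartAt (𝓡 (2 * (m + 1))) x x) :=
    ((S.contDiffOn_chartVF_hamVF ha x).contDiffAt hT).differentiableAt (by simp)
  have hαd : DifferentiableAt ℝ (α.toDForm.chartRep x) (extChartAt (𝓡 (2 * (m + 1))) x x) :=
    ((hα x).contDiffAt hT).differentiableAt (by simp)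
  have hrep {z} (hz : z ∈ (extChartAt (𝓡 (2 * (m + 1))) x).target)
      (v : (x : M) → TangentSpace (𝓡 (2 * (m + 1))) x) :
      α.toDForm.chartRep x z ![chartVF v x z] =
        α ((extChartAt (𝓡 (2 * (m + 1))) x).symm z)
          (v ((extChartAt (𝓡 (2 * (m + 1))) x).symm z)) := by
    rw [← chartFrame_chartVF v hz]
    rfl
  have hd {a b : M → ℝ} (hαa : ContMDiff (𝓡 (2 * (m + 1))) 𝓘(ℝ) ∞ fun x => α x (S.hamVF a x)) :
      fderiv ℝ (fun z => α.toDForm.chartRep x z ![chartVF (S.hamVF a) x z])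
        (extChartAt (𝓡 (2 * (m + 1))) x x)
        (chartVF (S.hamVF b) x (extChartAt (𝓡 (2 * (m + 1))) x x)) =
      mvfderiv (𝓡 (2 * (m + 1))) (fun x => α x (S.hamVF a x)) x (S.hamVF b x) := by
    have h1 : (fun z => α.toDForm.chartRep x z ![chartVF (S.hamVF a) x z])
        =ᶠ[𝓝 (extChartAt (𝓡 (2 * (m + 1))) x x)]
        (fun x => α x (S.hamVF a x)) ∘ (extChartAt (𝓡 (2 * (m + 1))) x).symm :=
      Filter.eventuallyEq_of_mem hT fun z hz => hrep hz _
    rw [h1.fderiv_eq, fderiv_comp_extChartAt_symm_chartVF hy (hαa.mdifferentiable (by simp) _),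
      extChartAt_to_inv]
  have e₀ : (![S.hamVF g x, S.hamVF h x] : Fin 2 → TangentSpace (𝓡 (2 * (m + 1))) x) =
      fun i => (![S.hamVF g, S.hamVF h] : Fin 2 →
        (x : M) → TangentSpace (𝓡 (2 * (m + 1))) x) i x := by
    funext i; fin_cases i <;> rfl
  have e : (fun i => chartVF ((![S.hamVF g, S.hamVF h] : Fin 2 →
      (x : M) → TangentSpace (𝓡 (2 * (m + 1))) x) i) x (extChartAt (𝓡 (2 * (m + 1))) x x)) =
      ![chartVF (S.hamVF g) x (extChartAt (𝓡 (2 * (m + 1))) x x),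
        chartVF (S.hamVF h) x (extChartAt (𝓡 (2 * (m + 1))) x x)] := by
    funext i; fin_cases i <;> rfl
  rw [e₀, DForm.extD_apply, e, extDeriv_one_form_apply hαd (hV hg) (hV hh), hd hαh, hd hαg,
    lieBracket_chartVF_hamVF S hf hg hh hy, sub_eq_add_neg _ (α.toDForm.chartRep x _ _)]
  congr 1
  have e₂ : α.toDForm.chartRep x (extChartAt (𝓡 (2 * (m + 1))) x x)
      ![-chartVF (S.hamVF (S.bracket g h)) x (extChartAt (𝓡 (2 * (m + 1))) x x)] =
      -α.toDForm.chartRep x (extChartAt (𝓡 (2 * (m + 1))) x x)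
      ![chartVF (S.hamVF (S.bracket g h)) x (extChartAt (𝓡 (2 * (m + 1))) x x)] := by
    rw [OneForm.chartRep_toDForm]
    exact map_neg ((α _).comp (chartFrame x _)) _
  rw [e₂, neg_neg, hrep hy, extChartAt_to_inv]

end Smooth

/-! ### Expansion of 2-forms in a frame and the structure equations -/

section AlternatingTwo

theorem alternatingMap_two_sum_sum {V ι : Type*} [AddCommGroup V] [Module ℝ V] [Fintype ι]
    (A : V [⋀^Fin 2]→ₗ[ℝ] ℝ) (c d : ι → ℝ) (X : ι → V) :
    A ![∑ a, c a • X a, ∑ b, d b • X b] = ∑ a, ∑ b, c a * d b * A ![X a, X b] := by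
  have h₀ (a v w : V) : Function.update ![a, w] 0 v = ![v, w] := by
    funext i; fin_cases i <;> rfl
  have h₁ (a v w : V) : Function.update ![v, a] 1 w = ![v, w] := by
    funext i; fin_cases i <;> rfl
  let B : V →ₗ[ℝ] V →ₗ[ℝ] ℝ := LinearMap.mk₂ ℝ (fun v w => A ![v, w])
    (fun u v w => by simpa only [h₀] using A.map_update_add ![u, w] 0 u v)
    (fun c v w => by simpa only [h₀] using A.map_update_smul ![v, w] 0 c v)
    (fun u v w => by simpa only [h₁] using A.map_update_add ![u, v] 1 v w)
    (fun c v w => by simpa only [h₁] using A.map_update_smul ![v, w] 1 c w)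
  change B (∑ a, c a • X a) (∑ b, d b • X b) = ∑ a, ∑ b, c a * d b * B (X a) (X b)
  rw [map_sum B, LinearMap.sum_apply]
  simp only [map_sum, map_smul, LinearMap.smul_apply, smul_eq_mul]
  refine Finset.sum_congr rfl fun a _ => Finset.sum_congr rfl fun b _ => ?_
  ring

theorem alternatingMap_sum_apply {V ι κ : Type*} [AddCommGroup V] [Module ℝ V] (s : Finset κ)
    (A : κ → V [⋀^ι]→ₗ[ℝ] ℝ) (v : ι → V) : (∑ j ∈ s, A j) v = ∑ j ∈ s, A j v := by
  classical
  induction s using Finset.induction_on with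
  | empty => simp
  | insert j s hj ih => rw [Finset.sum_insert hj, Finset.sum_insert hj, AlternatingMap.add_apply, ih]

theorem Finset.sum_sum_eq_sum_sum_Iio {ι : Type*} [Fintype ι] [LinearOrder ι]
    [LocallyFiniteOrderBot ι] (g : ι → ι → ℝ) (hg : ∀ a, g a a = 0) :
    ∑ a, ∑ b, g a b = ∑ b, ∑ a ∈ Finset.Iio b, (g a b + g b a) := by
  have h1 : ∀ a b, g a b = (if a < b then g a b else 0) + (if b < a then g a b else 0) := by
    intro a b
    rcases lt_trichotomy a b with h | h | h
    · simp [h, h.not_gt]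
    · simp [h, hg]
    · simp [h, h.not_gt]
  have h2 : ∀ (b : ι) (k : ι → ℝ), ∑ a ∈ Finset.Iio b, k a = ∑ a, if a < b then k a else 0 := by
    intro b k
    rw [← Finset.sum_filter]
    congr 1
    ext a
    simp
  simp only [h2]
  calc ∑ a, ∑ b, g a b
      = ∑ a, ∑ b, ((if a < b then g a b else 0) + (if b < a then g a b else 0)) :=
        Finset.sum_congr rfl fun a _ => Finset.sum_congr rfl fun b _ => h1 a b
    _ = (∑ b, ∑ a, if a < b then g a b else 0) + ∑ a, ∑ b, if b < a then g a b else 0 := by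
        simp only [Finset.sum_add_distrib]
        rw [Finset.sum_comm]
    _ = _ := by
        rw [← Finset.sum_add_distrib]
        refine Finset.sum_congr rfl fun b _ => ?_
        rw [← Finset.sum_add_distrib]
        refine Finset.sum_congr rfl fun a _ => ?_
        split_ifs <;> simp

end AlternatingTwo

section StructureEquations

variable {m : ℕ} {M : Type*} [TopologicalSpace M]
  [ChartedSpace (EuclideanSpace ℝ (Fin (2 * (m + 1)))) M] [IsManifold (𝓡 (2 * (m + 1))) ∞ M]
  (S : SymplecticForm (m + 1) M) {f : Fin (2 * m + 1 + 1) → C^∞⟮𝓡 (2 * (m + 1)), M; 𝓘(ℝ), ℝ⟯}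

theorem extD_pfaffianForm_hamVF (hf : FunctionallyIndependent f) (i a b : Fin (2 * m + 1 + 1))
    (x : M) :
    (pfaffianForm S f i).toDForm.extD x ![S.hamVF (f a) x, S.hamVF (f b) x] =
      S.bracket (fun x => pfaffianForm S f i x (S.hamVF (f b) x)) (f a) x -
      S.bracket (fun x => pfaffianForm S f i x (S.hamVF (f a) x)) (f b) x +
      pfaffianForm S f i x (S.hamVF (S.bracket (f a) (f b)) x) := by
  rw [S.bracket_eq, S.bracket_eq]
  exact extD_toDForm_hamVF hf (isSmooth_pfaffianForm S i) (f a).contMDiff (f b).contMDiff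
    (contMDiff_pfaffianForm_hamVF S i (f a).contMDiff)
    (contMDiff_pfaffianForm_hamVF S i (f b).contMDiff) x

/-- `ω_i` vanishes identically on both fields, and also on `X_{{f_a, f_b}}`, which by involutivity
lies in the span of the `X_{f_l}` with `l < i`. -/
theorem extD_pfaffianForm_hamVF_eq_zero (hf : FunctionallyIndependent f)
    (hinv : IsInvolutiveFamily S f) {i a b : Fin (2 * m + 1 + 1)} (ha : a < i) (hb : b < i)
    (x : M) :
    (pfaffianForm S f i).toDForm.extD x ![S.hamVF (f a) x, S.hamVF (f b) x] = 0 := by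
  have h0 {c : Fin (2 * m + 1 + 1)} (hc : c < i) :
      (fun x => pfaffianForm S f i x (S.hamVF (f c) x)) = 0 :=
    funext fun x => pfaffianForm_hamVF_of_ne S f hc.ne x
  rw [extD_pfaffianForm_hamVF S hf, h0 ha, h0 hb, S.bracket_eq, S.bracket_eq, mvfderiv_zero,
    ((forall_pfaffianForm_eq_zero_iff S hf x _ i).2 (hinv i a b ha hb x)) i le_rfl]
  simp

/-- The differential of `ω_i` is congruent to zero modulo `ω_i, …, ω_{2n-1}`. -/
theorem exists_extD_pfaffianForm_eq (hf : FunctionallyIndependent f)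
    (hinv : IsInvolutiveFamily S f) (i : Fin (2 * m + 1)) :
    ∃ β : Fin (2 * m + 1) → OneForm (2 * (m + 1)) M, (∀ j, (β j).toDForm.IsSmooth) ∧
      ∀ x : M, ((pfaffianForm S f i.succ).toDForm.extD x).toAlternatingMap =
        ∑ j ∈ Finset.Ici i, wedge ((β j).toDForm x).toAlternatingMap
          ((pfaffianForm S f j.succ).toDForm x).toAlternatingMap := by
  let N : Fin (2 * m + 1 + 1) → M → ℝ := fun a x => pfaffianForm S f a x (S.hamVF (f a) x)
  have hN : ∀ a, ContMDiff (𝓡 (2 * (m + 1))) 𝓘(ℝ) ∞ (N a) := fun a =>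
    contMDiff_pfaffianForm_hamVF S a (f a).contMDiff
  have hN0 : ∀ a x, N a x ≠ 0 := fun a x => pfaffianForm_hamVF_self_ne_zero S hf a x
  let D : Fin (2 * m + 1 + 1) → Fin (2 * m + 1 + 1) → M → ℝ := fun a b x =>
    (pfaffianForm S f i.succ).toDForm.extD x ![S.hamVF (f a) x, S.hamVF (f b) x]
  have hD : ∀ a b, ContMDiff (𝓡 (2 * (m + 1))) 𝓘(ℝ) ∞ (D a b) := by
    intro a b
    simp only [D, extD_pfaffianForm_hamVF S hf]
    exact ((S.contMDiff_bracket (contMDiff_pfaffianForm_hamVF S _ (f b).contMDiff)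
      (f a).contMDiff).sub (S.contMDiff_bracket (contMDiff_pfaffianForm_hamVF S _
      (f a).contMDiff) (f b).contMDiff)).add (contMDiff_pfaffianForm_hamVF S _
        (S.contMDiff_bracket (f a).contMDiff (f b).contMDiff))
  -- With the dual coframe `η_a = ω_a / N_a`, the differential is `∑_{a < b} D_{ab} η_a ∧ η_b`, and
  -- the terms with `b = j.succ` are collected into one wedge product. The sum over `a` includes
  -- `ω_0`, which completes the coframe. Terms with `b < i.succ` vanish by involutivity.
  refine ⟨fun j x => ∑ a ∈ Finset.Iio j.succ, (D a j.succ x / N a x / N j.succ x) •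
    pfaffianForm S f a x, fun j => OneForm.isSmooth_sum_smul _ (fun a =>
      ((hD a _).div₀ (hN a) (hN0 a)).div₀ (hN _) (hN0 _)) (fun a => isSmooth_pfaffianForm S a), ?_⟩
  intro x
  ext v
  let η : Fin (2 * m + 1 + 1) → TangentSpace (𝓡 (2 * (m + 1))) x → ℝ := fun a w =>
    pfaffianForm S f a x w / N a x
  have hη : ∀ w, w = ∑ a, η a w • S.hamVF (f a) x := eq_sum_hamVF S hf x
  let A := ((pfaffianForm S f i.succ).toDForm.extD x).toAlternatingMap
  have hA : ∀ u w, A ![u, w] = ∑ a, ∑ b, η a u * η b w * D a b x := by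
    intro u w
    conv_lhs => rw [hη u, hη w]
    exact alternatingMap_two_sum_sum A _ _ _
  have hswap : ∀ a b, D a b x = -D b a x := fun a b => alternatingMap_two_apply_swap A _ _
  have hv : v = ![v 0, v 1] := by
    funext k; fin_cases k <;> rfl
  have h1 : A v = ∑ b, ∑ a ∈ Finset.Iio b,
      (η a (v 0) * η b (v 1) - η a (v 1) * η b (v 0)) * D a b x := by
    conv_lhs => rw [hv, hA]
    rw [Finset.sum_sum_eq_sum_sum_Iio]
    · refine Finset.sum_congr rfl fun b _ => Finset.sum_congr rfl fun a _ => ?_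
      rw [hswap b a]
      ring
    · intro a
      rw [self_eq_neg.1 (hswap a a), mul_zero]
  refine h1.trans ?_
  rw [alternatingMap_sum_apply, Fin.sum_univ_succ, ← Finset.sum_subset (Finset.subset_univ (Finset.Ici i))]
  · have h0 : Finset.Iio (0 : Fin (2 * m + 1 + 1)) = ∅ :=
      Finset.eq_empty_of_forall_notMem fun a ha => Fin.not_lt_zero a (Finset.mem_Iio.1 ha)
    rw [h0, Finset.sum_empty, zero_add]
    refine Finset.sum_congr rfl fun j _ => ?_
    rw [wedge_one_one_apply]
    change _ = (∑ a ∈ Finset.Iio j.succ, (D a j.succ x / N a x / N j.succ x) •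
      pfaffianForm S f a x) (v 0) * pfaffianForm S f j.succ x (v 1) -
      (∑ a ∈ Finset.Iio j.succ, (D a j.succ x / N a x / N j.succ x) •
      pfaffianForm S f a x) (v 1) * pfaffianForm S f j.succ x (v 0)
    simp only [sum_apply, smul_apply, smul_eq_mul]
    rw [Finset.sum_mul, Finset.sum_mul, ← Finset.sum_sub_distrib]
    refine Finset.sum_congr rfl fun a _ => ?_
    simp only [η]
    ring
  · intro j _ hj
    refine Finset.sum_eq_zero fun a ha => ?_
    have hj' : j.succ < i.succ := Fin.succ_lt_succ_iff.2 (by simpa using hj)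
    have : D a j.succ x = 0 := extD_pfaffianForm_hamVF_eq_zero S hf hinv
      ((Finset.mem_Iio.1 ha).trans hj') hj' x
    rw [this, mul_zero]

end StructureEquations

/-! ### First integrals of the involutive spans -/

section FirstIntegrals

variable {m : ℕ} {M : Type*} [TopologicalSpace M]
  [ChartedSpace (EuclideanSpace ℝ (Fin (2 * (m + 1)))) M] [IsManifold (𝓡 (2 * (m + 1))) ∞ M]
  (S : SymplecticForm (m + 1) M) {f : Fin (2 * m + 1 + 1) → C^∞⟮𝓡 (2 * (m + 1)), M; 𝓘(ℝ), ℝ⟯}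

/-- The frame of Hamiltonian vector fields in a chart, as a field of linear maps. -/
def hamiltonianFrame (f : Fin (2 * m + 1 + 1) → C^∞⟮𝓡 (2 * (m + 1)), M; 𝓘(ℝ), ℝ⟯) (x₀ : M)
    (y : EuclideanSpace ℝ (Fin (2 * (m + 1)))) :
    (Fin (2 * m + 1 + 1) → ℝ) →L[ℝ] EuclideanSpace ℝ (Fin (2 * (m + 1))) :=
  ∑ a, (ContinuousLinearMap.proj a : (Fin (2 * m + 1 + 1) → ℝ) →L[ℝ] ℝ).smulRight
    (chartVF (S.hamVF (f a)) x₀ y)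

omit [IsManifold (𝓡 (2 * (m + 1))) ∞ M] in
theorem hamiltonianFrame_apply (x₀ : M) (y : EuclideanSpace ℝ (Fin (2 * (m + 1))))
    (t : Fin (2 * m + 1 + 1) → ℝ) :
    hamiltonianFrame S f x₀ y t = ∑ a, t a • chartVF (S.hamVF (f a)) x₀ y := by
  rw [hamiltonianFrame, sum_apply]
  rfl

omit [IsManifold (𝓡 (2 * (m + 1))) ∞ M] in
theorem hamiltonianFrame_single (x₀ : M) (y : EuclideanSpace ℝ (Fin (2 * (m + 1))))
    (a : Fin (2 * m + 1 + 1)) :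
    hamiltonianFrame S f x₀ y (Pi.single a 1) = chartVF (S.hamVF (f a)) x₀ y := by
  rw [hamiltonianFrame_apply, Finset.sum_eq_single a]
  · rw [Pi.single_eq_same, one_smul]
  · intro b _ hb
    rw [Pi.single_eq_of_ne hb, zero_smul]
  · simp

theorem contDiffOn_hamiltonianFrame (x₀ : M) :
    ContDiffOn ℝ ∞ (hamiltonianFrame S f x₀) (extChartAt (𝓡 (2 * (m + 1))) x₀).target := by
  refine contDiffOn_clm_apply.2 fun t => ?_
  simp only [hamiltonianFrame_apply]
  exact ContDiffOn.sum fun a _ =>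
    contDiffOn_const.fun_smul (S.contDiffOn_chartVF_hamVF (f a).contMDiff x₀)

theorem exists_equiv_hamiltonianFrame (hf : FunctionallyIndependent f) {x₀ : M}
    {y : EuclideanSpace ℝ (Fin (2 * (m + 1)))}
    (hy : y ∈ (extChartAt (𝓡 (2 * (m + 1))) x₀).target) :
    ∃ A : (Fin (2 * m + 1 + 1) → ℝ) ≃L[ℝ] EuclideanSpace ℝ (Fin (2 * (m + 1))),
      hamiltonianFrame S f x₀ y = A := by
  have hinj : Function.Injective (hamiltonianFrame S f x₀ y) := by
    rw [injective_iff_map_eq_zero]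
    intro t ht
    rw [hamiltonianFrame_apply] at ht
    have h1 := congrArg (chartFrame x₀ y) ht
    rw [map_sum, map_zero] at h1
    simp only [map_smul, chartFrame_chartVF _ hy] at h1
    funext a
    exact Fintype.linearIndependent_iff.1 (linearIndependent_hamVF S hf _) t h1 a
  refine ⟨(LinearMap.linearEquivOfInjective (hamiltonianFrame S f x₀ y).toLinearMap hinj
    ?_).toContinuousLinearEquiv, ?_⟩
  · rw [Module.finrank_fin_fun, finrank_euclideanSpace_fin]
    rfl
  · ext t
    rfl

/-- For constant coefficients the commutator is `∑ s_a t_b [X_a, X_b]`, so involutivity of the spans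
gives the hypothesis of the Frobenius theorem. -/
theorem hamiltonianFrame_involutive (hf : FunctionallyIndependent f)
    (hinv : IsInvolutiveFamily S f) {x₀ : M} {y : EuclideanSpace ℝ (Fin (2 * (m + 1)))}
    (hy : y ∈ (extChartAt (𝓡 (2 * (m + 1))) x₀).target) (r : Fin (2 * m + 1 + 1))
    {s t : Fin (2 * m + 1 + 1) → ℝ} (hs : ∀ a, r ≤ a → s a = 0) (ht : ∀ a, r ≤ a → t a = 0) :
    ∃ q : Fin (2 * m + 1 + 1) → ℝ, (∀ a, r ≤ a → q a = 0) ∧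
      fderiv ℝ (hamiltonianFrame S f x₀) y (hamiltonianFrame S f x₀ y s) t -
      fderiv ℝ (hamiltonianFrame S f x₀) y (hamiltonianFrame S f x₀ y t) s =
      hamiltonianFrame S f x₀ y q := by
  have hT := (isOpen_extChartAt_target (I := 𝓡 (2 * (m + 1))) x₀).mem_nhds hy
  let D : Submodule ℝ (EuclideanSpace ℝ (Fin (2 * (m + 1)))) :=
    Submodule.span ℝ ((fun a => chartVF (S.hamVF (f a)) x₀ y) '' Iio r)
  have hbr : ∀ a b, a < r → b < r → VectorField.lieBracket ℝ (chartVF (S.hamVF (f a)) x₀)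
      (chartVF (S.hamVF (f b)) x₀) y ∈ D := by
    intro a b ha hb
    rw [lieBracket_chartVF_hamVF S hf (f a).contMDiff (f b).contMDiff hy]
    refine D.neg_mem ?_
    have h1 := hinv r a b ha hb ((extChartAt (𝓡 (2 * (m + 1))) x₀).symm y)
    have h2 := Submodule.mem_map_of_mem (f := (chartFrame x₀ y).inverse.toLinearMap) h1
    rw [Submodule.map_span, ← image_comp] at h2
    exact h2
  have hsum (t : Fin (2 * m + 1 + 1) → ℝ) (v : EuclideanSpace ℝ (Fin (2 * (m + 1)))) :
      fderiv ℝ (hamiltonianFrame S f x₀) y v t =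
        ∑ a, t a • fderiv ℝ (chartVF (S.hamVF (f a)) x₀) y v := by
    have hd : DifferentiableAt ℝ (hamiltonianFrame S f x₀) y :=
      ((contDiffOn_hamiltonianFrame S x₀).contDiffAt hT).differentiableAt (by simp)
    have h1 : fderiv ℝ (fun z => hamiltonianFrame S f x₀ z t) y v =
        fderiv ℝ (hamiltonianFrame S f x₀) y v t := by
      rw [fderiv_clm_apply hd (differentiableAt_const t)]
      simp
    rw [← h1]
    simp only [hamiltonianFrame_apply]
    have hda : ∀ a, DifferentiableAt ℝ (chartVF (S.hamVF (f a)) x₀) y := fun a =>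
      ((S.contDiffOn_chartVF_hamVF (f a).contMDiff x₀).contDiffAt hT).differentiableAt (by simp)
    rw [fderiv_fun_sum fun a _ => (hda a).fun_const_smul (t a), sum_apply]
    refine Finset.sum_congr rfl fun a _ => ?_
    rw [fderiv_fun_const_smul (hda a), smul_apply]
  have hmem : fderiv ℝ (hamiltonianFrame S f x₀) y (hamiltonianFrame S f x₀ y s) t -
      fderiv ℝ (hamiltonianFrame S f x₀) y (hamiltonianFrame S f x₀ y t) s ∈ D := by
    have h1 : fderiv ℝ (hamiltonianFrame S f x₀) y (hamiltonianFrame S f x₀ y s) t -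
        fderiv ℝ (hamiltonianFrame S f x₀) y (hamiltonianFrame S f x₀ y t) s =
        ∑ a, ∑ b, (s a * t b) • VectorField.lieBracket ℝ (chartVF (S.hamVF (f a)) x₀)
          (chartVF (S.hamVF (f b)) x₀) y := by
      rw [hsum, hsum, hamiltonianFrame_apply, hamiltonianFrame_apply]
      simp only [map_sum, map_smul, VectorField.lieBracket, smul_sub, Finset.sum_sub_distrib,
        Finset.smul_sum, smul_smul]
      congr 1
      rw [Finset.sum_comm]
      refine Finset.sum_congr rfl fun a _ => Finset.sum_congr rfl fun b _ => ?_
      rw [mul_comm (t b)]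
    rw [h1]
    refine D.sum_mem fun a _ => D.sum_mem fun b _ => ?_
    by_cases ha : a < r
    · by_cases hb : b < r
      · exact D.smul_mem _ (hbr a b ha hb)
      · rw [ht b (not_lt.1 hb), mul_zero, zero_smul]
        exact D.zero_mem
    · rw [hs a (not_lt.1 ha), zero_mul, zero_smul]
      exact D.zero_mem
  generalize fderiv ℝ (hamiltonianFrame S f x₀) y (hamiltonianFrame S f x₀ y s) t -
      fderiv ℝ (hamiltonianFrame S f x₀) y (hamiltonianFrame S f x₀ y t) s = w at hmem
  induction hmem using Submodule.span_induction with
  | mem w hw =>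
    obtain ⟨a, ha, rfl⟩ := hw
    exact ⟨Pi.single a 1, fun b hb => Pi.single_eq_of_ne (lt_of_lt_of_le ha hb).ne' _,
      (hamiltonianFrame_single S x₀ y a).symm⟩
  | zero => exact ⟨0, fun _ _ => rfl, (map_zero _).symm⟩
  | add u w _ _ hu hw =>
    obtain ⟨q, hq, rfl⟩ := hu
    obtain ⟨q', hq', rfl⟩ := hw
    exact ⟨q + q', fun a ha => by rw [Pi.add_apply, hq a ha, hq' a ha, add_zero],
      (map_add _ _ _).symm⟩
  | smul c w _ hw =>
    obtain ⟨q, hq, rfl⟩ := hw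
    exact ⟨c • q, fun a ha => by rw [Pi.smul_apply, hq a ha, smul_zero], (map_smul _ _ _).symm⟩

/-- The involutive span of `X_{f_0}, …, X_{f_{r-1}}` has, near every point, a first integral that
is not stationary in the direction of `X_{f_r}`. -/
theorem exists_first_integral (hf : FunctionallyIndependent f) (hinv : IsInvolutiveFamily S f)
    (p : M) (r : Fin (2 * m + 1 + 1)) :
    ∃ (V : Set M) (J : M → ℝ), IsOpen V ∧ p ∈ V ∧ ContMDiffOn (𝓡 (2 * (m + 1))) 𝓘(ℝ) ∞ J V ∧
      ∀ x ∈ V, (∀ a < r, mvfderiv (𝓡 (2 * (m + 1))) J x (S.hamVF (f a) x) = 0) ∧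
        mvfderiv (𝓡 (2 * (m + 1))) J x (S.hamVF (f r) x) ≠ 0 := by
  have hp := mem_extChartAt_target (I := 𝓡 (2 * (m + 1))) p
  have hTo := isOpen_extChartAt_target (I := 𝓡 (2 * (m + 1))) p
  obtain ⟨A, hA⟩ := exists_equiv_hamiltonianFrame S hf hp
  -- The projection onto the coordinates below `r`: the image of its range is the span of the first
  -- `r` fields, and the `r`-th adapted coordinate is stationary along it.
  let π : (Fin (2 * m + 1 + 1) → ℝ) →L[ℝ] Fin (2 * m + 1 + 1) → ℝ :=
    ContinuousLinearMap.pi fun a => if a < r then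
      (ContinuousLinearMap.proj a : (Fin (2 * m + 1 + 1) → ℝ) →L[ℝ] ℝ) else 0
  have hπ : ∀ t a, π t a = if a < r then t a else 0 := by
    intro t a
    change (if a < r then (ContinuousLinearMap.proj a : (Fin (2 * m + 1 + 1) → ℝ) →L[ℝ] ℝ) else 0) t = _
    split_ifs <;> rfl
  have hπ_of : ∀ t, (∀ a, r ≤ a → t a = 0) → π t = t := by
    intro t ht
    funext a
    rw [hπ]
    split_ifs with h
    · rfl
    · exact (ht a (not_lt.1 h)).symm
  have hπ0 : ∀ t a, r ≤ a → π t a = 0 := fun t a ha => by rw [hπ, if_neg ha.not_gt]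
  obtain ⟨V, T, hVo, hpV, hVT, hT, hTp, hTz⟩ := exists_adapted_coordinates hTo
    (contDiffOn_hamiltonianFrame S (f := f) p) hp A hA π (fun t => hπ_of _ (hπ0 t))
    (fun z hz s t => by
      obtain ⟨q, hq, h⟩ := hamiltonianFrame_involutive S hf hinv hz r (hπ0 s) (hπ0 t)
      exact ⟨q, by rw [h, hπ_of q hq]⟩)
  have hV : ∀ z ∈ V, DifferentiableAt ℝ T z := fun z hz =>
    (hT.contDiffAt (hVo.mem_nhds hz)).differentiableAt (by simp)
  have hTr : ContDiffOn ℝ ∞ (fun z => T z r) V := contDiffOn_pi.1 hT r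
  have hd : ∀ z ∈ V, ∀ v, fderiv ℝ (fun z => T z r) z v = fderiv ℝ T z v r := fun z hz v => by
    rw [(hasFDerivAt_pi'.1 (hV z hz).hasFDerivAt r).fderiv]
    rfl
  have hcont : ContinuousOn (fun z => fderiv ℝ (fun z => T z r) z
      (chartVF (S.hamVF (f r)) p z)) V :=
    (hTr.continuousOn_fderiv_of_isOpen hVo (by simp)).clm_apply
      ((S.contDiffOn_chartVF_hamVF (f r).contMDiff p).continuousOn.mono hVT)
  -- At `p` the differential of `T` inverts the frame, so that of its `r`-th component takes the
  -- value `1` on `X_{f_r}`; it stays nonzero on `W`.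
  let W := V ∩ (fun z => fderiv ℝ (fun z => T z r) z (chartVF (S.hamVF (f r)) p z)) ⁻¹' {0}ᶜ
  have hWo : IsOpen W := hcont.isOpen_inter_preimage hVo isOpen_compl_singleton
  have hpW : extChartAt (𝓡 (2 * (m + 1))) p p ∈ W := by
    refine ⟨hpV, ?_⟩
    rw [mem_preimage, hd _ hpV, ← hamiltonianFrame_single, hTp, hA]
    erw [A.symm_apply_apply]
    simp
  have hJ : ∀ z ∈ (extChartAt (𝓡 (2 * (m + 1))) p).target,
      ((fun z => T z r) ∘ extChartAt (𝓡 (2 * (m + 1))) p)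
        ((extChartAt (𝓡 (2 * (m + 1))) p).symm z) = T z r := fun z hz => by
    rw [Function.comp_apply, (extChartAt (𝓡 (2 * (m + 1))) p).right_inv hz]
  let V' := (extChartAt (𝓡 (2 * (m + 1))) p).source ∩ extChartAt (𝓡 (2 * (m + 1))) p ⁻¹' W
  have hV'o : IsOpen V' :=
    (continuousOn_extChartAt p).isOpen_inter_preimage (isOpen_extChartAt_source p) hWo
  have hJs : ContMDiffOn (𝓡 (2 * (m + 1))) 𝓘(ℝ) ∞
      ((fun z => T z r) ∘ extChartAt (𝓡 (2 * (m + 1))) p) V' := by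
    refine (hTr.mono inter_subset_left).contMDiffOn.comp (t := W) ?_ fun x hx => hx.2
    refine (contMDiffOn_extChartAt (I := 𝓡 (2 * (m + 1))) (x := p)).mono fun x hx => ?_
    have := hx.1
    rwa [extChartAt_source] at this
  refine ⟨V', _, hV'o, ⟨mem_extChartAt_source p, hpW⟩, hJs, ?_⟩
  intro x hx
  have hJd : MDifferentiableAt (𝓡 (2 * (m + 1))) 𝓘(ℝ)
      ((fun z => T z r) ∘ extChartAt (𝓡 (2 * (m + 1))) p) x :=
    (hJs.contMDiffAt (hV'o.mem_nhds hx)).mdifferentiableAt (by simp)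
  obtain ⟨z, hz, rfl⟩ : ∃ z ∈ W, (extChartAt (𝓡 (2 * (m + 1))) p).symm z = x :=
    ⟨_, hx.2, (extChartAt (𝓡 (2 * (m + 1))) p).left_inv hx.1⟩
  have key : ∀ a, mvfderiv (𝓡 (2 * (m + 1))) ((fun z => T z r) ∘ extChartAt (𝓡 (2 * (m + 1))) p)
      ((extChartAt (𝓡 (2 * (m + 1))) p).symm z)
      (S.hamVF (f a) ((extChartAt (𝓡 (2 * (m + 1))) p).symm z)) =
      fderiv ℝ (fun z => T z r) z (chartVF (S.hamVF (f a)) p z) := by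
    intro a
    rw [← fderiv_comp_extChartAt_symm_chartVF (hVT hz.1) hJd]
    congr 1
    exact (Filter.eventuallyEq_of_mem (hTo.mem_nhds (hVT hz.1)) hJ).fderiv_eq
  refine ⟨fun a ha => ?_, ?_⟩
  · rw [key, hd _ hz.1, ← hamiltonianFrame_single]
    obtain ⟨q, hq⟩ := hTz z hz.1 (Pi.single a 1)
    rw [hπ_of _ fun b hb => Pi.single_eq_of_ne (lt_of_lt_of_le ha hb).ne' _] at hq
    rw [hq, hπ0 _ _ le_rfl]
  · rw [key]
    exact hz.2

end FirstIntegrals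

/-! ### Kernels of successively proportional forms -/

section SuccessiveKernels

/-- If each `α j` is proportional to `θ j` on the common zeros of the later `α l`, then the common
zeros of the last members of both families agree. -/
theorem forall_eq_zero_iff_of_proportional {N : ℕ} {V : Type*} {α θ : Fin N → V → ℝ}
    (hθ : ∀ j, ∃ v, (∀ l, j < l → θ l v = 0) ∧ θ j v ≠ 0) (n : ℕ)
    (hα : ∀ j : Fin N, n ≤ j → (∃ v, (∀ l, j < l → α l v = 0) ∧ α j v ≠ 0) ∧
      ∀ v, (∀ l, j < l → α l v = 0) → ∀ w, (∀ l, j < l → α l w = 0) →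
        θ j v * α j w - θ j w * α j v = 0) (v : V) :
    (∀ l : Fin N, n ≤ l → α l v = 0) ↔ ∀ l : Fin N, n ≤ l → θ l v = 0 := by
  suffices h : ∀ e n : ℕ, N ≤ n + e → (∀ j : Fin N, n ≤ j →
      (∃ v, (∀ l, j < l → α l v = 0) ∧ α j v ≠ 0) ∧
      ∀ v, (∀ l, j < l → α l v = 0) → ∀ w, (∀ l, j < l → α l w = 0) →
        θ j v * α j w - θ j w * α j v = 0) → ∀ v,
      ((∀ l : Fin N, n ≤ l → α l v = 0) ↔ ∀ l : Fin N, n ≤ l → θ l v = 0) from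
    h N n (by omega) hα v
  -- Descending induction on `n`, with `e` bounding the number of remaining members.
  intro e
  induction e with
  | zero =>
    intro n hn _ v
    have h (l : Fin N) : ¬ n ≤ (l : ℕ) := by have := l.isLt; omega
    exact ⟨fun _ l hl => absurd hl (h l), fun _ l hl => absurd hl (h l)⟩
  | succ e ih =>
    intro n hn hα v
    by_cases hnN : n < N
    · have ih' := ih (n + 1) (by omega) fun j hj => hα j (by omega)
      obtain ⟨⟨v₀, hv₀, hv₀'⟩, hprop⟩ := hα ⟨n, hnN⟩ le_rfl
      obtain ⟨u₀, hu₀, hu₀'⟩ := hθ ⟨n, hnN⟩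
      have hlt (l : Fin N) : (⟨n, hnN⟩ : Fin N) < l ↔ n + 1 ≤ (l : ℕ) := by
        rw [Fin.lt_def]; exact Iff.rfl
      have hsplit (β : Fin N → V → ℝ) (v : V) : (∀ l : Fin N, n ≤ l → β l v = 0) ↔
          (∀ l : Fin N, n + 1 ≤ l → β l v = 0) ∧ β ⟨n, hnN⟩ v = 0 := by
        refine ⟨fun h => ⟨fun l hl => h l (by omega), h _ le_rfl⟩, fun h l hl => ?_⟩
        rcases eq_or_lt_of_le hl with h1 | h1
        · have : l = ⟨n, hnN⟩ := Fin.ext h1.symm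
          rw [this]
          exact h.2
        · exact h.1 l h1
      simp only [hlt] at hprop hv₀ hu₀
      rw [hsplit α, hsplit θ, ih']
      -- On the common zeros of the later members, which agree by induction, the two `n`-th members
      -- are proportional and neither vanishes identically, as `v₀` and `u₀` show; hence they have
      -- the same zeros.
      refine and_congr_right fun hv => ?_
      constructor
      · intro h
        have := hprop v ((ih' v).2 hv) v₀ hv₀
        rw [h, mul_zero, sub_zero] at this
        exact (mul_eq_zero.1 this).resolve_right hv₀'
      · intro h
        have := hprop v ((ih' v).2 hv) u₀ ((ih' u₀).2 hu₀)
        rw [h, zero_mul, zero_sub, neg_eq_zero] at this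
        exact (mul_eq_zero.1 this).resolve_left hu₀'
    · exact ih n (by omega) hα v

end SuccessiveKernels

/-! ### Solutions of the successive Pfaffian equations -/

section Solutions

variable {m : ℕ} {M : Type*} [TopologicalSpace M]
  [ChartedSpace (EuclideanSpace ℝ (Fin (2 * (m + 1)))) M]
  {S : SymplecticForm (m + 1) M} {f : Fin (2 * m + 1 + 1) → C^∞⟮𝓡 (2 * (m + 1)), M; 𝓘(ℝ), ℝ⟯}
  {θ : Fin (2 * m + 1) → OneForm (2 * (m + 1)) M} {I : Fin (2 * m + 1) → M → ℝ}
  {c : Fin (2 * m + 1) → ℝ} {U : Set M}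

theorem pfaffianForm_succ_hamVF_eq_zero (hθ : ∀ i, θ i = pfaffianForm S f i.succ)
    {l : Fin (2 * m + 1)} {a : Fin (2 * m + 1 + 1)} (h : a < l.succ) (x : M) :
    θ l x (S.hamVF (f a) x) = 0 := by
  rw [hθ]
  exact pfaffianForm_hamVF_of_ne S f h.ne x

theorem pfaffianForm_succ_hamVF_ne_zero (hf : FunctionallyIndependent f)
    (hθ : ∀ i, θ i = pfaffianForm S f i.succ) (l : Fin (2 * m + 1)) (x : M) :
    θ l x (S.hamVF (f l.succ) x) ≠ 0 := by
  rw [hθ]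
  exact pfaffianForm_hamVF_self_ne_zero S hf _ x

/-- The tangent space of a common level set of solutions is the common kernel of the forms. -/
theorem SolvesPfaffian.forall_mvfderiv_eq_zero_iff (hf : FunctionallyIndependent f)
    (hθ : ∀ i, θ i = pfaffianForm S f i.succ) {n : ℕ}
    (hI : ∀ j : Fin (2 * m + 1), n ≤ j → SolvesPfaffian θ I c U j (I j)) {x : M} (hx : x ∈ U)
    (hxI : ∀ j : Fin (2 * m + 1), n < j → I j x = c j) (v : TangentSpace (𝓡 (2 * (m + 1))) x) :
    (∀ l : Fin (2 * m + 1), n ≤ l → mvfderiv (𝓡 (2 * (m + 1))) (I l) x v = 0) ↔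
      ∀ l : Fin (2 * m + 1), n ≤ l → θ l x v = 0 :=
  forall_eq_zero_iff_of_proportional (α := fun l v => mvfderiv (𝓡 (2 * (m + 1))) (I l) x v)
    (θ := fun l v => θ l x v)
    (fun j => ⟨S.hamVF (f j.succ) x, fun _ hl =>
      pfaffianForm_succ_hamVF_eq_zero hθ (Fin.succ_lt_succ_iff.2 hl) x,
      pfaffianForm_succ_hamVF_ne_zero hf hθ j x⟩) n
    (fun j hj => (hI j hj).2 x ⟨hx, fun l hl => hxI l (lt_of_le_of_lt hj hl)⟩) v

/-- The tangent spaces are given by the forms, whichever solutions were chosen; this allows the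
equations to be solved one after the other. -/
theorem SolvesPfaffian.mem_levelTangentAbove_iff (hf : FunctionallyIndependent f)
    (hθ : ∀ i, θ i = pfaffianForm S f i.succ) {k : Fin (2 * m + 1)}
    (hI : ∀ j, k < j → SolvesPfaffian θ I c U j (I j)) {x : M} (hx : x ∈ levelSetAbove I c U k)
    (v : TangentSpace (𝓡 (2 * (m + 1))) x) :
    v ∈ levelTangentAbove (2 * (m + 1)) I k x ↔ ∀ l, k < l → θ l x v = 0 :=
  SolvesPfaffian.forall_mvfderiv_eq_zero_iff hf hθ (n := k + 1) (fun j hj => hI j hj) hx.1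
    (fun j hj => hx.2 j (by rw [Fin.lt_def]; omega)) v

/-- On the tangent space of the level set the kernel of `θ k` is spanned by the fields of index at
most `k`, all annihilated by `dJ`. So `dJ` is a multiple of `θ k` there, and `X_{f_{k+1}}` shows
that it is nonzero. -/
theorem SolvesPfaffian.of_first_integral (hf : FunctionallyIndependent f)
    (hθ : ∀ i, θ i = pfaffianForm S f i.succ) {k : Fin (2 * m + 1)}
    (hI : ∀ j, k < j → SolvesPfaffian θ I c U j (I j)) {V : Set M} (hV : V ⊆ U) {J : M → ℝ}
    (hJ : ContMDiffOn (𝓡 (2 * (m + 1))) 𝓘(ℝ) ∞ J V)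
    (hJX : ∀ x ∈ V, (∀ a < k.succ, mvfderiv (𝓡 (2 * (m + 1))) J x (S.hamVF (f a) x) = 0) ∧
        mvfderiv (𝓡 (2 * (m + 1))) J x (S.hamVF (f k.succ) x) ≠ 0) :
    SolvesPfaffian θ I c V k J := by
  refine ⟨hJ, fun x hx => ?_⟩
  simp only [SolvesPfaffian.mem_levelTangentAbove_iff hf hθ hI (⟨hV hx.1, hx.2⟩ :
    x ∈ levelSetAbove I c U k)]
  refine ⟨⟨S.hamVF (f k.succ) x, fun l hl =>
    pfaffianForm_succ_hamVF_eq_zero hθ (Fin.succ_lt_succ_iff.2 hl) x, (hJX x hx.1).2⟩, ?_⟩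
  intro v hv w hw
  have key : ∀ u, (∀ l, k < l → θ l x u = 0) → θ k x u = 0 →
      mvfderiv (𝓡 (2 * (m + 1))) J x u = 0 := by
    intro u hu huk
    have h1 : u ∈ Submodule.span ℝ ((fun a => S.hamVF (f a) x) '' Iio k.succ) := by
      refine (forall_pfaffianForm_eq_zero_iff S hf x u k.succ).1 fun i hi => ?_
      obtain ⟨l, rfl⟩ := Fin.exists_succ_eq.2 (lt_of_lt_of_le (Fin.succ_pos k) hi).ne'
      rw [← hθ]
      rcases eq_or_lt_of_le (Fin.succ_le_succ_iff.1 hi) with h | h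
      · rw [← h]
        exact huk
      · exact hu l h
    exact (Submodule.span_le (p := LinearMap.ker
      (mvfderiv (𝓡 (2 * (m + 1))) J x).toLinearMap)).2 (by
        rintro _ ⟨a, ha, rfl⟩
        exact (hJX x hx.1).1 a ha) h1
  -- This combination of two tangent vectors lies in the kernel of `θ k`.
  have h1 := key (θ k x v • w - θ k x w • v)
    (fun l hl => by rw [map_sub, map_smul, map_smul, hv l hl, hw l hl, smul_zero, smul_zero, sub_zero])
    (by rw [map_sub, map_smul, map_smul, smul_eq_mul, smul_eq_mul, mul_comm, sub_self])
  rwa [map_sub, map_smul, map_smul, smul_eq_mul, smul_eq_mul] at h1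

/-- Proportionality is applied to `X_{f_{k+1}}` and `X_{f_0}`, both tangent to the level set: `θ k`
vanishes on the second but not on the first. -/
theorem SolvesPfaffian.mvfderiv_hamVF_eq_zero (hf : FunctionallyIndependent f)
    (hθ : ∀ i, θ i = pfaffianForm S f i.succ) {k : Fin (2 * m + 1)}
    (hI : ∀ j, k ≤ j → SolvesPfaffian θ I c U j (I j)) {x : M} (hx : x ∈ levelSetAbove I c U k) :
    mvfderiv (𝓡 (2 * (m + 1))) (I k) x (S.hamVF (f 0) x) = 0 := by
  have hmem := fun v => SolvesPfaffian.mem_levelTangentAbove_iff hf hθ (fun j hj => hI j hj.le) hx v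
  have h1 := ((hI k le_rfl).2 x hx).2 (S.hamVF (f k.succ) x)
    ((hmem _).2 fun l hl => pfaffianForm_succ_hamVF_eq_zero hθ (Fin.succ_lt_succ_iff.2 hl) x)
    (S.hamVF (f 0) x)
    ((hmem _).2 fun l _ => pfaffianForm_succ_hamVF_eq_zero hθ (Fin.succ_pos l) x)
  rw [pfaffianForm_succ_hamVF_eq_zero hθ (Fin.succ_pos k) x, zero_mul, sub_zero] at h1
  exact (mul_eq_zero.1 h1).resolve_left (pfaffianForm_succ_hamVF_ne_zero hf hθ k x)

variable [IsManifold (𝓡 (2 * (m + 1))) ∞ M]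

theorem exists_solvesPfaffian (hf : FunctionallyIndependent f) (hinv : IsInvolutiveFamily S f)
    (hθ : ∀ i, θ i = pfaffianForm S f i.succ) {k : Fin (2 * m + 1)} (hU : IsOpen U)
    (hI : ∀ j, k < j → SolvesPfaffian θ I c U j (I j)) {p : M} (hp : p ∈ levelSetAbove I c U k) :
    ∃ V : Set M, IsOpen V ∧ p ∈ V ∧ V ⊆ U ∧ ∃ u : M → ℝ, SolvesPfaffian θ I c V k u := by
  obtain ⟨V, J, hV, hpV, hJ, hJX⟩ := exists_first_integral S hf hinv p k.succ
  exact ⟨V ∩ U, hV.inter hU, ⟨hpV, hp.1⟩, inter_subset_right, J,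
    SolvesPfaffian.of_first_integral hf hθ hI inter_subset_right (hJ.mono inter_subset_left)
      fun x hx => hJX x hx.1⟩

/-- The first integrals have their properties on a whole neighbourhood, hence serve for every `c`.
The descending induction only identifies the tangent spaces of the level sets. -/
theorem exists_forall_solvesPfaffian (hf : FunctionallyIndependent f)
    (hinv : IsInvolutiveFamily S f) (hθ : ∀ i, θ i = pfaffianForm S f i.succ) (p : M) :
    ∃ U : Set M, IsOpen U ∧ p ∈ U ∧ ∃ I : Fin (2 * m + 1) → M → ℝ,
      ∀ c k, SolvesPfaffian θ I c U k (I k) := by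
  choose V J hV hpV hJ hJX using fun k : Fin (2 * m + 1) =>
    exists_first_integral S hf hinv p k.succ
  refine ⟨⋂ k, V k, isOpen_iInter_of_finite hV, mem_iInter.2 hpV, J, fun c k => ?_⟩
  induction k using WellFoundedGT.induction with
  | ind k ih =>
    exact SolvesPfaffian.of_first_integral hf hθ ih subset_rfl ((hJ k).mono (iInter_subset V k))
      fun x hx => hJX k x (mem_iInter.1 hx k)

end Solutions

/-! ### Level sets that are integral curves -/

section LevelCurve

variable {E ι : Type*} [NormedAddCommGroup E] [NormedSpace ℝ E] [FiniteDimensional ℝ E]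

/-- Composition with a left inverse of the injective differential has the identity as derivative,
and the inverse function theorem applies. -/
theorem exists_isOpen_injOn_of_forall_fderiv [Fintype ι] {O : Set E} (hO : IsOpen O) {y₀ : E} (hy₀ : y₀ ∈ O)
    {G : ι → E → ℝ} (hG : ∀ i, ContDiffOn ℝ ∞ (G i) O)
    (hker : ∀ v, (∀ i, fderiv ℝ (G i) y₀ v = 0) → v = 0) :
    ∃ W, IsOpen W ∧ y₀ ∈ W ∧ InjOn (fun y i => G i y) W := by
  have hstrict : HasStrictFDerivAt (fun y i => G i y)
      (ContinuousLinearMap.pi fun i => fderiv ℝ (G i) y₀) y₀ :=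
    hasStrictFDerivAt_pi.2 fun i =>
      ((hG i).contDiffAt (hO.mem_nhds hy₀)).hasStrictFDerivAt (by simp)
  obtain ⟨L, hL⟩ := LinearMap.exists_leftInverse_of_injective
    (ContinuousLinearMap.pi fun i => fderiv ℝ (G i) y₀).toLinearMap
    (LinearMap.ker_eq_bot'.2 fun v hv => hker v fun i => congrFun hv i)
  have h1 : HasStrictFDerivAt (L.toContinuousLinearMap ∘ fun y i => G i y)
      ((ContinuousLinearEquiv.refl ℝ E : E ≃L[ℝ] E) : E →L[ℝ] E) y₀ := by
    have h2 : ((ContinuousLinearEquiv.refl ℝ E : E ≃L[ℝ] E) : E →L[ℝ] E) =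
        L.toContinuousLinearMap.comp (ContinuousLinearMap.pi fun i => fderiv ℝ (G i) y₀) := by
      ext v
      exact (DFunLike.congr_fun hL v).symm
    rw [h2]
    exact L.toContinuousLinearMap.hasStrictFDerivAt.comp y₀ hstrict
  refine ⟨(h1.toOpenPartialHomeomorph _).source, (h1.toOpenPartialHomeomorph _).open_source,
    h1.mem_toOpenPartialHomeomorph_source, fun a ha b hb hab => ?_⟩
  exact (h1.toOpenPartialHomeomorph _).injOn ha hb (congrArg L.toContinuousLinearMap hab)

/-- If the functions `G i` are constant along the integral curves of `X` and the common kernel of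
their differentials at `y₀` is spanned by `X y₀`, then their common level set near `y₀` is an
integral curve. -/
theorem exists_integralCurve_eq_levelSet [Finite ι] {O : Set E} (hO : IsOpen O) {y₀ : E}
    (hy₀ : y₀ ∈ O) {X : E → E} (hX : ContDiffOn ℝ ∞ X O) (hX₀ : X y₀ ≠ 0)
    {G : ι → E → ℝ} (hG : ∀ i, ContDiffOn ℝ ∞ (G i) O)
    (hker : ∀ v, (∀ i, fderiv ℝ (G i) y₀ v = 0) → v ∈ Submodule.span ℝ {X y₀})
    (hconst : ∀ (δ : ℝ → E) (ε : ℝ), δ 0 = y₀ → (∀ t ∈ Ioo (-ε) ε, δ t ∈ O) →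
      (∀ t ∈ Ioo (-ε) ε, HasDerivAt δ (X (δ t)) t) → ∀ t ∈ Ioo (-ε) ε, ∀ i, G i (δ t) = G i y₀) :
    ∃ W, IsOpen W ∧ y₀ ∈ W ∧ W ⊆ O ∧ ∃ (δ : ℝ → E) (ε : ℝ), 0 < ε ∧ δ 0 = y₀ ∧
      (∀ t ∈ Ioo (-ε) ε, HasDerivAt δ (X (δ t)) t) ∧
      {y ∈ W | ∀ i, G i y = G i y₀} = δ '' Ioo (-ε) ε := by
  have := Fintype.ofFinite ι
  -- A functional positive on `X y₀` completes the `G i`: the differentials have no common kernel,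
  -- so the joint map is injective near `y₀`. Along the curve `ℓ` increases and serves as a
  -- parameter.
  obtain ⟨ℓ, -, hℓ⟩ := exists_dual_vector ℝ (X y₀) (norm_ne_zero_iff.2 hX₀)
  replace hℓ : 0 < ℓ (X y₀) := by
    rw [hℓ]
    exact norm_pos_iff.2 hX₀
  obtain ⟨W₁, hW₁o, hy₁, hinj⟩ := exists_isOpen_injOn_of_forall_fderiv (ι := Option ι) hO hy₀
    (G := fun o => o.elim ℓ G)
    (by
      rintro (_ | i)
      · exact ℓ.contDiff.contDiffOn
      · exact hG i)
    (by
      intro v hv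
      obtain ⟨a, rfl⟩ := Submodule.mem_span_singleton.1 (hker v fun i => hv (some i))
      have h1 : fderiv ℝ ℓ y₀ (a • X y₀) = 0 := hv none
      rw [ℓ.fderiv, map_smul, smul_eq_mul] at h1
      rw [(mul_eq_zero.1 h1).resolve_right hℓ.ne', zero_smul])
  let W₀ := (O ∩ (fun y => ℓ (X y)) ⁻¹' Ioi 0) ∩ W₁
  have hW₀o : IsOpen W₀ :=
    ((ℓ.continuous.comp_continuousOn hX.continuousOn).isOpen_inter_preimage hO isOpen_Ioi).inter
      hW₁o
  have hy₀W : y₀ ∈ W₀ := ⟨⟨hy₀, hℓ⟩, hy₁⟩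
  obtain ⟨δ, hδ₀, ε₀, hε₀, hδ⟩ := ((hX.contDiffAt (hO.mem_nhds hy₀)).of_le
    (by simp : (1 : WithTop ℕ∞) ≤ ∞)).exists_forall_mem_closedBall_exists_eq_forall_mem_Ioo_hasDerivAt₀ 0
  rw [zero_sub, zero_add] at hδ
  have hc : ContinuousAt δ 0 := (hδ 0 ⟨by linarith, hε₀⟩).continuousAt
  obtain ⟨ε₁, hε₁, hball⟩ := Metric.mem_nhds_iff.1
    (hc (by rw [hδ₀]; exact hW₀o.mem_nhds hy₀W : W₀ ∈ 𝓝 (δ 0)))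
  let e := min ε₀ ε₁
  have he : 0 < e := lt_min hε₀ hε₁
  have hδe : ∀ t ∈ Ioo (-e) e, HasDerivAt δ (X (δ t)) t := fun t ht =>
    hδ t ⟨by linarith [ht.1, min_le_left ε₀ ε₁], by linarith [ht.2, min_le_left ε₀ ε₁]⟩
  have hδW : ∀ t ∈ Ioo (-e) e, δ t ∈ W₀ := fun t ht => hball (by
    rw [Metric.mem_ball, Real.dist_0_eq_abs, abs_lt]
    exact ⟨by linarith [ht.1, min_le_right ε₀ ε₁], by linarith [ht.2, min_le_right ε₀ ε₁]⟩)
  have hmono : StrictMonoOn (fun t => ℓ (δ t)) (Ioo (-e) e) := by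
    have hd : ∀ t ∈ Ioo (-e) e, HasDerivAt (fun t => ℓ (δ t)) (ℓ (X (δ t))) t := fun t ht =>
      ℓ.hasFDerivAt.comp_hasDerivAt t (hδe t ht)
    refine strictMonoOn_of_deriv_pos (convex_Ioo _ _)
      (fun t ht => (hd t ht).continuousAt.continuousWithinAt) fun t ht => ?_
    rw [interior_Ioo] at ht
    rw [(hd t ht).deriv]
    exact (hδW t ht).1.2
  have hsub : Icc (-(e / 2)) (e / 2) ⊆ Ioo (-e) e := fun t ht =>
    ⟨by linarith [ht.1], by linarith [ht.2]⟩
  have hl : -(e / 2) ∈ Ioo (-e) e := hsub ⟨le_rfl, by linarith⟩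
  have hr : e / 2 ∈ Ioo (-e) e := hsub ⟨by linarith, le_rfl⟩
  have hconst' : ∀ t ∈ Ioo (-e) e, ∀ i, G i (δ t) = G i y₀ :=
    hconst δ e hδ₀ (fun t ht => (hδW t ht).1.1) hδe
  have hIoo : ∀ t ∈ Ioo (-(e / 2)) (e / 2), t ∈ Ioo (-e) e := fun t ht =>
    hsub (Ioo_subset_Icc_self ht)
  -- Cutting by the values of `ℓ` at times `±e / 2` lets the intermediate value theorem find, for
  -- each point of the level set, a point of the curve with the same `ℓ`; injectivity identifies the
  -- two.
  refine ⟨W₀ ∩ ℓ ⁻¹' Ioo (ℓ (δ (-(e / 2)))) (ℓ (δ (e / 2))),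
    hW₀o.inter (isOpen_Ioo.preimage ℓ.continuous), ⟨hy₀W, ?_⟩, fun y hy => hy.1.1.1, δ, e / 2,
    by linarith, hδ₀, fun t ht => hδe t (hIoo t ht), ?_⟩
  · have h0 : (0 : ℝ) ∈ Ioo (-e) e := ⟨by linarith, he⟩
    rw [mem_preimage, ← hδ₀]
    exact ⟨hmono hl h0 (by linarith), hmono h0 hr (by linarith)⟩
  · ext y
    constructor
    · rintro ⟨⟨hy, hyℓ⟩, hyG⟩
      obtain ⟨t, ht, hty⟩ := intermediate_value_Ioo (by linarith : -(e / 2) ≤ e / 2)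
        (f := fun t => ℓ (δ t)) (fun t ht =>
          (ℓ.continuous.continuousAt.comp (hδe t (hsub ht)).continuousAt).continuousWithinAt) hyℓ
      refine ⟨t, ht, hinj (hδW t (hIoo t ht)).2 hy.2 ?_⟩
      funext o
      rcases o with _ | i
      · exact hty
      · exact (hconst' t (hIoo t ht) i).trans (hyG i).symm
    · rintro ⟨t, ht, rfl⟩
      exact ⟨⟨hδW t (hIoo t ht), hmono hl (hIoo t ht) ht.1, hmono (hIoo t ht) hr ht.2⟩,
        hconst' t (hIoo t ht)⟩

end LevelCurve

/-! ### Integral manifolds of the Hamiltonian distribution -/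

section IntegralManifold

variable {m : ℕ} {M : Type*} [TopologicalSpace M]
  [ChartedSpace (EuclideanSpace ℝ (Fin (2 * (m + 1)))) M]
  {S : SymplecticForm (m + 1) M} {f : Fin (2 * m + 1 + 1) → C^∞⟮𝓡 (2 * (m + 1)), M; 𝓘(ℝ), ℝ⟯}
  {θ : Fin (2 * m + 1) → OneForm (2 * (m + 1)) M} {I : Fin (2 * m + 1) → M → ℝ}
  {c : Fin (2 * m + 1) → ℝ} {U : Set M}

theorem forall_pfaffianForm_succ_eq_zero_iff (hf : FunctionallyIndependent f)
    (hθ : ∀ i, θ i = pfaffianForm S f i.succ) (x : M) (v : TangentSpace (𝓡 (2 * (m + 1))) x) :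
    (∀ i, θ i x v = 0) ↔ v ∈ Submodule.span ℝ {S.hamVF (f 0) x} := by
  have h1 : Iio (1 : Fin (2 * m + 1 + 1)) = {0} := by
    ext a
    rw [mem_Iio, mem_singleton_iff]
    exact Fin.lt_one_iff a
  have h2 := forall_pfaffianForm_eq_zero_iff S hf x v 1
  rw [h1, image_singleton] at h2
  rw [← h2]
  refine ⟨fun h i hi => ?_, fun h i => ?_⟩
  · obtain ⟨l, rfl⟩ := Fin.exists_succ_eq.2 (lt_of_lt_of_le Fin.zero_lt_one hi).ne'
    rw [← hθ]
    exact h l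
  · rw [hθ]
    exact h _ (Fin.le_def.2 (by simp))

theorem SolvesPfaffian.forall_mvfderiv_eq_zero_iff_mem_span (hf : FunctionallyIndependent f)
    (hθ : ∀ i, θ i = pfaffianForm S f i.succ) (hI : ∀ k, SolvesPfaffian θ I c U k (I k)) {x : M}
    (hx : x ∈ U) (hxc : ∀ k, I k x = c k) (v : TangentSpace (𝓡 (2 * (m + 1))) x) :
    (∀ k, mvfderiv (𝓡 (2 * (m + 1))) (I k) x v = 0) ↔ v ∈ Submodule.span ℝ {S.hamVF (f 0) x} := by
  have h := SolvesPfaffian.forall_mvfderiv_eq_zero_iff hf hθ (n := 0) (fun j _ => hI j) hx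
    (fun j _ => hxc j) v
  simp only [zero_le, true_imp_iff] at h
  rw [h, forall_pfaffianForm_succ_eq_zero_iff hf hθ]

variable [IsManifold (𝓡 (2 * (m + 1))) ∞ M]

/-- Common level sets of solutions of all the equations are integral curves of `X_{f_0}`. -/
theorem SolvesPfaffian.exists_isMIntegralCurveOn (hf : FunctionallyIndependent f)
    (hθ : ∀ i, θ i = pfaffianForm S f i.succ) (hU : IsOpen U)
    (hI : ∀ k, SolvesPfaffian θ I c U k (I k)) {p : M} (hp : p ∈ U) (hpc : ∀ k, I k p = c k) :
    ∃ V : Set M, IsOpen V ∧ p ∈ V ∧ V ⊆ U ∧ ∃ (γ : ℝ → M) (ε : ℝ), 0 < ε ∧ γ 0 = p ∧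
      IsMIntegralCurveOn γ (S.hamVF (f 0)) (Ioo (-ε) ε) ∧
      {x ∈ V | ∀ k, I k x = c k} = γ '' Ioo (-ε) ε := by
  have hyT := mem_extChartAt_target (I := 𝓡 (2 * (m + 1))) p
  have hpy : (extChartAt (𝓡 (2 * (m + 1))) p).symm (extChartAt (𝓡 (2 * (m + 1))) p p) = p :=
    extChartAt_to_inv p
  set y₀ := extChartAt (𝓡 (2 * (m + 1))) p p with hy₀
  let ψ := (extChartAt (𝓡 (2 * (m + 1))) p).symm
  have hTo := isOpen_extChartAt_target (I := 𝓡 (2 * (m + 1))) p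
  let O := (extChartAt (𝓡 (2 * (m + 1))) p).target ∩ ψ ⁻¹' U
  have hO : IsOpen O := (continuousOn_extChartAt_symm p).isOpen_inter_preimage hTo hU
  have hyO : y₀ ∈ O := ⟨hyT, by rw [mem_preimage, hpy]; exact hp⟩
  have hG : ∀ k, ContDiffOn ℝ ∞ (I k ∘ ψ) O := fun k =>
    ((hI k).1.comp ((contMDiffOn_extChartAt_symm p).mono inter_subset_left)
      fun _ hy => hy.2).contDiffOn
  have hId : ∀ k, ∀ y ∈ O, MDifferentiableAt (𝓡 (2 * (m + 1))) 𝓘(ℝ) (I k) (ψ y) := fun k y hy =>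
    ((hI k).1.contMDiffAt (hU.mem_nhds hy.2)).mdifferentiableAt (by simp)
  have hX := (S.contDiffOn_chartVF_hamVF (f 0).contMDiff p).mono
    (inter_subset_left : O ⊆ (extChartAt (𝓡 (2 * (m + 1))) p).target)
  have hX₀ : chartVF (S.hamVF (f 0)) p y₀ ≠ 0 := by
    intro h
    have h1 := chartFrame_chartVF (S.hamVF (f 0)) hyT
    rw [h, map_zero] at h1
    exact (linearIndependent_hamVF S hf _).ne_zero 0 h1.symm
  obtain ⟨W, hWo, hyW, hWO, δ, ε, hε, hδ₀, hδ, hset⟩ := exists_integralCurve_eq_levelSet hO hyO hX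
    hX₀ hG (by
      intro v hv
      have h1 : chartFrame p y₀ v ∈ Submodule.span ℝ {S.hamVF (f 0) (ψ y₀)} := by
        refine (SolvesPfaffian.forall_mvfderiv_eq_zero_iff_mem_span hf hθ hI hyO.2
          (fun k => by rw [hpy]; exact hpc k) _).1 fun k => ?_
        rw [← fderiv_comp_extChartAt_symm hyT (hId k y₀ hyO)]
        exact hv k
      obtain ⟨a, ha⟩ := Submodule.mem_span_singleton.1 h1
      refine Submodule.mem_span_singleton.2 ⟨a, ?_⟩
      obtain ⟨e, he⟩ := isInvertible_chartFrame hyT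
      refine e.injective ?_
      have he' (w) : e w = chartFrame p y₀ w := by rw [← he]; rfl
      rw [he', he', map_smul, chartFrame_chartVF _ hyT]
      exact ha)
    (by
      -- `I k` is known to be stationary along the field only on the level set of the later
      -- functions, so constancy along the curve is proved from the last function downwards.
      intro δ ε hδ₀ hδO hδ t ht k
      induction k using WellFoundedGT.induction generalizing t with
      | ind k ih =>
        have hd : ∀ s ∈ Ioo (-ε) ε, HasDerivAt ((I k ∘ ψ) ∘ δ) 0 s := by
          intro s hs
          have h1 := (((hG k).contDiffAt (hO.mem_nhds (hδO s hs))).differentiableAt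
            (by simp)).hasFDerivAt.comp_hasDerivAt s (hδ s hs)
          have h2 : fderiv ℝ (I k ∘ ψ) (δ s) (chartVF (S.hamVF (f 0)) p (δ s)) = 0 := by
            refine (fderiv_comp_extChartAt_symm_chartVF (hδO s hs).1 (hId k _ (hδO s hs)) _).trans ?_
            refine SolvesPfaffian.mvfderiv_hamVF_eq_zero hf hθ (fun j _ => hI j)
              ⟨(hδO s hs).2, fun j hj => ?_⟩
            rw [← hpc j]
            refine (ih j hj s hs).trans ?_
            rw [Function.comp_apply, hpy]
          rwa [h2] at h1
        have h0 : (0 : ℝ) ∈ Ioo (-ε) ε := ⟨by linarith [ht.1, ht.2], by linarith [ht.1, ht.2]⟩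
        have h1 := isOpen_Ioo.is_const_of_deriv_eq_zero isPreconnected_Ioo
          (fun s hs => (hd s hs).differentiableAt.differentiableWithinAt)
          (fun s hs => (hd s hs).deriv) ht h0
        rw [← hδ₀]
        exact h1)
  have hδW : ∀ t ∈ Ioo (-ε) ε, δ t ∈ W ∧ ∀ k, (I k ∘ ψ) (δ t) = (I k ∘ ψ) y₀ := fun t ht => by
    have : δ t ∈ {y ∈ W | ∀ k, (I k ∘ ψ) y = (I k ∘ ψ) y₀} := by
      rw [hset]
      exact mem_image_of_mem δ ht
    exact this
  have hc : ∀ k, (I k ∘ ψ) y₀ = c k := fun k => by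
    rw [Function.comp_apply, hpy, hpc]
  refine ⟨(extChartAt (𝓡 (2 * (m + 1))) p).source ∩ extChartAt (𝓡 (2 * (m + 1))) p ⁻¹' W,
    (continuousOn_extChartAt p).isOpen_inter_preimage (isOpen_extChartAt_source p) hWo,
    ⟨mem_extChartAt_source p, hyW⟩, ?_, ψ ∘ δ, ε, hε, ?_, ?_, ?_⟩
  · rintro x ⟨hx, hxW⟩
    have := (hWO hxW).2
    rwa [mem_preimage, (extChartAt (𝓡 (2 * (m + 1))) p).left_inv hx] at this
  · rw [Function.comp_apply, hδ₀, hpy]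
  · intro t ht
    have hT := (hWO (hδW t ht).1).1
    have h1 := (mdifferentiableAt_extChartAt_symm hT).hasMFDerivAt.comp t
      (hδ t ht).hasFDerivAt.hasMFDerivAt
    refine HasMFDerivAt.hasMFDerivWithinAt ?_
    refine (congrArg (HasMFDerivAt 𝓘(ℝ, ℝ) (𝓡 (2 * (m + 1))) (ψ ∘ δ) t) ?_).mp h1
    refine ContinuousLinearMap.ext fun (a : ℝ) => ?_
    change chartFrame p (δ t) (a • chartVF (S.hamVF (f 0)) p (δ t)) =
      a • S.hamVF (f 0) (ψ (δ t))
    rw [map_smul, chartFrame_chartVF (S.hamVF (f 0)) hT]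
  · ext x
    constructor
    · rintro ⟨⟨hx, hxW⟩, hxc⟩
      have hxy := (extChartAt (𝓡 (2 * (m + 1))) p).left_inv hx
      obtain ⟨t, ht, hty⟩ : extChartAt (𝓡 (2 * (m + 1))) p x ∈ δ '' Ioo (-ε) ε := by
        rw [← hset]
        exact ⟨hxW, fun k => by rw [hc, Function.comp_apply, hxy, hxc]⟩
      exact ⟨t, ht, by rw [Function.comp_apply, hty, hxy]⟩
    · rintro ⟨t, ht, rfl⟩
      obtain ⟨h1, h2⟩ := hδW t ht
      refine ⟨⟨(extChartAt (𝓡 (2 * (m + 1))) p).map_target (hWO h1).1, ?_⟩, fun k =>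
        (h2 k).trans (hc k)⟩
      rw [mem_preimage, Function.comp_apply, (extChartAt (𝓡 (2 * (m + 1))) p).right_inv (hWO h1).1]
      exact h1

end IntegralManifold
end

/-! ### The main theorem -/

theorem mainTheorem3 (m : ℕ) {M : Type*} [TopologicalSpace M]
    [ChartedSpace (EuclideanSpace ℝ (Fin (2 * (m + 1)))) M]
    [IsManifold (𝓡 (2 * (m + 1))) ∞ M]
    (S : SymplecticForm (m + 1) M)
    (H : C^∞⟮𝓡 (2 * (m + 1)), M; 𝓘(ℝ), ℝ⟯)
    (𝓕 : Fin (2 * m) → C^∞⟮𝓡 (2 * (m + 1)), M; 𝓘(ℝ), ℝ⟯)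
    (h𝓕 : IsPoissonCInfStructure S H 𝓕)
    (g : C^∞⟮𝓡 (2 * (m + 1)), M; 𝓘(ℝ), ℝ⟯)
    (hg : FunctionallyIndependent (fullFamily H 𝓕 g))
    (f : Fin (2 * m + 1 + 1) → C^∞⟮𝓡 (2 * (m + 1)), M; 𝓘(ℝ), ℝ⟯)
    (hf : f = fullFamily H 𝓕 g)
    -- `θ i` is the form with index `i + 1`, so that the indices `1, …, 2n - 1` are covered
    (θ : Fin (2 * m + 1) → OneForm (2 * (m + 1)) M)
    (hθ : ∀ i, θ i = pfaffianForm S f i.succ) :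
    -- the forms are the contractions of the Liouville volume form
    (∀ (i : Fin (2 * m + 1)) (x : M) (Z : TangentSpace (𝓡 (2 * (m + 1))) x),
      θ i x Z = S.liouville x
        (Fin.snoc (α := fun _ => TangentSpace (𝓡 (2 * (m + 1))) x)
          (fun a : Fin (2 * m + 1) => S.hamVF (f (i.succ.succAbove a)) x) Z)) ∧
    -- they are smooth, independent, and their common kernel is the Hamiltonian distribution
    (∀ i, (θ i).toDForm.IsSmooth) ∧
    (∀ x : M, LinearIndependent ℝ (fun i => θ i x)) ∧
    (∀ (x : M) (v : TangentSpace (𝓡 (2 * (m + 1))) x),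
      (∀ i, θ i x v = 0) ↔ v ∈ Submodule.span ℝ {S.hamVF H x}) ∧
    -- `dω_i = 0` modulo `ω_i, …, ω_{2n-1}`
    (∀ i, ∃ β : Fin (2 * m + 1) → OneForm (2 * (m + 1)) M,
      (∀ j, (β j).toDForm.IsSmooth) ∧
      ∀ x : M, ((θ i).toDForm.extD x).toAlternatingMap =
        ∑ j ∈ Finset.Ici i,
          wedge ((β j).toDForm x).toAlternatingMap ((θ j).toDForm x).toAlternatingMap) ∧
    -- each equation is locally solvable on every level set given by solutions of the later ones
    (∀ (U : Set M) (I : Fin (2 * m + 1) → M → ℝ) (c : Fin (2 * m + 1) → ℝ)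
      (k : Fin (2 * m + 1)), IsOpen U → (∀ j, k < j → SolvesPfaffian θ I c U j (I j)) →
      ∀ p ∈ levelSetAbove I c U k, ∃ V : Set M, IsOpen V ∧ p ∈ V ∧ V ⊆ U ∧
        ∃ u : M → ℝ, SolvesPfaffian θ I c V k u) ∧
    -- near every point there are functions solving all equations on all level sets at once
    (∀ p : M, ∃ U : Set M, IsOpen U ∧ p ∈ U ∧ ∃ I : Fin (2 * m + 1) → M → ℝ,
      ∀ c k, SolvesPfaffian θ I c U k (I k)) ∧
    -- the solutions describe the integral manifolds of the Hamiltonian distribution implicitly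
    (∀ (U : Set M) (I : Fin (2 * m + 1) → M → ℝ) (c : Fin (2 * m + 1) → ℝ), IsOpen U →
      (∀ k, SolvesPfaffian θ I c U k (I k)) →
      ∀ p ∈ U, (∀ k, I k p = c k) →
        (∀ v : TangentSpace (𝓡 (2 * (m + 1))) p,
          (∀ k, mvfderiv (𝓡 (2 * (m + 1))) (I k) p v = 0) ↔
            v ∈ Submodule.span ℝ {S.hamVF H p}) ∧
        ∃ V : Set M, IsOpen V ∧ p ∈ V ∧ V ⊆ U ∧
          ∃ (γ : ℝ → M) (ε : ℝ), 0 < ε ∧ γ 0 = p ∧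
            IsMIntegralCurveOn γ (S.hamVF H) (Ioo (-ε) ε) ∧
            {x ∈ V | ∀ k, I k x = c k} = γ '' Ioo (-ε) ε) := by
  have hinv : IsInvolutiveFamily S f := hf ▸ h𝓕.isInvolutiveFamily g
  have hfi : FunctionallyIndependent f := hf ▸ hg
  have hf0 : f 0 = H := by
    rw [hf]
    exact (Fin.snoc_castSucc (α := fun _ => C^∞⟮𝓡 (2 * (m + 1)), M; 𝓘(ℝ), ℝ⟯) _ _ 0).trans
      (Fin.cons_zero _ _)
  refine ⟨fun i x Z => ?_, fun i => ?_, fun x => ?_, fun x v => ?_, fun i => ?_,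
    fun U I c k hU hI p hp => exists_solvesPfaffian hfi hinv hθ hU hI hp,
    fun p => exists_forall_solvesPfaffian hfi hinv hθ p, fun U I c hU hI p hp hpc => ⟨fun v => ?_, ?_⟩⟩
  · rw [hθ]
    exact pfaffianForm_apply S f i.succ x Z
  · rw [hθ]
    exact isSmooth_pfaffianForm S i.succ
  · simp only [hθ]
    exact (linearIndependent_pfaffianForm S hfi x).comp _ (Fin.succ_injective _)
  · rw [← hf0]
    exact forall_pfaffianForm_succ_eq_zero_iff hfi hθ x v
  · simp only [hθ]
    exact exists_extD_pfaffianForm_eq S hfi hinv i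
  · rw [← hf0]
    exact SolvesPfaffian.forall_mvfderiv_eq_zero_iff_mem_span hfi hθ hI hp hpc v
  · rw [← hf0]
    exact SolvesPfaffian.exists_isMIntegralCurveOn hfi hθ hU hI hp hpc
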